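/- **The graphs.** Let $\mathbf k=(k_1,\dots,k_r)$, $r\ge 1$, be positive integers. $\mathrm{Path}(\mathbf k)$ is the directed multigraph with one source $s$, one sink $t$ and $1+\sum k_i$ inner vertices, numbered consecutively, such that consecutive inner vertices are joined by one edge; the first $k_1$ of these inner edges point in one direction along the numbering (either one), the next $k_2$ in the opposite direction, and so on; and edges $s\to v$ and $v\to t$ are added, with multiplicity, until every inner vertex $v$ has indegree and outdegree $2$. For even $r$, $\mathrm{Cycle}(\mathbf k)$ is obtained in the same way from an undirected cycle with $\sum k_i$ inner vertices (numbered cyclically, starting at the tail of the first $k_1$ edges, which point upwards). The $r$ maximal directed inner paths are called legs. A *route* is a directed path from $s$ to $t$. **Framings.** A *framing* $F$ is a linear order on the incoming and on the outgoing edges of each inner vertex. At an inner vertex, two distinct partial routes ending (starting) there are compared by the last (first) edges in which they diverge. Two routes *conflict* if at some common subroute (possibly one vertex) the parts before it and the parts after it are ordered differently; otherwise they are *coherent*. A route is *exceptional* if it is coherent with every route. $F$ is *ample* if the indicator vectors of the exceptional routes are not all contained in one facet of the cone of nonnegative flows. At each inner vertex label the smaller incoming edge $1$ and the larger one $2$,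 and likewise for outgoing edges (for ample $F$ the two labels of an inner edge agree). The *g-vector* of a route has, at the inner vertex $v$, the entry $-1$ if the route enters $v$ with label $1$ and leaves with label $2$, the entry $1$ if it enters with label $2$ and leaves with label $1$, and $0$ otherwise. The *g-polytope* $P$ is the convex hull of all g-vectors. $F$ is *locally anti-blocking* if for every sign vector $\sigma$ and every $x\in\sigma P$ with $x\ge 0$, all $y$ with $0\le y_i\le x_i$ for all $i$ lie in $\sigma P$. The *DKK triangulation* $\mathcal T$ of $P$ consists of the simplices $\mathrm{conv}\{g(R):R\in M\}$, where $M$ runs over the maximal sets of pairwise coherent routes. **Pulling.** *Pulling* a subdivision of $P$ at $x\in P$ keeps the cells not containing $x$ and replaces each cell $S\ni x$ by the pyramids $\mathrm{conv}(\Phi\cup\{x\})$ over the facets $\Phi\not\ni x$ of $S$. A *pulling triangulation* of $P$ is a triangulation obtained from $\{P\}$ by successively pulling at points of $P$. **The coherence diagram.** Let $F$ be ample and locally anti-blocking. Then labels are constant on each leg, and, after interchanging the labels $1$ and $2$ if necessary, the legs pointing upwards in the numbering have label $2$ and the others label $1$. Rows (top to bottom) are indexed by the source edges, ordered by vertex number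 and, at the same vertex, label $2$ before label $1$; columns (left to right) by the sink edges, ordered by vertex number and, at the same vertex, label $1$ before label $2$. A route is the box in the row of its source edge and the column of its sink edge, except that for $\mathrm{Cycle}(\mathbf k)$ the two rows of the source edges at the first vertex are repeated below all others and hold the routes on the last leg that start at that vertex. Each route lies on exactly one leg; the box of the unique exceptional route with more than two edges on that leg is the corner of the leg. The distance of a route is the number of diagonals (lines running from upper left to lower right, i.e. with constant row minus column) from the corner of its leg to its box. **Theorem.** Let $P$ be the g-polytope of $\mathrm{Path}(\mathbf k)$ or $\mathrm{Cycle}(\mathbf k)$ with a locally anti-blocking ample framing $F$. Then the DKK triangulation $\mathcal T$ of $P$ is a unimodular triangulation and a pulling triangulation. Explicitly, $\mathcal T$ is obtained by pulling $\{P\}$ first at the origin and then at the g-vectors of all non-exceptional routes, each once, in order of increasing distance, where routes on the same leg at the same distance are taken along their diagonal from upper left to lower right, and the order between routes at the same distance on different legs is arbitrary. Such an order exists. -/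

import Mathlib

namespace GPoly

/-! ## Polytopes, subdivisions and pulling -/

section Polyhedra

variable {W : Type*} [AddCommGroup W] [Module ℝ W] [TopologicalSpace W]

/-- `Φ` is a facet of the convex polyhedron `S`: a maximal proper face. The faces of a polyhedron
are its exposed faces; the empty face is allowed by `IsExposed`. -/
def IsFacet (S Φ : Set W) : Prop :=
  IsExposed ℝ S Φ ∧ Φ ≠ S ∧ ∀ Ψ : Set W, IsExposed ℝ S Ψ → Ψ ≠ S → Φ ⊆ Ψ → Ψ = Φ

/-- A (convex) polytope: the convex hull of a finite nonempty set. -/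
def IsPolytope (S : Set W) : Prop :=
  ∃ s : Finset W, s.Nonempty ∧ S = convexHull ℝ (s : Set W)

/-- A simplex: the convex hull of a finite nonempty affinely independent set. -/
def IsSimplex (S : Set W) : Prop :=
  ∃ s : Finset W, s.Nonempty ∧ AffineIndependent ℝ (fun x : s => (x : W)) ∧
    S = convexHull ℝ (s : Set W)

/-- A subdivision of the polytope `P`, given by its cells, which are polytopes of the dimension
of `P`. -/
structure IsSubdivision (P : Set W) (𝒮 : Set (Set W)) : Prop where
  finite : 𝒮.Finite
  polytope : ∀ S ∈ 𝒮, IsPolytope S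
  dim : ∀ S ∈ 𝒮, Module.finrank ℝ (vectorSpan ℝ S) = Module.finrank ℝ (vectorSpan ℝ P)
  cover : ⋃₀ 𝒮 = P
  inter : ∀ S ∈ 𝒮, ∀ T ∈ 𝒮, S ≠ T →
    (IsExposed ℝ S (S ∩ T) ∧ S ∩ T ≠ S) ∧ (IsExposed ℝ T (S ∩ T) ∧ S ∩ T ≠ T)

/-- A triangulation is a subdivision all of whose cells are simplices. -/
def IsTriangulation (P : Set W) (𝒮 : Set (Set W)) : Prop :=
  IsSubdivision P 𝒮 ∧ ∀ S ∈ 𝒮, IsSimplex S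

/-- Pulling the subdivision `𝒮` at the point `x`: a cell without `x` is kept, a cell `S` that
contains `x` is replaced by the pyramids `conv(Φ, x)` over the facets `Φ` of `S` without `x`. -/
def pull (𝒮 : Set (Set W)) (x : W) : Set (Set W) :=
  {T | (T ∈ 𝒮 ∧ x ∉ T) ∨
    ∃ S ∈ 𝒮, x ∈ S ∧ ∃ Φ, IsFacet S Φ ∧ x ∉ Φ ∧ T = convexHull ℝ (insert x Φ)}

/-- `pull(P; x¹, …, xⁿ)`: start from the trivial subdivision `{P}` and pull successively. -/
def pullSeq (P : Set W) (xs : List W) : Set (Set W) :=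
  xs.foldl pull {P}

/-- A pulling triangulation of `P`: a triangulation obtained by successively pulling `P` at
points of `P`. -/
def IsPullingTriangulation (P : Set W) (𝒮 : Set (Set W)) : Prop :=
  IsTriangulation P 𝒮 ∧ ∃ xs : List W, (∀ x ∈ xs, x ∈ P) ∧ pullSeq P xs = 𝒮

end Polyhedra

section Coordinates

variable {ι : Type*}

/-- A unimodular simplex in `ℝ^ι`: the image of `conv(0, eᵢ : i ∈ ι)` under an affine
automorphism of the lattice `ℤ^ι`, that is, `conv(c, c + bᵢ)` for a lattice basis `b`. -/
def IsUnimodularSimplex (S : Set (ι → ℝ)) : Prop :=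
  ∃ (b : Module.Basis ι ℤ (ι → ℤ)) (c : ι → ℤ),
    S = convexHull ℝ (insert (fun j => (c j : ℝ))
      (Set.range fun i : ι => fun j => ((c j + b i j : ℤ) : ℝ)))

/-- A subset of the nonnegative orthant is anti-blocking if it is closed under decreasing
coordinates within the orthant. -/
def IsAntiBlocking (Q : Set (ι → ℝ)) : Prop :=
  ∀ x ∈ Q, ∀ y : ι → ℝ, (∀ i, 0 ≤ y i ∧ y i ≤ x i) → y ∈ Q

/-- `P` is locally anti-blocking if `(σP) ∩ ℝ₊^ι` is anti-blocking for each sign vector `σ`. -/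
def IsLocallyAntiBlocking (P : Set (ι → ℝ)) : Prop :=
  ∀ σ : ι → ℝ, (∀ i, σ i = 1 ∨ σ i = -1) →
    IsAntiBlocking (((fun x => σ * x) '' P) ∩ {x | ∀ i, 0 ≤ x i})

end Coordinates

/-! ## Directed multigraphs, routes, framings -/

/-- A directed multigraph with vertex set `V` and edge set `E`. -/
structure MultiDigraph (V E : Type*) where
  src : E → V
  tgt : E → V

namespace MultiDigraph

variable {V E : Type*} (G : MultiDigraph V E)

def IsSource (v : V) : Prop := ∀ e, G.tgt e ≠ v

def IsSink (v : V) : Prop := ∀ e, G.src e ≠ v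

/-- The inner vertices: neither sources nor sinks. -/
def InnerVertex : Type _ := {v : V // ¬ G.IsSource v ∧ ¬ G.IsSink v}

/-- A route: a directed path from a source to a sink, as the list of its edges. (The graphs below
are acyclic, so that directed walks are paths.) -/
structure Route where
  edges : List E
  ne : edges ≠ []
  chain : edges.IsChain (fun e f => G.tgt e = G.src f)
  source : G.IsSource (G.src (edges.head ne))
  sink : G.IsSink (G.tgt (edges.getLast ne))

open Classical in
/-- The indicator vector of a route in `ℝ^E`. -/
noncomputable def Route.indicator {G : MultiDigraph V E} (R : G.Route) : E → ℝ :=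
  fun e => if e ∈ R.edges then 1 else 0

open Classical in
/-- The cone of nonnegative flows. -/
def flowCone [Fintype E] : Set (E → ℝ) :=
  {f | (∀ e, 0 ≤ f e) ∧ ∀ v : G.InnerVertex,
    ∑ e with G.tgt e = v.1, f e = ∑ e with G.src e = v.1, f e}

end MultiDigraph

/-- A framing: linear orders on the incoming and on the outgoing edges of each inner vertex. -/
structure Framing {V E : Type*} (G : MultiDigraph V E) where
  inOrder : ∀ v : G.InnerVertex, LinearOrder {e : E // G.tgt e = v.1}
  outOrder : ∀ v : G.InnerVertex, LinearOrder {e : E // G.src e = v.1}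

namespace Framing

variable {V E : Type*} {G : MultiDigraph V E} (F : Framing G)

/-- `a` and `b` enter a common inner vertex and `a` precedes `b` there. -/
def inLT (a b : E) : Prop :=
  ∃ (v : G.InnerVertex) (ha : G.tgt a = v.1) (hb : G.tgt b = v.1),
    (F.inOrder v).lt ⟨a, ha⟩ ⟨b, hb⟩

/-- `a` and `b` leave a common inner vertex and `a` precedes `b` there. -/
def outLT (a b : E) : Prop :=
  ∃ (v : G.InnerVertex) (ha : G.src a = v.1) (hb : G.src b = v.1),
    (F.outOrder v).lt ⟨a, ha⟩ ⟨b, hb⟩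

/-- The strict order on partial routes that end at the same inner vertex: compare the edges that
precede the longest common final segment `c`. -/
def PrecIn (p q : List E) : Prop :=
  ∃ (p₀ q₀ c : List E) (a b : E), p = p₀ ++ a :: c ∧ q = q₀ ++ b :: c ∧ F.inLT a b

/-- The strict order on partial routes that start at the same inner vertex: compare the edges that
follow the longest common initial segment `c`. -/
def PrecOut (p q : List E) : Prop :=
  ∃ (c p₁ q₁ : List E) (a b : E), p = c ++ a :: p₁ ∧ q = c ++ b :: q₁ ∧ F.outLT a b

/-- `R` and `S` are in conflict: at some common subroute `c` (possibly a single vertex) the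
parts before `c` and the parts after `c` are ordered differently. -/
def Conflict (R S : G.Route) : Prop :=
  ∃ p q c p' q' : List E, R.edges = p ++ c ++ p' ∧ S.edges = q ++ c ++ q' ∧
    ((F.PrecIn p q ∧ F.PrecOut q' p') ∨ (F.PrecIn q p ∧ F.PrecOut p' q'))

def Coherent (R S : G.Route) : Prop := ¬ F.Conflict R S

/-- A route is exceptional if it is coherent with every route. -/
def IsExceptional (R : G.Route) : Prop := ∀ S : G.Route, F.Coherent R S

/-- A clique: a set of mutually coherent routes. -/
def IsClique (M : Set G.Route) : Prop := ∀ R ∈ M, ∀ S ∈ M, F.Coherent R S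

/-- A framing is ample if its exceptional routes do not all lie in one facet of the cone of
nonnegative flows. -/
def IsAmple [Fintype E] : Prop :=
  ∀ Φ : Set (E → ℝ), IsFacet G.flowCone Φ →
    ¬ ∀ R : G.Route, F.IsExceptional R → R.indicator ∈ Φ

/- Each inner vertex of the graphs below has two incoming and two outgoing edges. The smaller edge
of each pair is labelled `1` and the larger one `2`; for an ample framing the labels of an edge
between inner vertices at its two ends agree. -/

/-- `e` has label `1` among the edges that enter its head. -/
def InOne (e : E) : Prop := ∃ a, F.inLT e a

/-- `e` has label `2` among the edges that enter its head. -/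
def InTwo (e : E) : Prop := ∃ a, F.inLT a e

/-- `e` has label `1` among the edges that leave its tail. -/
def OutOne (e : E) : Prop := ∃ a, F.outLT e a

/-- `e` has label `2` among the edges that leave its tail. -/
def OutTwo (e : E) : Prop := ∃ a, F.outLT a e

open Classical in
/-- The g-vector of a route: `-1` at `v` if the route enters `v` with label `1` and leaves it with
label `2`, `1` if it enters with label `2` and leaves with label `1`, and `0` otherwise. -/
noncomputable def gVector (R : G.Route) : G.InnerVertex → ℝ := fun v =>
  if ∃ e f, [e, f] <:+: R.edges ∧ G.tgt e = v.1 ∧ F.InOne e ∧ F.OutTwo f then -1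
  else if ∃ e f, [e, f] <:+: R.edges ∧ G.tgt e = v.1 ∧ F.InTwo e ∧ F.OutOne f then 1
  else 0

/-- The g-polytope. -/
noncomputable def gPolytope : Set (G.InnerVertex → ℝ) :=
  convexHull ℝ (Set.range F.gVector)

/-- The cells of the DKK triangulation of the g-polytope: the g-simplices of the maximal
cliques. -/
noncomputable def dkk : Set (Set (G.InnerVertex → ℝ)) :=
  {T | ∃ M : Set G.Route, Maximal F.IsClique M ∧ T = convexHull ℝ (F.gVector '' M)}

end Framing

/-! ## The graphs `Path(k)` and `Cycle(k)` -/

/-- An inner graph with vertices `0, …, n-1` and edges `0, …, m-1`, where edge `j` goes from `lo j`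
to `hi j` if `up j` holds, and from `hi j` to `lo j` otherwise. -/
structure Zigzag where
  n : ℕ
  m : ℕ
  lo : Fin m → Fin n
  hi : Fin m → Fin n
  up : Fin m → Bool

/-- The vertices of the full graph: one source, one sink and the inner vertices. -/
inductive Vertex (n : ℕ) where
  | source : Vertex n
  | sink : Vertex n
  | inner (i : Fin n) : Vertex n

/-- The directions of the successive inner edges: `k₁` edges in direction `b`, then `k₂` edges in
the opposite direction, and so on. -/
def directions : Bool → List ℕ → List Bool
  | _, [] => []
  | b, k :: ks => List.replicate k b ++ directions (!b) ks

namespace Zigzag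

/-- The inner graph of `Path(k)`; `b` tells whether the first leg is directed away from
vertex `0`. -/
def path (b : Bool) (k : List ℕ) : Zigzag where
  n := (directions b k).length + 1
  m := (directions b k).length
  lo := Fin.castSucc
  hi := Fin.succ
  up := (directions b k).get

/-- The inner graph of `Cycle(k)`. -/
def cycle (k : List ℕ) : Zigzag where
  n := (directions true k).length
  m := (directions true k).length
  lo := id
  hi := fun j => ⟨(j + 1) % (directions true k).length, Nat.mod_lt _ j.pos⟩
  up := (directions true k).get

def IsPath (Z : Zigzag) : Prop :=
  ∃ (b : Bool) (k : List ℕ), k ≠ [] ∧ (∀ x ∈ k, 0 < x) ∧ Z = path b k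

def IsCycle (Z : Zigzag) : Prop :=
  ∃ k : List ℕ, k ≠ [] ∧ (∀ x ∈ k, 0 < x) ∧ Even k.length ∧ Z = cycle k

variable (Z : Zigzag)

/-- The tail of an inner edge. -/
def tail (j : Fin Z.m) : Fin Z.n := if Z.up j then Z.lo j else Z.hi j

/-- The head of an inner edge. -/
def head (j : Fin Z.m) : Fin Z.n := if Z.up j then Z.hi j else Z.lo j

/-- The edges of the full graph: the inner edges, and as many source edges and sink edges at each
inner vertex as are needed to make its indegree and its outdegree equal to `2`. -/
abbrev Edge : Type :=
  Fin Z.m ⊕ (Σ v : Fin Z.n, Fin (2 - Finset.card {j | Z.head j = v})) ⊕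
    (Σ v : Fin Z.n, Fin (2 - Finset.card {j | Z.tail j = v}))

/-- The full graph with the given inner graph. -/
def dag : MultiDigraph (Vertex Z.n) Z.Edge where
  src
    | .inl j => .inner (Z.tail j)
    | .inr (.inl _) => .source
    | .inr (.inr e) => .inner e.1
  tgt
    | .inl j => .inner (Z.head j)
    | .inr (.inl e) => .inner e.1
    | .inr (.inr _) => .sink

end Zigzag

/-! ## The coherence diagram -/

namespace Framing

variable {Z : Zigzag} (F : Framing Z.dag)

/-- The inner edges that point upwards in the numbering are labelled `2`, the others `1`. (For a
locally anti-blocking framing, otherwise the labels `1` and `2` are interchanged; the diagram is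
then the one for the interchanged labels.) -/
def IsStandard : Prop := ∀ j : Fin Z.m, Z.up j = true ↔ F.InTwo (.inl j)

/-- The order of the source edges that index the rows of the diagram, from top to bottom: by
vertex; of two source edges at one vertex, the one with label `2` comes first. -/
def RowBefore (e e' : Z.Edge) : Prop :=
  ∃ i i' : Fin Z.n, Z.dag.src e = .source ∧ Z.dag.src e' = .source ∧
    Z.dag.tgt e = .inner i ∧ Z.dag.tgt e' = .inner i' ∧
    (i < i' ∨ i = i' ∧ ((F.IsStandard ∧ F.inLT e' e) ∨ (¬ F.IsStandard ∧ F.inLT e e')))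

/-- The order of the sink edges that index the columns of the diagram, from left to right: by
vertex; of two sink edges at one vertex, the one with label `1` comes first. -/
def ColBefore (e e' : Z.Edge) : Prop :=
  ∃ i i' : Fin Z.n, Z.dag.tgt e = .sink ∧ Z.dag.tgt e' = .sink ∧
    Z.dag.src e = .inner i ∧ Z.dag.src e' = .inner i' ∧
    (i < i' ∨ i = i' ∧ ((F.IsStandard ∧ F.outLT e e') ∨ (¬ F.IsStandard ∧ F.outLT e' e)))

open Classical in
/-- The row of the box of a route. In a cycle the two rows of the source edges at vertex `0` are
repeated at the bottom of the diagram, for the routes on the last leg, which starts with an inner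
edge from vertex `0` that points downwards in the cyclic numbering. -/
noncomputable def row (R : Z.dag.Route) : ℕ :=
  Set.ncard {e | F.RowBefore e (R.edges.head R.ne)} +
    if ∃ j : Fin Z.m, .inl j ∈ R.edges ∧ Z.up j = false ∧ (Z.hi j : ℕ) = 0 then
      Set.ncard {e | Z.dag.src e = .source} else 0

/-- The column of the box of a route. -/
noncomputable def col (R : Z.dag.Route) : ℕ :=
  Set.ncard {e | F.ColBefore e (R.edges.getLast R.ne)}

/-- `C` is the long exceptional route (an exceptional route with more than two edges) that
runs along the leg on which `R` lies. -/
def IsCornerOf (C R : Z.dag.Route) : Prop :=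
  F.IsExceptional C ∧ 2 < C.edges.length ∧
    (∀ j : Fin Z.m, .inl j ∈ R.edges → .inl j ∈ C.edges) ∧
    (∀ i : Fin Z.n, (∃ e ∈ R.edges, Z.dag.tgt e = .inner i) →
      ∃ e ∈ C.edges, Z.dag.tgt e = .inner i)

/-- The number of diagonals (running from upper left to lower right) from the box of `C` to the box
of `R`. -/
noncomputable def diagDist (C R : Z.dag.Route) : ℕ :=
  (((F.row R : ℤ) - F.col R) - ((F.row C : ℤ) - F.col C)).natAbs

/-- The list contains each non-exceptional route exactly once and proceeds along the diagonals of
the coherence diagram, starting next to the corners formed by the long exceptional routes: first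
the diagonals at distance `1` from the corner of their leg, then those at distance `2`, and so on,
each of them from upper left to lower right. -/
def IsDiagonalOrder (L : List Z.dag.Route) : Prop :=
  L.Nodup ∧ (∀ R, R ∈ L ↔ ¬ F.IsExceptional R) ∧
    L.Pairwise fun R S => ∀ C D, F.IsCornerOf C R → F.IsCornerOf D S →
      F.diagDist C R < F.diagDist D S ∨
        (F.diagDist C R = F.diagDist D S ∧ (C = D → F.row R < F.row S))

end Framing

end GPoly

open GPoly

/-! Pulling at a point makes it an apex of every cell that contains it: it lies outside the affine
span of the other vertices of the cell. So a cell cannot contain p, q, r, s with p + q = r + s if r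
is an apex different from p and q. Conflicting routes provide such relations: if R and S conflict,
exchanging their final parts at the end of a common part gives routes T and U with g(R) + g(S) =
g(T) + g(U) (`gVector_add`). A supporting function that vanishes at g(R) and g(S) also vanishes at
g(T) and g(U), so the relation survives in every cell that still contains g(R) and g(S). If for each
conflicting pair one of T, U is pulled before both R and S, then no conflicting pair remains at the
end.

The diagonal order has this property (`resolves`). Once the labels are normalised, a leg of
direction d carries the label d. Replacing an end of a route that attaches with the wrong label by a
part that attaches with label d moves its box strictly nearer to the corner (`closer_of_start`,
`closer_of_end`). One of T, U takes both edges labelled `true` at the ends of the common part, the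
other both edges labelled `false`. On a leg with label d, the one with label d is nearer to the
corner than the original route; for legs with different labels the distances of R and S decide which
of the two serves.

Conversely, every maximal clique must occur, and the cells must fit together. Both follow from the
uniqueness of coherent nonnegative combinations up to exceptional routes, whose g-vectors are zero.
For two combinations with equal sum, consider a route farthest from its corner among those with
different coefficients; comparing coordinates at its ends produces two routes in the support of the
other combination that cross (`not_lt_of_farthest`). Uniqueness makes the nonzero g-vectors of a
clique linearly independent, so a full-dimensional cell with a clique as vertex set comes from a
maximal clique. The cells cover P; the centroid of the simplex of any maximal clique lies in some
cell, and uniqueness identifies the two. Unimodularity holds because all g-vectors are 0, ±e_v or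
e_v - e_w.

The polyhedral part works with an abstract family of vectors (`IsRootFan`). The hypotheses on the
framing enter only through the labelling: ampleness puts every edge on an exceptional route, which
makes the labels at the two ends of an inner edge agree, and local anti-blocking makes labels
constant along legs (`not_drop`). -/

namespace GPoly

/-! ### Faces, facets and pyramids of polytopes -/

section Polyhedra

variable {V : Type*} [NormedAddCommGroup V] [NormedSpace ℝ V]

theorem affineMap_sum_smul {κ : Type*} (f : V →ᵃ[ℝ] ℝ) (s : Finset κ) (w : κ → ℝ) (z : κ → V)
    (hw : ∑ i ∈ s, w i = 1) : f (∑ i ∈ s, w i • z i) = ∑ i ∈ s, w i * f (z i) := by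
  have h : ∀ y, f y = f.linear y + f 0 := fun y => congrFun (AffineMap.decomp f) y
  have h' : ∀ i ∈ s, w i * f (z i) = f.linear (w i • z i) + w i * f 0 := fun i _ => by
    rw [h (z i), mul_add, map_smul, smul_eq_mul]
  rw [h, map_sum, Finset.sum_congr rfl h', Finset.sum_add_distrib, ← Finset.sum_mul, hw, one_mul]

theorem affineMap_apply_eq {f : V →ᵃ[ℝ] ℝ} (hf : f.linear = 0) (y z : V) : f y = f z := by
  have h : ∀ y, f y = f.linear y + f 0 := fun y => congrFun (AffineMap.decomp f) y
  rw [h, h z, hf]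
  simp

theorem nonneg_on_convexHull {Y : Set V} {f : V →ᵃ[ℝ] ℝ} (hf : ∀ y ∈ Y, 0 ≤ f y) :
    ∀ z ∈ convexHull ℝ Y, 0 ≤ f z := by
  have : Convex ℝ {z | 0 ≤ f z} := (convex_Ici (0 : ℝ)).affine_preimage f
  exact fun z hz => convexHull_min hf this hz

theorem mem_convexHull_zeros {Y : Set V} {f : V →ᵃ[ℝ] ℝ} (hf : ∀ y ∈ Y, 0 ≤ f y) {z : V}
    (hz : z ∈ convexHull ℝ Y) (h0 : f z = 0) : z ∈ convexHull ℝ {y ∈ Y | f y = 0} := by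
  obtain ⟨κ, _, w, p, hw, hw1, hp, rfl⟩ := mem_convexHull_iff_exists_fintype.1 hz
  rw [affineMap_sum_smul _ _ _ _ hw1,
    Finset.sum_eq_zero_iff_of_nonneg fun i _ => mul_nonneg (hw i) (hf _ (hp i))] at h0
  classical
  have h1 : ∑ i with w i ≠ 0, w i = 1 := by rw [Finset.sum_filter_ne_zero, hw1]
  have h2 : ∑ i with w i ≠ 0, w i • p i = ∑ i, w i • p i := by
    apply Finset.sum_subset (Finset.filter_subset _ _)
    intro i _ hi
    simp only [Finset.mem_filter, Finset.mem_univ, true_and, not_not] at hi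
    simp [hi]
  rw [← h2]
  refine (convex_convexHull ℝ _).sum_mem (fun i _ => hw i) h1 fun i hi => ?_
  refine subset_convexHull ℝ _ ⟨hp i, ?_⟩
  have := h0 i (Finset.mem_univ i)
  simpa [(Finset.mem_filter.1 hi).2] using this

/-- Faces become zero sets of nonnegative affine functions, the form in which they are rotated and
compared below. The empty face is exposed vacuously and is the zero set of the constant 1. -/
theorem IsExposed.exists_zeros {S Φ : Set V} (h : IsExposed ℝ S Φ) :
    ∃ f : V →ᵃ[ℝ] ℝ, (∀ y ∈ S, 0 ≤ f y) ∧ Φ = {y ∈ S | f y = 0} := by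
  rcases Φ.eq_empty_or_nonempty with rfl | hne
  · refine ⟨AffineMap.const ℝ V 1, fun _ _ => by simp, ?_⟩
    ext; simp
  · obtain ⟨l, hl⟩ := h hne
    obtain ⟨z, hz⟩ := hne
    have hz' := hz
    rw [hl] at hz'
    refine ⟨AffineMap.const ℝ V (l z) - (l : V →ₗ[ℝ] ℝ).toAffineMap, fun y hy => ?_, ?_⟩
    · simpa using hz'.2 y hy
    · rw [hl]
      ext y
      simp only [Set.mem_ofPred_eq, AffineMap.coe_sub, Pi.sub_apply, AffineMap.const_apply,
        LinearMap.coe_toAffineMap, ContinuousLinearMap.coe_coe]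
      refine and_congr_right fun hy => ⟨fun h' => ?_, fun h' w hw => ?_⟩
      · linarith [h' z hz'.1, hz'.2 y hy]
      · linarith [hz'.2 w hw]

theorem exists_affineMap_of_affineSpan_ne_top {A : Set V} {x : V} (hx : x ∈ A)
    (hA : affineSpan ℝ A ≠ ⊤) :
    ∃ m : V →ᵃ[ℝ] ℝ, (∀ y ∈ A, m y = 0) ∧ m.linear ≠ 0 := by
  have h : vectorSpan ℝ A < ⊤ := by
    rw [lt_top_iff_ne_top]
    intro h
    exact hA ((AffineSubspace.affineSpan_eq_top_iff_vectorSpan_eq_top_of_nonempty _ _ _ ⟨x, hx⟩).2 h)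
  obtain ⟨φ, hφ, hle⟩ := Submodule.exists_le_ker_of_lt_top _ h
  refine ⟨φ.toAffineMap - AffineMap.const ℝ V (φ x), fun y hy => ?_, by simpa using hφ⟩
  have := hle (vsub_mem_vectorSpan ℝ hy hx)
  simpa [LinearMap.mem_ker, sub_eq_zero] using this

theorem linear_eq_zero_of_affineSpan_eq_top {Y : Set V} (hY : affineSpan ℝ Y = ⊤)
    {m : V →ᵃ[ℝ] ℝ} {c : ℝ} (hm : ∀ y ∈ Y, m y = c) : m.linear = 0 := by
  have h : affineSpan ℝ Y ≤ (affineSpan ℝ {c}).comap m := by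
    rw [affineSpan_le]
    intro y hy
    simp [hm y hy]
  rw [hY] at h
  have h' : ∀ y, m y = c := fun y => by
    have : y ∈ (affineSpan ℝ {c}).comap m := h (AffineSubspace.mem_top ℝ V y)
    simpa using this
  ext v
  have := m.map_vadd 0 v
  simp only [h'] at this
  simpa using this.symm

/-- A supporting hyperplane that together with `x` does not span can be rotated about `x` until it
meets a further point. -/
theorem exists_rotation {Y : Set V} (hfin : Y.Finite) (hY : affineSpan ℝ Y = ⊤) {f : V →ᵃ[ℝ] ℝ}
    (hf : ∀ y ∈ Y, 0 ≤ f y) {x : V} (hfx : 0 < f x)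
    (hns : affineSpan ℝ (insert x {y ∈ Y | f y = 0}) ≠ ⊤) :
    ∃ f' : V →ᵃ[ℝ] ℝ, (∀ y ∈ Y, 0 ≤ f' y) ∧ 0 < f' x ∧
      {y ∈ Y | f y = 0} ⊂ {y ∈ Y | f' y = 0} := by
  obtain ⟨m, hm, hneg⟩ : ∃ m : V →ᵃ[ℝ] ℝ, (∀ y ∈ insert x {y ∈ Y | f y = 0}, m y = 0) ∧
      ∃ y ∈ Y, m y < 0 := by
    obtain ⟨m, hm, hne⟩ := exists_affineMap_of_affineSpan_ne_top (Set.mem_insert _ _) hns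
    -- One of m and -m is negative somewhere on `Y`; otherwise m would vanish on a spanning set.
    by_contra! hcon
    refine hne (linear_eq_zero_of_affineSpan_eq_top hY (c := 0) fun y hy => ?_)
    have h1 := hcon m hm y hy
    have h2 := hcon (-m) (fun y hy => by simp [hm y hy]) y hy
    simp only [AffineMap.coe_neg, Pi.neg_apply] at h2
    linarith
  -- Ratio test: t is the largest multiple of m that can be added to f with nonnegativity on `Y`
  -- preserved. The minimiser y₁ becomes a new zero, and the value at x does not change because m x
  -- = 0.
  obtain ⟨y₁, ⟨hy₁, hm₁⟩, hmin⟩ := Set.exists_min_image {y ∈ Y | m y < 0}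
    (fun y => f y / (-m y)) (hfin.subset (Set.sep_subset _ _)) hneg
  set t := f y₁ / (-m y₁) with ht
  have ht0 : 0 ≤ t := div_nonneg (hf _ hy₁) (by linarith)
  refine ⟨f + t • m, fun y hy => ?_, ?_, ?_⟩
  · simp only [AffineMap.coe_add, AffineMap.coe_smul, Pi.add_apply, Pi.smul_apply, smul_eq_mul]
    rcases le_or_gt 0 (m y) with h | h
    · exact add_nonneg (hf y hy) (mul_nonneg ht0 h)
    · have := hmin y ⟨hy, h⟩
      rw [le_div_iff₀ (by linarith)] at this
      linarith
  · simpa [hm x (Set.mem_insert _ _)] using hfx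
  · rw [Set.ssubset_iff_of_subset]
    · refine ⟨y₁, ⟨hy₁, ?_⟩, fun h => ?_⟩
      · have : -m y₁ ≠ 0 := by linarith
        simp only [AffineMap.coe_add, AffineMap.coe_smul, Pi.add_apply, Pi.smul_apply, smul_eq_mul]
        have key : t * (-m y₁) = f y₁ := div_mul_cancel₀ _ this
        linarith
      · exact hm₁.ne (hm y₁ (Set.mem_insert_of_mem _ h))
    · rintro y hy
      exact ⟨hy.1, by simp [hy.2, hm y (Set.mem_insert_of_mem _ hy)]⟩

/-- Affine functions that vanish on a common set are proportional if this set spans together with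
one more point: the combination that also vanishes at x is zero. -/
theorem zeros_subset_of_span {Y : Set V} {f f' : V →ᵃ[ℝ] ℝ} {x : V}
    (hspan : affineSpan ℝ (insert x {y ∈ Y | f y = 0}) = ⊤) (hfx : f x ≠ 0)
    (h0 : ∀ y ∈ Y, f y = 0 → f' y = 0) (hfx' : f' x ≠ 0) :
    ∀ y, f' y = 0 → f y = 0 := by
  have h : (f x • f' - f' x • f).linear = 0 := by
    refine linear_eq_zero_of_affineSpan_eq_top hspan (c := 0) ?_
    rintro y (rfl | ⟨hy, hy0⟩)
    · simp [mul_comm]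
    · simp [hy0, h0 y hy hy0]
  have h' : ∀ y, (f x • f' - f' x • f) y = 0 := by
    intro y
    rw [affineMap_apply_eq h y x]
    simp [mul_comm]
  intro y hy
  have := h' y
  simp only [AffineMap.coe_sub, AffineMap.coe_smul, Pi.sub_apply, Pi.smul_apply, smul_eq_mul, hy,
    mul_zero, zero_sub, neg_eq_zero, mul_eq_zero, hfx', false_or] at this
  exact this

variable [FiniteDimensional ℝ V]

theorem isExposed_zeros {S : Set V} {f : V →ᵃ[ℝ] ℝ} (hf : ∀ y ∈ S, 0 ≤ f y) :
    IsExposed ℝ S {y ∈ S | f y = 0} := by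
  rintro ⟨z, hz, hz0⟩
  have h : ∀ y, f y = f.linear y + f 0 := fun y => congrFun (AffineMap.decomp f) y
  refine ⟨-(LinearMap.toContinuousLinearMap f.linear), ?_⟩
  ext y
  simp only [Set.mem_ofPred_eq, neg_apply, LinearMap.coe_toContinuousLinearMap',
    neg_le_neg_iff]
  refine and_congr_right fun hy => ⟨fun hy0 w hw => ?_, fun hmin => ?_⟩
  · have := hf w hw
    rw [h] at this hy0
    linarith
  · have h1 := hmin z hz
    have h2 := hf y hy
    rw [h] at h2 hz0 ⊢
    linarith

/-- A facet of a full-dimensional polytope together with a vertex outside it spans. -/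
theorem IsFacet.exists_zeros {Y : Set V} (hfin : Y.Finite) (hY : affineSpan ℝ Y = ⊤) {Φ : Set V}
    (hΦ : IsFacet (convexHull ℝ Y) Φ) {x : V} (hx : x ∈ Y) (hxΦ : x ∉ Φ) :
    ∃ f : V →ᵃ[ℝ] ℝ, (∀ y ∈ Y, 0 ≤ f y) ∧ 0 < f x ∧ (∀ y ∈ Y, y ∈ Φ ↔ f y = 0) ∧
      Φ = convexHull ℝ {y ∈ Y | f y = 0} ∧ affineSpan ℝ (insert x {y ∈ Y | f y = 0}) = ⊤ := by
  obtain ⟨hexp, -, hmax⟩ := hΦ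
  obtain ⟨f, hf, rfl⟩ := IsExposed.exists_zeros hexp
  have hYS := subset_convexHull ℝ Y
  have hfx : 0 < f x := lt_of_le_of_ne (hf x (hYS hx)) fun h => hxΦ ⟨hYS hx, h.symm⟩
  refine ⟨f, fun y hy => hf y (hYS hy), hfx, fun y hy => ⟨fun h => h.2, fun h => ⟨hYS hy, h⟩⟩, ?_, ?_⟩
  · apply Set.Subset.antisymm
    · rintro z ⟨hz, hz0⟩
      exact mem_convexHull_zeros (fun y hy => hf y (hYS hy)) hz hz0
    · refine convexHull_min (fun y hy => ⟨hYS hy.1, hy.2⟩) ?_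
      exact (convex_convexHull ℝ Y).inter ((convex_singleton (0 : ℝ)).affine_preimage f)
  -- Otherwise rotation about x yields a strictly larger proper face, against the maximality of a
  -- facet.
  · by_contra hns
    obtain ⟨f', hf', hfx', hss⟩ := exists_rotation hfin hY (fun y hy => hf y (hYS hy)) hfx hns
    have hS' := nonneg_on_convexHull hf'
    have hsub : {y ∈ convexHull ℝ Y | f y = 0} ⊆ {y ∈ convexHull ℝ Y | f' y = 0} := by
      rintro z ⟨hz, hz0⟩
      have h1 := mem_convexHull_zeros (fun y hy => hf y (hYS hy)) hz hz0
      have h2 : Convex ℝ {y | f' y = 0} := (convex_singleton (0 : ℝ)).affine_preimage f'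
      exact ⟨hz, convexHull_min (fun y hy => (hss.1 hy).2) h2 h1⟩
    have := hmax _ (isExposed_zeros hS')
      (fun h => hfx'.ne' (h.symm ▸ hYS hx : x ∈ {y ∈ convexHull ℝ Y | f' y = 0}).2) hsub
    obtain ⟨y, hy, hy'⟩ := Set.not_subset.1 hss.2
    have h3 : y ∈ {y ∈ convexHull ℝ Y | f' y = 0} := ⟨hYS hy.1, hy.2⟩
    rw [this] at h3
    exact hy' ⟨hy.1, h3.2⟩

/-- Every supporting hyperplane that avoids the vertex `x` is contained in a facet avoiding
`x`. -/
theorem exists_isFacet {Y : Set V} (hfin : Y.Finite) (hY : affineSpan ℝ Y = ⊤) {f : V →ᵃ[ℝ] ℝ}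
    (hf : ∀ y ∈ Y, 0 ≤ f y) {x : V} (hx : x ∈ Y) (hfx : 0 < f x) :
    ∃ Φ, IsFacet (convexHull ℝ Y) Φ ∧ x ∉ Φ ∧ {y ∈ convexHull ℝ Y | f y = 0} ⊆ Φ := by
  have hYS := subset_convexHull ℝ Y
  -- Among the finitely many zero sets of supporting functions that are positive at x, a maximal one
  -- spans together with x, since rotation would enlarge it otherwise. It then cuts out a facet.
  let 𝒵 : Set (Set V) := {Z | ∃ f' : V →ᵃ[ℝ] ℝ, (∀ y ∈ Y, 0 ≤ f' y) ∧ 0 < f' x ∧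
    {y ∈ Y | f y = 0} ⊆ {y ∈ Y | f' y = 0} ∧ Z = {y ∈ Y | f' y = 0}}
  have h𝒵fin : 𝒵.Finite := by
    refine hfin.finite_subsets.subset ?_
    rintro Z ⟨f', -, -, -, rfl⟩
    exact Set.sep_subset _ _
  obtain ⟨Z, hZmax⟩ := h𝒵fin.exists_maximal ⟨_, f, hf, hfx, subset_rfl, rfl⟩
  obtain ⟨g, hg, hgx, hfg, rfl⟩ := hZmax.prop
  have hspan : affineSpan ℝ (insert x {y ∈ Y | g y = 0}) = ⊤ := by
    by_contra hns
    obtain ⟨g', hg', hgx', hss⟩ := exists_rotation hfin hY hg hgx hns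
    exact hss.2 (hZmax.le_of_ge ⟨g', hg', hgx', hfg.trans hss.1, rfl⟩ hss.1)
  refine ⟨{y ∈ convexHull ℝ Y | g y = 0}, ⟨isExposed_zeros (nonneg_on_convexHull hg), ?_, ?_⟩, ?_, ?_⟩
  · intro h
    exact hgx.ne' (h.symm ▸ hYS hx : x ∈ {y ∈ convexHull ℝ Y | g y = 0}).2
  · intro Ψ hΨ hne hsub
    obtain ⟨p, hp, rfl⟩ := IsExposed.exists_zeros hΨ
    have hp0 : ∀ y ∈ Y, g y = 0 → p y = 0 := fun y hy h => (hsub ⟨hYS hy, h⟩).2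
    have hpx : p x ≠ 0 := by
      intro hpx
      have h1 : p.linear = 0 := by
        refine linear_eq_zero_of_affineSpan_eq_top hspan (c := 0) ?_
        rintro y (rfl | hy)
        · exact hpx
        · exact hp0 y hy.1 hy.2
      apply hne
      refine Set.Subset.antisymm (Set.sep_subset _ _) fun y hy => ⟨hy, ?_⟩
      rw [affineMap_apply_eq h1 y x, hpx]
    refine Set.Subset.antisymm (fun y hy => ⟨hy.1, ?_⟩) hsub
    exact zeros_subset_of_span hspan hgx.ne' hp0 hpx y hy.2
  · exact fun h => hgx.ne' h.2
  · rintro z ⟨hz, hz0⟩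
    have h1 := mem_convexHull_zeros hf hz hz0
    have h2 : Convex ℝ {y | g y = 0} := (convex_singleton (0 : ℝ)).affine_preimage g
    exact ⟨hz, convexHull_min (fun y hy => (hfg hy).2) h2 h1⟩

/-- A point of a full-dimensional polytope in general position lies in the pyramid with apex `x`
over some facet. -/
theorem exists_isFacet_mem_pyramid {Y : Set V} (hfin : Y.Finite) (hY : affineSpan ℝ Y = ⊤) {x y : V}
    (hx : x ∈ Y) (hy : y ∈ convexHull ℝ Y)
    (hgen : ∀ Z ⊆ Y, affineSpan ℝ Z ≠ ⊤ → y ∉ affineSpan ℝ Z)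
    (hxne : affineSpan ℝ ({x} : Set V) ≠ ⊤) :
    ∃ Φ, IsFacet (convexHull ℝ Y) Φ ∧ x ∉ Φ ∧ y ∈ convexHull ℝ (insert x Φ) := by
  have hYS := subset_convexHull ℝ Y
  have hcv := convex_convexHull ℝ Y
  have hyx : y ≠ x := by
    rintro rfl
    exact hgen {y} (by simpa using hx) hxne (mem_affineSpan ℝ rfl)
  have hcomp : IsCompact (convexHull ℝ Y) := hfin.isCompact_convexHull ℝ
  let r : ℝ → V := fun t => x + t • (y - x)
  have hr : Continuous r := by fun_prop
  -- the last point of the ray from `x` through `y` in the polytope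
  obtain ⟨t, htS, htmax⟩ : ∃ t, r t ∈ convexHull ℝ Y ∧ ∀ s, r s ∈ convexHull ℝ Y → s ≤ t := by
    have hclosed : IsClosed {s | r s ∈ convexHull ℝ Y} := hcomp.isClosed.preimage hr
    have hbdd : BddAbove {s | r s ∈ convexHull ℝ Y} := by
      obtain ⟨B, hB⟩ := hcomp.isBounded.exists_norm_le
      refine ⟨(B + ‖x‖) / ‖y - x‖, fun s hs => ?_⟩
      rw [le_div_iff₀ (norm_pos_iff.2 (sub_ne_zero.2 hyx))]
      have h1 := hB _ hs
      have h2 : ‖s • (y - x)‖ ≤ ‖r s‖ + ‖x‖ := by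
        have : s • (y - x) = r s - x := by simp [r]
        rw [this]
        exact norm_sub_le _ _
      rw [norm_smul] at h2
      have h3 := mul_le_mul_of_nonneg_right (le_abs_self s) (norm_nonneg (y - x))
      rw [Real.norm_eq_abs] at h2
      linarith
    have hne : {s | r s ∈ convexHull ℝ Y}.Nonempty := ⟨1, by simpa [r] using hy⟩
    exact ⟨sSup {s | r s ∈ convexHull ℝ Y}, hclosed.csSup_mem hne hbdd, fun s hs => le_csSup hbdd hs⟩
  have ht1 : 1 ≤ t := htmax 1 (by simpa [r] using hy)
  -- At an interior point the ray could be prolonged; so there is a supporting functional at the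
  -- exit point.
  have hint : r t ∉ interior (convexHull ℝ Y) := by
    intro h
    have h1 : r ⁻¹' interior (convexHull ℝ Y) ∈ nhds t :=
      (isOpen_interior.preimage hr).mem_nhds h
    obtain ⟨ε, hε, hball⟩ := Metric.mem_nhds_iff.1 h1
    have h2 : t + ε / 2 ∈ Metric.ball t ε := by
      rw [Metric.mem_ball, Real.dist_eq, add_sub_cancel_left, abs_of_pos (by linarith)]
      linarith
    have := htmax _ (interior_subset (hball h2))
    linarith
  obtain ⟨l, hl, hmax⟩ := geometric_hahn_banach_of_nonempty_interior_point hcv hint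
    (interior_convexHull_nonempty_iff_affineSpan_eq_top.2 hY)
  let f : V →ᵃ[ℝ] ℝ := AffineMap.const ℝ V (l (r t)) - (l : V →ₗ[ℝ] ℝ).toAffineMap
  have hfv : ∀ z, f z = l (r t) - l z := fun z => by simp [f]
  have hf : ∀ z ∈ Y, 0 ≤ f z := fun z hz => by rw [hfv]; linarith [hmax z (hYS hz)]
  have hyseg : y ∈ segment ℝ x (r t) := by
    refine ⟨1 - 1 / t, 1 / t, ?_, by positivity, by ring, ?_⟩
    · rw [sub_nonneg, div_le_one (by linarith)]; exact ht1
    · have : t ≠ 0 := by linarith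
      simp only [r, smul_add, smul_smul, one_div, inv_mul_cancel₀ this]
      module
  have hfx : 0 < f x := by
    -- If f vanished at x as well as at the exit point, the segment between them, and with it y,
    -- would lie in the span of the zeros of f, against genericity.
    refine lt_of_le_of_ne (hf x hx) fun h0 => ?_
    have hns : affineSpan ℝ {z ∈ Y | f z = 0} ≠ ⊤ := by
      intro htop
      have h1 := linear_eq_zero_of_affineSpan_eq_top htop (m := f) (c := 0) fun z hz => hz.2
      apply hl
      ext v
      have := LinearMap.congr_fun h1 v
      simpa [f] using this
    refine hgen _ (Set.sep_subset _ _) hns (convexHull_subset_affineSpan _ ?_)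
    have hxz : x ∈ convexHull ℝ {z ∈ Y | f z = 0} := subset_convexHull ℝ _ ⟨hx, h0.symm⟩
    have htz : r t ∈ convexHull ℝ {z ∈ Y | f z = 0} :=
      mem_convexHull_zeros hf htS (by rw [hfv, sub_self])
    exact (convex_convexHull ℝ _).segment_subset hxz htz hyseg
  obtain ⟨Φ, hΦ, hxΦ, hsub⟩ := exists_isFacet hfin hY hf hx hfx
  refine ⟨Φ, hΦ, hxΦ, ?_⟩
  have h1 : x ∈ convexHull ℝ (insert x Φ) := subset_convexHull ℝ _ (Set.mem_insert _ _)
  have h2 : r t ∈ convexHull ℝ (insert x Φ) :=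
    subset_convexHull ℝ _ (Set.mem_insert_of_mem _ (hsub ⟨htS, by rw [hfv, sub_self]⟩))
  exact (convex_convexHull ℝ _).segment_subset h1 h2 hyseg

end Polyhedra

end GPoly

/-! ### Root fans: vectors with unique coherent combinations -/

namespace GPoly

theorem convexHull_insert_convexHull {V : Type*} [AddCommGroup V] [Module ℝ V] (x : V) (Z : Set V) :
    convexHull ℝ (insert x (convexHull ℝ Z)) = convexHull ℝ (insert x Z) := by
  rw [Set.insert_eq, Set.insert_eq, convexHull_convexHull_union_right]

/-- Vectors `g R` with a coherence relation such that coherent nonnegative combinations are unique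
and each vector is zero, a signed unit vector, or a difference of two unit vectors. -/
structure IsRootFan {ι ρ : Type*} [Fintype ι] [DecidableEq ι] [Fintype ρ] (g : ρ → ι → ℝ)
    (Coh : ρ → ρ → Prop) : Prop where
  symm : ∀ R S, Coh R S → Coh S R
  refl : ∀ R, Coh R R
  eq_zero_iff : ∀ R, g R = 0 ↔ ∀ S, Coh R S
  exists_zero : ∃ R, g R = 0
  unique : ∀ a b : ρ → ℝ, (∀ R, 0 ≤ a R) → (∀ R, 0 ≤ b R) →
    (∀ R S, a R ≠ 0 → a S ≠ 0 → Coh R S) → (∀ R S, b R ≠ 0 → b S ≠ 0 → Coh R S) →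
    ∑ R, a R • g R = ∑ R, b R • g R → ∀ R, g R ≠ 0 → a R = b R
  form : ∀ R, g R = 0 ∨ (∃ v, g R = Pi.single v 1 ∨ g R = Pi.single v (-1)) ∨
    ∃ v w, v ≠ w ∧ g R = Pi.single v 1 - Pi.single w 1
  span : Submodule.span ℝ (Set.range g) = ⊤

namespace IsRootFan

variable {ι ρ : Type*} [Fintype ι] [DecidableEq ι] [Fintype ρ] {g : ρ → ι → ℝ}
  {Coh : ρ → ρ → Prop}

/-- Each vector is a coherent combination of itself alone, so uniqueness of coefficients separates
the elements. -/
theorem eq_of_eq (h : IsRootFan g Coh) {R S : ρ} (hR : g R ≠ 0) (hRS : g R = g S) : R = S := by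
  classical
  have hs : ∀ T U V : ρ, (Pi.single T 1 : ρ → ℝ) U ≠ 0 → (Pi.single T 1 : ρ → ℝ) V ≠ 0 →
      Coh U V := by
    intro T U V hU hV
    obtain rfl : U = T := by by_contra hne; exact hU (Pi.single_eq_of_ne hne _)
    obtain rfl : V = U := by by_contra hne; exact hV (Pi.single_eq_of_ne hne _)
    exact h.refl V
  have h0 : ∀ T U : ρ, 0 ≤ (Pi.single T 1 : ρ → ℝ) U := fun T U => by
    by_cases hT : U = T
    · subst hT; simp
    · simp [hT]
  have hsum : ∀ T : ρ, ∑ U, (Pi.single T 1 : ρ → ℝ) U • g U = g T := fun T => by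
    simp [Pi.single_apply, ite_smul]
  have := h.unique (Pi.single R 1) (Pi.single S 1) (h0 R) (h0 S) (hs R) (hs S)
    (by rw [hsum, hsum, hRS]) R hR
  by_contra hne
  simp [hne] at this

theorem coh_of_eq_zero (h : IsRootFan g Coh) {R S : ρ} (hR : g R = 0) : Coh R S ∧ Coh S R :=
  ⟨(h.eq_zero_iff R).1 hR S, h.symm _ _ ((h.eq_zero_iff R).1 hR S)⟩

/-- Nonzero vectors are vertices of the polytope, so pulling at one of them changes only the cells
that have it as a vertex. -/
theorem mem_of_mem_convexHull (h : IsRootFan g Coh) {R : ρ} (hR : g R ≠ 0) {Y : Set (ι → ℝ)}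
    (hY : Y ⊆ Set.range g) (hmem : g R ∈ convexHull ℝ Y) : g R ∈ Y := by
  -- a weight whose maximum on the vectors is attained only at `g R`
  suffices hl : ∃ a : ι → ℝ, ∀ S, g S ≠ g R → ∑ i, a i * g S i < ∑ i, a i * g R i by
    obtain ⟨a, ha⟩ := hl
    let l : (ι → ℝ) →ₗ[ℝ] ℝ := ∑ i, a i • LinearMap.proj i
    have hl : ∀ x, l x = ∑ i, a i * x i := fun x => by simp [l]
    by_contra hcon
    have h1 : Y ⊆ {x | l x < l (g R)} := by
      intro y hy
      obtain ⟨S, rfl⟩ := hY hy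
      change l (g S) < l (g R)
      rw [hl, hl]
      exact ha S fun hS => hcon (hS ▸ hy)
    have h2 : l (g R) < l (g R) :=
      convexHull_min h1 ((convex_Iio (l (g R))).linear_preimage l) hmem
    exact lt_irrefl _ h2
  have hsum : ∀ (a : ι → ℝ) (v : ι) (c : ℝ), ∑ i, a i * (Pi.single v c : ι → ℝ) i = a v * c :=
    fun a v c => by simp [Pi.single_apply]
  rcases h.form R with h0 | ⟨v, hv | hv⟩ | ⟨v, w, hvw, hv⟩
  · exact absurd h0 hR
  -- With these weights e_v has value 3, and every other admissible vector has value at most 2,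
  -- attained by e_v - e_w.
  · refine ⟨fun i => if i = v then 3 else 1, fun S hS => ?_⟩
    rcases h.form S with h0 | ⟨v', hv' | hv'⟩ | ⟨v', w', hvw', hv'⟩ <;>
      simp only [*, Pi.sub_apply, mul_sub, Finset.sum_sub_distrib, Pi.zero_apply, mul_zero,
        Finset.sum_const_zero, if_true] <;> (try split_ifs) <;> simp_all <;> norm_num
  · refine ⟨fun i => if i = v then -3 else -1, fun S hS => ?_⟩
    rcases h.form S with h0 | ⟨v', hv' | hv'⟩ | ⟨v', w', hvw', hv'⟩ <;>
      simp only [*, Pi.sub_apply, mul_sub, Finset.sum_sub_distrib, Pi.zero_apply, mul_zero,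
        Finset.sum_const_zero, if_true] <;> (try split_ifs) <;> simp_all <;> norm_num
  -- Here e_v - e_w has value 2 and every other admissible vector at most 1.
  · refine ⟨fun i => if i = v then 1 else if i = w then -1 else 0, fun S hS => ?_⟩
    rcases h.form S with h0 | ⟨v', hv' | hv'⟩ | ⟨v', w', hvw', hv'⟩ <;>
      simp only [*, Pi.sub_apply, mul_sub, Finset.sum_sub_distrib, Pi.zero_apply, mul_zero,
        Finset.sum_const_zero, if_true] <;> (try split_ifs) <;> simp_all <;> norm_num

/-- A clique: a set of pairwise coherent elements. -/
def Clique (Coh : ρ → ρ → Prop) (M : Set ρ) : Prop := ∀ R ∈ M, ∀ S ∈ M, Coh R S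

/-- The positive and the negative part of a linear relation are coherent combinations with the same
sum. By uniqueness they agree at R, where one of them is zero. -/
theorem coeff_eq_zero (h : IsRootFan g Coh) {M : Set ρ} (hM : Clique Coh M) {c : ρ → ℝ}
    (hc : ∀ R, c R ≠ 0 → R ∈ M) (h0 : ∑ R, c R • g R = 0) {R : ρ} (hR : g R ≠ 0) : c R = 0 := by
  have hpos : ∀ R, max (c R) 0 ≠ 0 → R ∈ M := fun R hR => hc R fun h => hR (by simp [h])
  have hneg : ∀ R, max (-c R) 0 ≠ 0 → R ∈ M := fun R hR => hc R fun h => hR (by simp [h])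
  have := h.unique (fun R => max (c R) 0) (fun R => max (-c R) 0) (fun R => le_max_right _ _)
    (fun R => le_max_right _ _) (fun R S hR hS => hM R (hpos R hR) S (hpos S hS))
    (fun R S hR hS => hM R (hneg R hR) S (hneg S hS)) (by
      rw [← sub_eq_zero, ← Finset.sum_sub_distrib, ← h0]
      refine Finset.sum_congr rfl fun R _ => ?_
      rw [← sub_smul]
      congr 1
      rcases le_total (c R) 0 with h | h
      · rw [max_eq_right h, max_eq_left (by linarith)]; ring
      · rw [max_eq_left h, max_eq_right (by linarith)]; ring) R hR
  rcases le_total (c R) 0 with h | h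
  · simp only [max_eq_right h, max_eq_left (show (0 : ℝ) ≤ -c R by linarith)] at this
    linarith
  · simp only [max_eq_left h, max_eq_right (show -c R ≤ (0 : ℝ) by linarith)] at this
    exact this

theorem linearIndependent (h : IsRootFan g Coh) {M : Set ρ} (hM : Clique Coh M) :
    LinearIndependent ℝ (fun R : {R // R ∈ M ∧ g R ≠ 0} => g R) := by
  classical
  rw [Fintype.linearIndependent_iff]
  intro c hc R
  set F : ρ → ℝ := fun S => if hS : S ∈ M ∧ g S ≠ 0 then c ⟨S, hS⟩ else 0 with hF
  have hF' : ∀ S : {R // R ∈ M ∧ g R ≠ 0}, F S = c S := fun S => dif_pos S.2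
  have hsum : ∑ S, F S • g S = 0 := by
    have h1 := Finset.sum_subtype (F := inferInstance) (p := fun S => S ∈ M ∧ g S ≠ 0)
      (Finset.univ.filter fun S => S ∈ M ∧ g S ≠ 0) (by simp) fun S => F S • g S
    simp only [hF'] at h1
    rw [← hc, ← h1]
    refine (Finset.sum_subset (Finset.subset_univ _) fun S _ hS => ?_).symm
    simp only [Finset.mem_filter, Finset.mem_univ, true_and] at hS
    simp [hF, hS]
  rw [← hF']
  refine h.coeff_eq_zero hM (c := F) (fun S hS => ?_) hsum R.2.2
  by_contra hcon
  simp [hF, hcon] at hS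

/-- A clique whose vectors span is maximal. -/
theorem maximal_of_span (h : IsRootFan g Coh) {M : Set ρ} (hM : Clique Coh M)
    (hspan : Submodule.span ℝ (g '' M) = ⊤) (h0 : ∀ R, g R = 0 → R ∈ M) :
    Maximal (Clique Coh) M := by
  classical
  refine ⟨hM, fun M' hM' hsub R hR => ?_⟩
  by_contra hRM
  have hgR : g R ≠ 0 := fun h => hRM (h0 R h)
  have hmem : g R ∈ Submodule.span ℝ (g '' M) := hspan ▸ Submodule.mem_top
  rw [Finsupp.mem_span_image_iff_linearCombination] at hmem
  obtain ⟨l, hl, hlR⟩ := hmem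
  rw [Finsupp.mem_supported] at hl
  rw [Finsupp.linearCombination_apply, Finsupp.sum_fintype _ _ (by simp)] at hlR
  have hlz : l R = 0 := by
    by_contra hne
    exact hRM (hl (by simpa using hne))
  -- Subtracting R from its expansion in M gives a relation within M' whose coefficient at R is -1.
  have := h.coeff_eq_zero hM' (c := fun S => l S - (Pi.single R 1 : ρ → ℝ) S) (fun S hS => ?_) (by
    simp [sub_smul, Finset.sum_sub_distrib, hlR, Pi.single_apply, ite_smul]) hgR
  · simp [hlz] at this
  · by_cases hSR : S = R
    · exact hSR ▸ hR
    · exact hsub (hl (by simpa [hSR] using hS))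

end IsRootFan

end GPoly

/-! ### Pulling and the vertex sets of the cells -/

namespace GPoly

/-- The combinatorial content of one pull. The base Z consists of the zeros in `Y` of a function f
that defines the facet. An earlier apex stays in the base, since otherwise the remaining vertices
would still span. The last clause holds because f is nonnegative on `Y` and f r + f s = f p + f q =
0. -/
theorem exists_pyramid_base {V : Type*} [NormedAddCommGroup V] [NormedSpace ℝ V]
    [FiniteDimensional ℝ V] {Y : Set V} (hfin : Y.Finite) (hY : affineSpan ℝ Y = ⊤) {Φ : Set V}
    (hΦ : IsFacet (convexHull ℝ Y) Φ) {x : V} (hx : x ∈ Y) (hxΦ : x ∉ Φ) :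
    ∃ Z ⊆ Y, convexHull ℝ (insert x Φ) = convexHull ℝ (insert x Z) ∧
      affineSpan ℝ (insert x Z) = ⊤ ∧ x ∉ affineSpan ℝ Z ∧
      (∀ y ∈ Y, y ≠ x → y ∉ affineSpan ℝ (Y \ {y}) → y ∈ Z) ∧
      ∀ p ∈ Z, ∀ q ∈ Z, ∀ r ∈ Y, ∀ s ∈ Y, p + q = r + s → r ∈ Z ∧ s ∈ Z := by
  obtain ⟨f, hf, hfx, -, hconv, hspan⟩ := IsFacet.exists_zeros hfin hY hΦ hx hxΦ
  refine ⟨{y ∈ Y | f y = 0}, Set.sep_subset _ _, ?_, hspan, fun h => ?_, fun y hy hyx hapex => ?_, ?_⟩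
  · rw [hconv, convexHull_insert_convexHull]
  · have : affineSpan ℝ {y ∈ Y | f y = 0} ≤ (affineSpan ℝ {0}).comap f := by
      rw [affineSpan_le]
      intro y hy
      simp [hy.2]
    have hx0 : f x = 0 := by simpa using this h
    exact hfx.ne' hx0
  · by_contra hyZ
    apply hapex
    have : affineSpan ℝ (insert x {y ∈ Y | f y = 0}) ≤ affineSpan ℝ (Y \ {y}) := by
      apply affineSpan_mono
      rintro z (rfl | hz)
      · exact ⟨hx, fun h => hyx h.symm⟩
      · refine ⟨hz.1, ?_⟩
        rintro rfl
        exact hyZ hz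
    rw [hspan] at this
    exact this (AffineSubspace.mem_top ℝ V y)
  · rintro p ⟨hp, hp0⟩ q ⟨hq, hq0⟩ r hr s hs hsum
    have h : ∀ y, f y = f.linear y + f 0 := fun y => congrFun (AffineMap.decomp f) y
    have h1 : f r + f s = 0 := by
      have : f.linear r + f.linear s = f.linear p + f.linear q := by
        rw [← map_add, ← hsum, map_add]
      rw [h] at hp0 hq0
      rw [h r, h s]
      linarith
    have hr' := hf r hr
    have hs' := hf s hs
    exact ⟨⟨hr, by linarith⟩, ⟨hs, by linarith⟩⟩

theorem pullSeq_append_singleton {W : Type*} [AddCommGroup W] [Module ℝ W] [TopologicalSpace W]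
    (P : Set W) (xs : List W) (x : W) : pullSeq P (xs ++ [x]) = pull (pullSeq P xs) x := by
  simp [pullSeq, List.foldl_append]

namespace IsRootFan

variable {ι ρ : Type*} [Fintype ι] [DecidableEq ι] [Fintype ρ] {g : ρ → ι → ℝ}
  {Coh : ρ → ρ → Prop}

/-- The vertex set of a cell that arises by pulling at the vectors of the elements of `D`. -/
structure PullCell (g : ρ → ι → ℝ) (Coh : ρ → ρ → Prop) (D : Set ρ) (Y : Set (ι → ℝ)) : Prop where
  sub : Y ⊆ Set.range g
  span : affineSpan ℝ Y = ⊤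
  apex : ∀ R ∈ D, g R ∈ Y → g R ∉ affineSpan ℝ (Y \ {g R})
  closed : ∀ R S, ¬ Coh R S → g R ∈ Y → g S ∈ Y → ∀ R' S', g R + g S = g R' + g S' →
    g R' ∈ Y ∧ g S' ∈ Y

theorem PullCell.finite {D : Set ρ} {Y : Set (ι → ℝ)} (hY : PullCell g Coh D Y) : Y.Finite :=
  (Set.finite_range g).subset hY.sub

/-- The contradiction that drives the proof: an incoherent pair brings both vectors of the equal sum
into the cell, and then the apex g R' = g R + g S - g S' lies in the affine span of the other
vertices. -/
theorem PullCell.coherent {D : Set ρ} {Y : Set (ι → ℝ)} (hY : PullCell g Coh D Y) {R S R' S' : ρ}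
    (hR : g R ∈ Y) (hS : g S ∈ Y) (hsum : g R + g S = g R' + g S') (hR' : R' ∈ D)
    (h1 : g R' ≠ g R) (h2 : g R' ≠ g S) : Coh R S := by
  by_contra hcon
  obtain ⟨hr, hs⟩ := hY.closed R S hcon hR hS R' S' hsum
  refine hY.apex R' hR' hr ?_
  have hp : g R ∈ affineSpan ℝ (Y \ {g R'}) := mem_affineSpan ℝ ⟨hR, h1.symm⟩
  have hq : g S ∈ affineSpan ℝ (Y \ {g R'}) := mem_affineSpan ℝ ⟨hS, h2.symm⟩
  -- If S' and R' have the same vector, the apex is the midpoint of g R and g S instead.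
  by_cases hsr : g S' = g R'
  · have := AffineMap.lineMap_mem (1 / 2 : ℝ) hp hq
    convert this using 1
    rw [AffineMap.lineMap_apply_module]
    have h3 : g R' = (1 / 2 : ℝ) • (g R + g S) := by rw [hsum, hsr]; module
    rw [h3]; module
  · have hs' : g S' ∈ affineSpan ℝ (Y \ {g R'}) := mem_affineSpan ℝ ⟨hs, hsr⟩
    have := AffineSubspace.vadd_mem_of_mem_direction
      (AffineSubspace.vsub_mem_direction hp hs') hq
    convert this using 1
    simp only [vsub_eq_sub, vadd_eq_add]
    rw [sub_add_eq_add_sub, hsum]; module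

/-- The invariant survives pulling at x. Since x is coherent with all vertices of the cell, an
incoherent pair in the pyramid lies in its base, and the base contains every pair of vertices with
the same sum. -/
theorem PullCell.step {D : Set ρ} {Y : Set (ι → ℝ)} (hY : PullCell g Coh D Y) {x : ι → ℝ}
    (hx : x ∈ Y) (hcoh : ∀ R S, g R ∈ Y → g S ∈ Y → (g R = x ∨ g S = x) → Coh R S)
    {Φ : Set (ι → ℝ)} (hΦ : IsFacet (convexHull ℝ Y) Φ) (hxΦ : x ∉ Φ) :
    ∃ Y', PullCell g Coh (D ∪ g ⁻¹' {x}) Y' ∧ convexHull ℝ (insert x Φ) = convexHull ℝ Y' ∧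
      x ∈ Y' ∧ ∀ R ∈ D, g R ∈ Y → g R ∈ Y' := by
  obtain ⟨Z, hZY, hconv, hspan, hxZ, hapex, hclosed⟩ :=
    exists_pyramid_base hY.finite hY.span hΦ hx hxΦ
  have hsub : insert x Z ⊆ Y := Set.insert_subset hx hZY
  refine ⟨insert x Z, ⟨hsub.trans hY.sub, hspan, ?_, ?_⟩, hconv, Set.mem_insert _ _, ?_⟩
  · intro R hR hRY
    rcases eq_or_ne (g R) x with rfl | hne
    · refine fun h => hxZ (affineSpan_mono ℝ ?_ h)
      rintro z ⟨rfl | hz, hz'⟩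
      · exact absurd rfl hz'
      · exact hz
    · have hRD : R ∈ D := hR.resolve_right hne
      exact fun h => hY.apex R hRD (hsub hRY) (affineSpan_mono ℝ (Set.sdiff_subset_sdiff_left hsub) h)
  · intro R S hRS hR hS R' S' hsum
    obtain ⟨hr, hs⟩ := hY.closed R S hRS (hsub hR) (hsub hS) R' S' hsum
    have h1 : g R ∈ Z := hR.resolve_left fun h => hRS (hcoh R S (hsub hR) (hsub hS) (Or.inl h))
    have h2 : g S ∈ Z := hS.resolve_left fun h => hRS (hcoh R S (hsub hR) (hsub hS) (Or.inr h))
    exact (hclosed _ h1 _ h2 _ hr _ hs hsum).imp (Set.mem_insert_of_mem _) (Set.mem_insert_of_mem _)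
  · intro R hR hRY
    by_cases hne : g R = x
    · exact Or.inl hne
    · exact Or.inr (hapex _ hRY hne (hY.apex R hR hRY))

/-- The order `L` of the elements with nonzero vectors resolves every incoherent pair: some equal
sum involves an element that comes before the pair. -/
def Resolves (g : ρ → ι → ℝ) (Coh : ρ → ρ → Prop) (L : List ρ) : Prop :=
  ∀ R S, ¬ Coh R S → ∃ R' S', g R + g S = g R' + g S' ∧
    ∀ T, (T = R ∨ T = S) → ∀ L₁ L₂, L = L₁ ++ T :: L₂ → g R' = 0 ∨ R' ∈ L₁

theorem affineSpan_range (h : IsRootFan g Coh) : affineSpan ℝ (Set.range g) = ⊤ := by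
  obtain ⟨R, hR⟩ := h.exists_zero
  have h0 : (0 : ι → ℝ) ∈ Set.range g := ⟨R, hR⟩
  rw [AffineSubspace.affineSpan_eq_top_iff_vectorSpan_eq_top_of_nonempty _ _ _ ⟨0, h0⟩,
    vectorSpan_eq_span_vsub_set_right ℝ h0]
  simpa using h.span

theorem span_eq_top_of_affineSpan {Y : Set (ι → ℝ)} (h0 : (0 : ι → ℝ) ∈ Y)
    (hY : affineSpan ℝ Y = ⊤) : Submodule.span ℝ Y = ⊤ := by
  rw [AffineSubspace.affineSpan_eq_top_iff_vectorSpan_eq_top_of_nonempty _ _ _ ⟨0, h0⟩,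
    vectorSpan_eq_span_vsub_set_right ℝ h0] at hY
  simpa using hY

variable {L : List ρ}

theorem pullCell_range (h : IsRootFan g Coh) : PullCell g Coh ∅ (Set.range g) where
  sub := subset_rfl
  span := h.affineSpan_range
  apex := by simp
  closed := by simp

/-- The invariant of the pulling process. -/
theorem exists_pullCell (h : IsRootFan g Coh) (hnd : L.Nodup) (hL : ∀ R, R ∈ L ↔ g R ≠ 0)
    (hres : Resolves g Coh L) (L₁ : List ρ) :
    ∀ L₂, L = L₁ ++ L₂ → ∀ T ∈ pullSeq (convexHull ℝ (Set.range g)) (0 :: L₁.map g),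
      ∃ Y, PullCell g Coh ({R | g R = 0} ∪ {R | R ∈ L₁}) Y ∧ T = convexHull ℝ Y ∧ 0 ∈ Y := by
  obtain ⟨R₀, hR₀⟩ := h.exists_zero
  have hne : ∀ R S, ¬ Coh R S → g R ≠ 0 ∧ g S ≠ 0 := fun R S hRS =>
    ⟨fun h' => hRS (h.coh_of_eq_zero h').1, fun h' => hRS (h.coh_of_eq_zero h').2⟩
  induction L₁ using List.reverseRecOn with
  | nil =>
    intro L₂ _ T hT
    have h0 : (0 : ι → ℝ) ∈ Set.range g := ⟨R₀, hR₀⟩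
    rcases hT with ⟨rfl, hT⟩ | ⟨S, rfl, hS, Φ, hΦ, h0Φ, rfl⟩
    · exact absurd (subset_convexHull ℝ _ h0) hT
    · obtain ⟨Y', hY', hconv, h0Y, -⟩ := h.pullCell_range.step h0 (fun R S _ _ hRS => by
        rcases hRS with hR | hS
        · exact (h.coh_of_eq_zero hR).1
        · exact (h.coh_of_eq_zero hS).2) hΦ h0Φ
      refine ⟨Y', ?_, hconv, h0Y⟩
      convert hY' using 1
      ext; simp
  | append_singleton L₁ R ih =>
    intro L₂ hL₂ T hT
    rw [List.append_assoc, List.singleton_append] at hL₂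
    rw [List.map_append, List.map_singleton, ← List.cons_append, pullSeq_append_singleton] at hT
    have hR : g R ≠ 0 := (hL R).1 (by rw [hL₂]; simp)
    have hset : {S | g S = 0} ∪ {S | S ∈ L₁ ++ [R]} = ({S | g S = 0} ∪ {S | S ∈ L₁}) ∪ g ⁻¹' {g R} := by
      ext S
      simp only [List.mem_append, List.mem_singleton, Set.mem_union, Set.mem_ofPred_eq,
        Set.mem_preimage, Set.mem_singleton_iff, or_assoc]
      refine or_congr_right (or_congr_right ⟨fun hS => hS ▸ rfl, fun hS => (h.eq_of_eq hR hS.symm).symm⟩)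
    rcases hT with ⟨hT, hRT⟩ | ⟨S, hS, hRS, Φ, hΦ, hRΦ, rfl⟩
    · obtain ⟨Y, hY, rfl, h0Y⟩ := ih _ hL₂ T hT
      refine ⟨Y, ⟨hY.sub, hY.span, fun S hS hSY => ?_, hY.closed⟩, rfl, h0Y⟩
      rw [hset] at hS
      rcases hS with hS | hS
      · exact hY.apex S hS hSY
      · exact absurd (subset_convexHull ℝ _ (hS ▸ hSY)) hRT
    · obtain ⟨Y, hY, rfl, h0Y⟩ := ih _ hL₂ S hS
      have hRY := h.mem_of_mem_convexHull hR hY.sub hRS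
      -- When R is pulled it is coherent with every vertex of the cell: for an incoherent pair that
      -- contains R, the resolving element comes before R and is already an apex.
      have hcoh : ∀ U W, g U ∈ Y → g W ∈ Y → (g U = g R ∨ g W = g R) → Coh U W := by
        intro U W hU hW hUW
        by_contra hcon
        obtain ⟨hU0, hW0⟩ := hne U W hcon
        obtain ⟨U', W', hsum, hbefore⟩ := hres U W hcon
        have hnot : ∀ T, (T = U ∨ T = W) → g U' ≠ g T := by
          intro T hT heq
          have hT0 : g T ≠ 0 := by rcases hT with rfl | rfl <;> assumption
          have := (h.eq_of_eq hT0 heq.symm)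
          subst this
          obtain ⟨A, B, hAB⟩ := List.append_of_mem ((hL T).2 hT0)
          have hTA := (hbefore T hT A B hAB).resolve_left hT0
          rw [hAB] at hnd
          exact (List.nodup_append.1 hnd).2.2 T hTA T (by simp) rfl
        have hRUW : R = U ∨ R = W :=
          hUW.imp (fun e => h.eq_of_eq hR e.symm) (fun e => h.eq_of_eq hR e.symm)
        exact hcon (hY.coherent hU hW hsum (hbefore R hRUW _ _ hL₂) (hnot U (Or.inl rfl))
          (hnot W (Or.inr rfl)))
      obtain ⟨Y', hY', hconv, -, hmem⟩ := hY.step hRY hcoh hΦ hRΦ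
      refine ⟨Y', ?_, hconv, ?_⟩
      · rwa [hset]
      · have := hmem R₀ (Or.inl hR₀) (by rwa [hR₀])
        rwa [hR₀] at this

end IsRootFan

end GPoly

/-! ### Clique simplices: covering, triangulation, unimodularity -/

namespace GPoly
namespace IsRootFan

variable {ι ρ : Type*} [Fintype ι] [DecidableEq ι] [Fintype ρ] {g : ρ → ι → ℝ}
  {Coh : ρ → ρ → Prop} {L : List ρ}

/-- The simplices of the maximal cliques. -/
def cells (g : ρ → ι → ℝ) (Coh : ρ → ρ → Prop) : Set (Set (ι → ℝ)) :=
  {T | ∃ M : Set ρ, Maximal (Clique Coh) M ∧ T = convexHull ℝ (g '' M)}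

theorem mem_of_maximal (h : IsRootFan g Coh) {M : Set ρ} (hM : Maximal (Clique Coh) M) {R : ρ}
    (hR : g R = 0) : R ∈ M := by
  have hcl : Clique Coh (insert R M) := by
    rintro S (rfl | hS) T (rfl | hT)
    · exact h.refl _
    · exact (h.coh_of_eq_zero hR).1
    · exact (h.coh_of_eq_zero hR).2
    · exact hM.prop S hS T hT
  exact hM.le_of_ge hcl (Set.subset_insert _ _) (Set.mem_insert _ _)

theorem exists_weights {M : Set ρ} {y : ι → ℝ} (hy : y ∈ convexHull ℝ (g '' M)) :
    ∃ b : ρ → ℝ, (∀ R, 0 ≤ b R) ∧ (∀ R, b R ≠ 0 → R ∈ M) ∧ ∑ R, b R = 1 ∧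
      ∑ R, b R • g R = y := by
  classical
  obtain ⟨κ, _, w, z, hw, hw1, hz, rfl⟩ := mem_convexHull_iff_exists_fintype.1 hy
  choose r hr hrz using hz
  refine ⟨fun R => ∑ i with r i = R, w i, fun R => Finset.sum_nonneg fun i _ => hw i,
    fun R hR => ?_, ?_, ?_⟩
  · obtain ⟨i, hi, -⟩ := Finset.exists_ne_zero_of_sum_ne_zero hR
    rw [← (Finset.mem_filter.1 hi).2]
    exact hr i
  · exact (Finset.sum_fiberwise Finset.univ r w).trans hw1
  · rw [← Finset.sum_fiberwise Finset.univ r]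
    refine Finset.sum_congr rfl fun R _ => ?_
    rw [Finset.sum_smul]
    refine Finset.sum_congr rfl fun i hi => ?_
    rw [← hrz i, (Finset.mem_filter.1 hi).2]

theorem mem_convexHull_of_weights {M : Set ρ} {b : ρ → ℝ} (h0 : ∀ R, 0 ≤ b R)
    (hb : ∀ R, b R ≠ 0 → R ∈ M) (h1 : ∑ R, b R = 1) :
    ∑ R, b R • g R ∈ convexHull ℝ (g '' M) := by
  classical
  have h2 : ∑ R with b R ≠ 0, b R = 1 := by rw [Finset.sum_filter_ne_zero, h1]
  have h3 : ∑ R with b R ≠ 0, b R • g R = ∑ R, b R • g R := by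
    refine Finset.sum_subset (Finset.filter_subset _ _) fun R _ hR => ?_
    simp only [Finset.mem_filter, Finset.mem_univ, true_and, not_not] at hR
    simp [hR]
  rw [← h3]
  refine (convex_convexHull ℝ _).sum_mem (fun R _ => h0 R) h2 fun R hR => ?_
  exact subset_convexHull ℝ _ ⟨R, hb R (Finset.mem_filter.1 hR).2, rfl⟩

theorem weights_eq (h : IsRootFan g Coh) {M M' : Set ρ} (hM : Clique Coh M) (hM' : Clique Coh M')
    {a b : ρ → ℝ} (ha0 : ∀ R, 0 ≤ a R) (hb0 : ∀ R, 0 ≤ b R) (ha : ∀ R, a R ≠ 0 → R ∈ M)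
    (hb : ∀ R, b R ≠ 0 → R ∈ M') (hab : ∑ R, a R • g R = ∑ R, b R • g R) {R : ρ} (hR : g R ≠ 0) :
    a R = b R :=
  h.unique a b ha0 hb0 (fun R S hR hS => hM R (ha R hR) S (ha S hS))
    (fun R S hR hS => hM' R (hb R hR) S (hb S hS)) hab R hR

/-- Once everything has been pulled, each vertex of a cell is an apex, so no incoherent pair
survives; and a clique that spans is maximal. -/
theorem pullSeq_subset_cells (h : IsRootFan g Coh) (hnd : L.Nodup) (hL : ∀ R, R ∈ L ↔ g R ≠ 0)
    (hres : Resolves g Coh L) {T : Set (ι → ℝ)}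
    (hT : T ∈ pullSeq (convexHull ℝ (Set.range g)) (0 :: L.map g)) :
    affineSpan ℝ T = ⊤ ∧ T ∈ cells g Coh := by
  obtain ⟨Y, hY, rfl, h0⟩ := h.exists_pullCell hnd hL hres L [] (by simp) T hT
  have hall : ∀ R, R ∈ ({R | g R = 0} ∪ {R | R ∈ L} : Set ρ) := fun R => by
    by_cases hR : g R = 0
    · exact Or.inl hR
    · exact Or.inr ((hL R).2 hR)
  have himg : g '' (g ⁻¹' Y) = Y := Set.image_preimage_eq_of_subset hY.sub
  have hcl : Clique Coh (g ⁻¹' Y) := by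
    intro R hR S hS
    by_contra hcon
    have hR0 : g R ≠ 0 := fun h' => hcon (h.coh_of_eq_zero h').1
    have hS0 : g S ≠ 0 := fun h' => hcon (h.coh_of_eq_zero h').2
    obtain ⟨R', S', hsum, hbefore⟩ := hres R S hcon
    have hnot : ∀ T, (T = R ∨ T = S) → g R' ≠ g T := by
      intro T hT heq
      have hT0 : g T ≠ 0 := by rcases hT with rfl | rfl <;> assumption
      have := (h.eq_of_eq hT0 heq.symm)
      subst this
      obtain ⟨A, B, hAB⟩ := List.append_of_mem ((hL T).2 hT0)
      have hTA := (hbefore T hT A B hAB).resolve_left hT0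
      rw [hAB] at hnd
      exact (List.nodup_append.1 hnd).2.2 T hTA T (by simp) rfl
    exact hcon (hY.coherent hR hS hsum (hall R') (hnot R (Or.inl rfl)) (hnot S (Or.inr rfl)))
  refine ⟨by rw [affineSpan_convexHull, hY.span], g ⁻¹' Y, ?_, by rw [himg]⟩
  refine h.maximal_of_span hcl ?_ fun R hR => ?_
  · rw [himg]
    exact span_eq_top_of_affineSpan h0 hY.span
  · rw [Set.mem_preimage, hR]
    exact h0

/-- Genericity refers to all non-spanning sets of vectors, so it is inherited by each cell, and a
generic point passes into some pyramid at each pull. -/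
theorem mem_pullSeq_of_generic [Nonempty ι] (h : IsRootFan g Coh) (hnd : L.Nodup)
    (hL : ∀ R, R ∈ L ↔ g R ≠ 0) (hres : Resolves g Coh L) {y : ι → ℝ}
    (hy : y ∈ convexHull ℝ (Set.range g))
    (hgen : ∀ Z ⊆ Set.range g, affineSpan ℝ Z ≠ ⊤ → y ∉ affineSpan ℝ Z) (L₁ : List ρ) :
    ∀ L₂, L = L₁ ++ L₂ →
      ∃ T ∈ pullSeq (convexHull ℝ (Set.range g)) (0 :: L₁.map g), y ∈ T := by
  obtain ⟨R₀, hR₀⟩ := h.exists_zero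
  -- A point spans only a space of dimension zero, which `Nonempty ι` excludes.
  have hpt : ∀ x : ι → ℝ, affineSpan ℝ ({x} : Set (ι → ℝ)) ≠ ⊤ := by
    intro x hx
    have := congrArg AffineSubspace.direction hx
    rw [direction_affineSpan, vectorSpan_singleton, AffineSubspace.direction_top] at this
    exact bot_ne_top this
  induction L₁ using List.reverseRecOn with
  | nil =>
    intro _ _
    have h0 : (0 : ι → ℝ) ∈ Set.range g := ⟨R₀, hR₀⟩
    obtain ⟨Φ, hΦ, h0Φ, hyΦ⟩ := exists_isFacet_mem_pyramid (Set.finite_range g)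
      h.affineSpan_range h0 hy hgen (hpt 0)
    exact ⟨_, Or.inr ⟨_, rfl, subset_convexHull ℝ _ h0, Φ, hΦ, h0Φ, rfl⟩, hyΦ⟩
  | append_singleton L₁ R ih =>
    intro L₂ hL₂
    rw [List.append_assoc, List.singleton_append] at hL₂
    obtain ⟨T, hT, hyT⟩ := ih _ hL₂
    rw [List.map_append, List.map_singleton, ← List.cons_append, pullSeq_append_singleton]
    by_cases hRT : g R ∈ T
    · obtain ⟨Y, hY, rfl, -⟩ := h.exists_pullCell hnd hL hres L₁ _ hL₂ T hT
      have hR : g R ≠ 0 := (hL R).1 (by rw [hL₂]; simp)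
      obtain ⟨Φ, hΦ, hRΦ, hyΦ⟩ := exists_isFacet_mem_pyramid hY.finite hY.span
        (h.mem_of_mem_convexHull hR hY.sub hRT) hyT
        (fun Z hZ => hgen Z (hZ.trans hY.sub)) (hpt _)
      exact ⟨_, Or.inr ⟨_, hT, hRT, Φ, hΦ, hRΦ, rfl⟩, hyΦ⟩
    · exact ⟨T, Or.inl ⟨hT, hRT⟩, hyT⟩

theorem cells_finite : (cells g Coh).Finite := by
  refine (Set.finite_range fun M : Set ρ => convexHull ℝ (g '' M)).subset ?_
  rintro T ⟨M, -, rfl⟩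
  exact ⟨M, rfl⟩

/-- Generic points are dense because finitely many proper affine subspaces have measure zero. The
union of the cells is closed, and P lies in the closure of its interior. -/
theorem sUnion_pullSeq [Nonempty ι] (h : IsRootFan g Coh) (hnd : L.Nodup)
    (hL : ∀ R, R ∈ L ↔ g R ≠ 0) (hres : Resolves g Coh L) :
    convexHull ℝ (Set.range g) ⊆ ⋃₀ pullSeq (convexHull ℝ (Set.range g)) (0 :: L.map g) := by
  set P := convexHull ℝ (Set.range g) with hP
  set 𝒮 := pullSeq P (0 :: L.map g) with h𝒮
  have hsub : 𝒮 ⊆ cells g Coh := fun T hT => (h.pullSeq_subset_cells hnd hL hres hT).2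
  have hclosed : IsClosed (⋃₀ 𝒮) := by
    rw [Set.sUnion_eq_biUnion]
    refine (cells_finite.subset hsub).isClosed_biUnion fun T hT => ?_
    obtain ⟨M, -, rfl⟩ := hsub hT
    exact (Set.toFinite _).isClosed_convexHull ℝ
  let G : Set (ι → ℝ) := {y | ∀ Z ∈ {Z | Z ⊆ Set.range g ∧ affineSpan ℝ Z ≠ ⊤}, y ∉ affineSpan ℝ Z}
  have hG : Dense G := by
    apply MeasureTheory.Measure.dense_of_ae (μ := MeasureTheory.volume)
    rw [MeasureTheory.ae_ball_iff
      (((Set.finite_range g).finite_subsets.subset fun Z hZ => hZ.1).countable)]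
    intro Z hZ
    exact MeasureTheory.measure_eq_zero_iff_ae_notMem.1
      (MeasureTheory.Measure.addHaar_affineSubspace _ _ hZ.2)
  have hint : (interior P).Nonempty :=
    interior_convexHull_nonempty_iff_affineSpan_eq_top.2 h.affineSpan_range
  have h1 : P ⊆ closure (interior P) := by
    rw [(convex_convexHull ℝ _).closure_interior_eq_closure_of_nonempty_interior hint]
    exact subset_closure
  refine h1.trans (closure_minimal ?_ hclosed)
  refine (hG.open_subset_closure_inter isOpen_interior).trans (closure_minimal ?_ hclosed)
  rintro y ⟨hyP, hyG⟩
  obtain ⟨T, hT, hyT⟩ := h.mem_pullSeq_of_generic hnd hL hres (interior_subset hyP)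
    (fun Z hZ hZ' => hyG Z ⟨hZ, hZ'⟩) L [] (by simp)
  exact ⟨T, hT, hyT⟩

/-- Pulling at the origin and then along a resolving order yields the maximal clique simplices. -/
theorem pullSeq_eq_cells [Nonempty ι] (h : IsRootFan g Coh) (hnd : L.Nodup)
    (hL : ∀ R, R ∈ L ↔ g R ≠ 0) (hres : Resolves g Coh L) :
    pullSeq (convexHull ℝ (Set.range g)) (0 :: L.map g) = cells g Coh := by
  classical
  refine Set.Subset.antisymm (fun T hT => (h.pullSeq_subset_cells hnd hL hres hT).2) ?_
  rintro T ⟨M, hM, rfl⟩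
  obtain ⟨R₀, hR₀⟩ := h.exists_zero
  have hR₀M := h.mem_of_maximal hM hR₀
  set s : Finset ρ := Finset.univ.filter (· ∈ M) with hs
  have hspos : (0 : ℝ) < s.card := by
    rw [Nat.cast_pos, Finset.card_pos]
    exact ⟨R₀, by simp [hs, hR₀M]⟩
  -- The centroid of the vectors of M has positive coefficients on all of M. It lies in the simplex
  -- of some M', and uniqueness gives M ⊆ M'.
  let a : ρ → ℝ := fun R => if R ∈ M then (s.card : ℝ)⁻¹ else 0
  have ha0 : ∀ R, 0 ≤ a R := fun R => by
    dsimp only [a]; split_ifs <;> positivity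
  have haM : ∀ R, a R ≠ 0 → R ∈ M := fun R hR => by
    by_contra hcon; exact hR (if_neg hcon)
  have ha1 : ∑ R, a R = 1 := by
    simp only [a]
    rw [← Finset.sum_filter, Finset.sum_const, nsmul_eq_mul, ← hs, mul_inv_cancel₀ hspos.ne']
  have hmem := mem_convexHull_of_weights (g := g) ha0 haM ha1
  obtain ⟨T, hT, hyT⟩ := h.sUnion_pullSeq hnd hL hres (convexHull_mono (Set.image_subset_range _ _) hmem)
  obtain ⟨M', hM', rfl⟩ := (h.pullSeq_subset_cells hnd hL hres hT).2
  obtain ⟨b, hb0, hbM, -, hb⟩ := exists_weights hyT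
  have hMM' : M ⊆ M' := by
    intro R hR
    by_cases hgR : g R = 0
    · exact h.mem_of_maximal hM' hgR
    · have := h.weights_eq hM.prop hM'.prop ha0 hb0 haM hbM hb.symm hgR
      refine hbM R ?_
      rw [← this]
      simp only [a, if_pos hR]
      positivity
  rwa [hM.eq_of_subset hM'.prop hMM']

theorem exists_basis (h : IsRootFan g Coh) {M : Set ρ} (hM : Clique Coh M)
    (hspan : affineSpan ℝ (convexHull ℝ (g '' M)) = ⊤) :
    ∃ b : Module.Basis {R // R ∈ M ∧ g R ≠ 0} ℝ (ι → ℝ), ∀ R, b R = g R := by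
  rw [affineSpan_convexHull] at hspan
  have h1 : affineSpan ℝ (g '' M) ≤ (Submodule.span ℝ (Set.range fun R : {R // R ∈ M ∧ g R ≠ 0} =>
      g R)).toAffineSubspace := by
    rw [affineSpan_le]
    rintro _ ⟨R, hR, rfl⟩
    by_cases hgR : g R = 0
    · simp [hgR]
    · exact Submodule.subset_span ⟨⟨R, hR, hgR⟩, rfl⟩
  rw [hspan] at h1
  have h2 : ⊤ ≤ Submodule.span ℝ (Set.range fun R : {R // R ∈ M ∧ g R ≠ 0} => g R) :=
    fun x _ => h1 (AffineSubspace.mem_top ℝ (ι → ℝ) x)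
  exact ⟨Module.Basis.mk (h.linearIndependent hM) h2, fun R => Module.Basis.mk_apply _ _ _⟩

theorem image_eq_insert (h : IsRootFan g Coh) {M : Set ρ} (hM : Maximal (Clique Coh) M) :
    g '' M = insert 0 (Set.range fun R : {R // R ∈ M ∧ g R ≠ 0} => g R) := by
  obtain ⟨R₀, hR₀⟩ := h.exists_zero
  apply Set.Subset.antisymm
  · rintro _ ⟨R, hR, rfl⟩
    by_cases hgR : g R = 0
    · exact Or.inl hgR
    · exact Or.inr ⟨⟨R, hR, hgR⟩, rfl⟩
  · rintro _ (rfl | ⟨R, rfl⟩)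
    · exact ⟨R₀, h.mem_of_maximal hM hR₀, hR₀⟩
    · exact ⟨R, R.2.1, rfl⟩

theorem inter_eq_zeros (h : IsRootFan g Coh) {M M' : Set ρ} (hM : Maximal (Clique Coh) M)
    (hM' : Maximal (Clique Coh) M') (hspan : affineSpan ℝ (convexHull ℝ (g '' M)) = ⊤)
    (hne : convexHull ℝ (g '' M) ≠ convexHull ℝ (g '' M')) :
    IsExposed ℝ (convexHull ℝ (g '' M)) (convexHull ℝ (g '' M) ∩ convexHull ℝ (g '' M')) ∧
      convexHull ℝ (g '' M) ∩ convexHull ℝ (g '' M') ≠ convexHull ℝ (g '' M) := by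
  classical
  obtain ⟨bas, hbas⟩ := h.exists_basis hM.prop hspan
  -- This functional is 0 at the vertices shared with M' and 1 at the others, so it exposes the face
  -- spanned by the common vertices. By uniqueness a point of both simplices has coefficients on
  -- common elements only.
  let l : (ι → ℝ) →ₗ[ℝ] ℝ := bas.constr ℝ fun R => if (R : ρ) ∈ M' then (0 : ℝ) else 1
  have hl : ∀ R ∈ M, l (g R) = if R ∈ M' then (0 : ℝ) else 1 := by
    intro R hR
    by_cases hgR : g R = 0
    · rw [if_pos (h.mem_of_maximal hM' hgR), hgR, map_zero]
    · have := bas.constr_basis ℝ (fun R => if (R : ρ) ∈ M' then (0 : ℝ) else 1) ⟨R, hR, hgR⟩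
      rwa [hbas] at this
  have hnn : ∀ y ∈ convexHull ℝ (g '' M), 0 ≤ l.toAffineMap y := by
    refine nonneg_on_convexHull ?_
    rintro _ ⟨R, hR, rfl⟩
    rw [LinearMap.coe_toAffineMap, hl R hR]
    split_ifs <;> norm_num
  have hterm : ∀ {a : ρ → ℝ}, (∀ R, a R ≠ 0 → R ∈ M) → ∀ R, l (a R • g R) = if R ∈ M' then 0 else a R := by
    intro a ha R
    rw [map_smul, smul_eq_mul]
    by_cases hR : a R = 0
    · simp [hR]
    · rw [hl R (ha R hR)]
      split_ifs <;> simp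
  constructor
  · have : convexHull ℝ (g '' M) ∩ convexHull ℝ (g '' M') =
        {y ∈ convexHull ℝ (g '' M) | l.toAffineMap y = 0} := by
      ext y
      refine and_congr_right fun hy => ⟨fun hy' => ?_, fun hy0 => ?_⟩
      · obtain ⟨a, ha0, haM, -, rfl⟩ := exists_weights hy
        obtain ⟨b, hb0, hbM, -, hb⟩ := exists_weights hy'
        rw [LinearMap.coe_toAffineMap, map_sum]
        refine Finset.sum_eq_zero fun R _ => ?_
        rw [hterm haM]
        split_ifs with hR
        · rfl
        · have hgR : g R ≠ 0 := fun h' => hR (h.mem_of_maximal hM' h')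
          rw [h.weights_eq hM.prop hM'.prop ha0 hb0 haM hbM hb.symm hgR]
          by_contra hcon
          exact hR (hbM R hcon)
      · obtain ⟨a, ha0, haM, ha1, rfl⟩ := exists_weights hy
        refine mem_convexHull_of_weights ha0 (fun R hR => ?_) ha1
        by_contra hcon
        rw [LinearMap.coe_toAffineMap, map_sum, Finset.sum_congr rfl fun R _ => hterm haM R,
          Finset.sum_eq_zero_iff_of_nonneg fun R _ => by split_ifs <;> [rfl; exact ha0 R]] at hy0
        have := hy0 R (Finset.mem_univ R)
        rw [if_neg hcon] at this
        exact hR this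
    rw [this]
    exact isExposed_zeros hnn
  · intro heq
    apply hne
    have hMM' : M ⊆ M' := by
      intro R hR
      by_contra hcon
      have h1 : g R ∈ convexHull ℝ (g '' M') :=
        Set.inter_eq_left.1 heq (subset_convexHull ℝ _ ⟨R, hR, rfl⟩)
      obtain ⟨b, hb0, hbM, -, hb⟩ := exists_weights h1
      have hgR : g R ≠ 0 := fun h' => hcon (h.mem_of_maximal hM' h')
      have := h.weights_eq (a := Pi.single R 1) hM.prop hM'.prop (fun S => by
        by_cases hS : S = R
        · subst hS; simp
        · simp [hS]) hb0 (fun S hS => by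
          by_cases hSR : S = R
          · exact hSR ▸ hR
          · simp [hSR] at hS) hbM (by simp [hb, Pi.single_apply, ite_smul]) hgR
      rw [Pi.single_eq_same] at this
      exact hcon (hbM R (by rw [← this]; norm_num))
    rw [hM.eq_of_subset hM'.prop hMM']

theorem isTriangulation_cells [Nonempty ι] (h : IsRootFan g Coh) (hnd : L.Nodup)
    (hL : ∀ R, R ∈ L ↔ g R ≠ 0) (hres : Resolves g Coh L) :
    IsTriangulation (convexHull ℝ (Set.range g)) (cells g Coh) := by
  classical
  have heq := h.pullSeq_eq_cells hnd hL hres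
  have hspan : ∀ T ∈ cells g Coh, affineSpan ℝ T = ⊤ := fun T hT =>
    (h.pullSeq_subset_cells hnd hL hres (heq ▸ hT)).1
  have hdir : ∀ T : Set (ι → ℝ), affineSpan ℝ T = ⊤ → vectorSpan ℝ T = ⊤ := fun T hT => by
    rw [← direction_affineSpan, hT, AffineSubspace.direction_top]
  have hne : ∀ M, Maximal (Clique Coh) M → (g '' M).Nonempty := fun M hM => by
    rw [h.image_eq_insert hM]
    exact Set.insert_nonempty _ _
  refine ⟨⟨cells_finite, ?_, ?_, ?_, ?_⟩, ?_⟩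
  · rintro T ⟨M, hM, rfl⟩
    refine ⟨(Set.toFinite (g '' M)).toFinset, ?_, by simp⟩
    simpa using hne M hM
  · intro T hT
    rw [hdir T (hspan T hT), hdir _ (by rw [affineSpan_convexHull, h.affineSpan_range])]
  · refine Set.Subset.antisymm (Set.sUnion_subset ?_) (heq ▸ h.sUnion_pullSeq hnd hL hres)
    rintro T ⟨M, -, rfl⟩
    exact convexHull_mono (Set.image_subset_range _ _)
  · rintro S hS T hT hST
    have hS' := hspan S hS
    have hT' := hspan T hT
    obtain ⟨M, hM, rfl⟩ := hS
    obtain ⟨M', hM', rfl⟩ := hT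
    refine ⟨h.inter_eq_zeros hM hM' hS' hST, ?_⟩
    rw [Set.inter_comm]
    exact h.inter_eq_zeros hM' hM hT' hST.symm
  · rintro T ⟨M, hM, rfl⟩
    obtain ⟨s, hs⟩ := (Set.toFinite (g '' M)).exists_finset_coe
    refine ⟨s, Finset.coe_nonempty.1 (hs ▸ hne M hM), ?_, by rw [hs]⟩
    have h0 : (0 : ι → ℝ) ∈ g '' M := by rw [h.image_eq_insert hM]; exact Set.mem_insert _ _
    have h2 : AffineIndependent ℝ (fun x : (g '' M : Set (ι → ℝ)) => (x : ι → ℝ)) := by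
      rw [affineIndependent_set_iff_linearIndependent_vsub ℝ h0]
      have h3 := (h.linearIndependent hM.prop).linearIndepOn_id
      refine h3.mono ?_
      rintro _ ⟨x, ⟨hx, hx0⟩, rfl⟩
      rw [h.image_eq_insert hM] at hx
      simpa using hx.resolve_left hx0
    rw [← hs] at h2
    exact h2

theorem isUnimodularSimplex_cells [Nonempty ι] (h : IsRootFan g Coh) (hnd : L.Nodup)
    (hL : ∀ R, R ∈ L ↔ g R ≠ 0) (hres : Resolves g Coh L) {T : Set (ι → ℝ)}
    (hT : T ∈ cells g Coh) : IsUnimodularSimplex T := by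
  classical
  have hspan := (h.pullSeq_subset_cells hnd hL hres ((h.pullSeq_eq_cells hnd hL hres) ▸ hT)).1
  obtain ⟨M, hM, rfl⟩ := hT
  obtain ⟨bas, hbas⟩ := h.exists_basis hM.prop hspan
  have hint : ∀ R, ∃ z : ι → ℤ, (∀ i, (z i : ℝ) = g R i) ∧ (z = 0 ∨
      (∃ v, z = Pi.single v 1 ∨ z = Pi.single v (-1)) ∨
      ∃ v w, v ≠ w ∧ z = Pi.single v 1 - Pi.single w 1) := by
    intro R
    have hcast : ∀ (v : ι) (c : ℤ) (i : ι), (((Pi.single v c : ι → ℤ) i : ℤ) : ℝ) =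
        (Pi.single v (c : ℝ) : ι → ℝ) i := fun v c i => by
      by_cases hv : i = v
      · subst hv; simp
      · simp [hv]
    rcases h.form R with h0 | ⟨v, hv | hv⟩ | ⟨v, w, hvw, hv⟩
    · exact ⟨0, fun i => by simp [h0], Or.inl rfl⟩
    · exact ⟨Pi.single v 1, fun i => by rw [hcast, hv]; simp, Or.inr (Or.inl ⟨v, Or.inl rfl⟩)⟩
    · exact ⟨Pi.single v (-1), fun i => by rw [hcast, hv]; simp, Or.inr (Or.inl ⟨v, Or.inr rfl⟩)⟩
    · exact ⟨Pi.single v 1 - Pi.single w 1, fun i => by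
        rw [Pi.sub_apply, Int.cast_sub, hcast, hcast, hv]; simp, Or.inr (Or.inr ⟨v, w, hvw, rfl⟩)⟩
  choose z hz hform using hint
  have hcard : Fintype.card ι = Fintype.card {R // R ∈ M ∧ g R ≠ 0} := by
    rw [← Module.finrank_eq_card_basis bas, Module.finrank_fintype_fun_eq_card]
  let e := Fintype.equivOfCardEq hcard
  have hli : LinearIndependent ℤ fun i => z (e i) := by
    rw [Fintype.linearIndependent_iff]
    intro c hc i
    have h1 : ∑ j, (c j : ℝ) • bas (e j) = 0 := by
      ext k
      have := congrArg (Int.cast : ℤ → ℝ) (congrFun hc k)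
      simpa [hbas, hz] using this
    have h2 := Fintype.linearIndependent_iff.1 (bas.linearIndependent.comp e e.injective) _ h1 i
    exact_mod_cast h2
  have hsp : ⊤ ≤ Submodule.span ℤ (Set.range fun i => z (e i)) := by
    set Λ := Submodule.span ℤ (Set.range fun i => z (e i)) with hΛ
    have hzΛ : ∀ R, R ∈ M → g R ≠ 0 → z R ∈ Λ := fun R hR hgR =>
      Submodule.subset_span ⟨e.symm ⟨R, hR, hgR⟩, by simp⟩
    -- φ adds up the coordinates whose unit vector is missing from Λ. It vanishes on the basis: if
    -- e_v - e_w is in Λ, then e_v and e_w are both in Λ or both missing. Hence φ = 0 and no unit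
    -- vector is missing.
    let φ : (ι → ℝ) →ₗ[ℝ] ℝ :=
      ∑ i, (if (Pi.single i 1 : ι → ℤ) ∈ Λ then (0 : ℝ) else 1) • LinearMap.proj i
    have hφ : ∀ x, φ x = ∑ i, (if (Pi.single i 1 : ι → ℤ) ∈ Λ then (0 : ℝ) else 1) * x i :=
      fun x => by
        simp only [φ, LinearMap.sum_apply, LinearMap.smul_apply, LinearMap.proj_apply, smul_eq_mul]
    have hφs : ∀ (v : ι) (c : ℝ), φ (Pi.single v c) =
        (if (Pi.single v 1 : ι → ℤ) ∈ Λ then (0 : ℝ) else 1) * c := fun v c => by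
      simp [hφ, Pi.single_apply]
    have hzg : ∀ R, g R = fun i => (z R i : ℝ) := fun R => funext fun i => (hz R i).symm
    have hcast : ∀ (v : ι) (c : ℤ), (fun i => (((Pi.single v c : ι → ℤ) i : ℤ) : ℝ)) =
        (Pi.single v (c : ℝ) : ι → ℝ) := fun v c => by
      ext i
      by_cases hv : i = v
      · subst hv; simp
      · simp [hv]
    have hφ0 : φ = 0 := by
      refine bas.ext fun ⟨R, hR, hgR⟩ => ?_
      have hmem := hzΛ R hR hgR
      rw [hbas, hzg, LinearMap.zero_apply]
      rcases hform R with h0 | ⟨v, hv | hv⟩ | ⟨v, w, hvw, hv⟩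
      · exact absurd (by rw [hzg, h0]; ext; simp) hgR
      · rw [hv] at hmem ⊢
        rw [hcast, hφs, if_pos hmem, zero_mul]
      · rw [hv] at hmem ⊢
        have : (Pi.single v 1 : ι → ℤ) ∈ Λ := by
          have := Λ.neg_mem hmem
          rwa [← Pi.single_neg, neg_neg] at this
        rw [hcast, hφs, if_pos this, zero_mul]
      · rw [hv] at hmem ⊢
        have h1 : (fun i => (((Pi.single v 1 - Pi.single w 1 : ι → ℤ) i : ℤ) : ℝ)) =
            Pi.single v 1 - Pi.single w 1 := by
          have h2 := hcast v 1
          have h3 := hcast w 1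
          rw [Int.cast_one] at h2 h3
          rw [← h2, ← h3]
          ext i; simp
        have hiff : (Pi.single v 1 : ι → ℤ) ∈ Λ ↔ (Pi.single w 1 : ι → ℤ) ∈ Λ := by
          constructor <;> intro h'
          · have := Λ.sub_mem h' hmem
            rwa [sub_sub_cancel] at this
          · have := Λ.add_mem hmem h'
            rwa [sub_add_cancel] at this
        rw [h1, map_sub, hφs, hφs]
        simp [hiff]
    have hsingle : ∀ v, (Pi.single v 1 : ι → ℤ) ∈ Λ := by
      intro v
      by_contra hcon
      have := hφs v 1
      rw [hφ0, if_neg hcon] at this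
      norm_num at this
    intro x _
    rw [pi_eq_sum_univ' x]
    refine Λ.sum_mem fun i _ => Λ.smul_mem _ ?_
    convert hsingle i using 1
  refine ⟨Module.Basis.mk hli hsp, 0, ?_⟩
  rw [h.image_eq_insert hM]
  congr 2
  · ext; simp
  · rw [← e.surjective.range_comp]
    congr 1
    ext i j
    simp [hz]

end IsRootFan
end GPoly

/-! ### The inner graphs of paths and cycles and their full graphs -/

namespace GPoly

theorem directions_head {b : Bool} {k : List ℕ} (hk : k ≠ []) (hpos : ∀ x ∈ k, 0 < x) :
    (directions b k).head? = some b := by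
  cases k with
  | nil => exact absurd rfl hk
  | cons a ks =>
    obtain ⟨a, rfl⟩ := Nat.exists_eq_succ_of_ne_zero (hpos a (by simp)).ne'
    simp [directions, List.replicate_succ]

theorem directions_getLast {b : Bool} {k : List ℕ} (hk : k ≠ []) (hpos : ∀ x ∈ k, 0 < x) :
    (directions b k).getLast? = some (if Even k.length then !b else b) := by
  induction k generalizing b with
  | nil => exact absurd rfl hk
  | cons a ks ih =>
    obtain ⟨a, rfl⟩ := Nat.exists_eq_succ_of_ne_zero (hpos a (by simp)).ne'
    rcases eq_or_ne ks [] with rfl | hks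
    · simp [directions, List.getLast?_replicate]
    · rw [directions, List.getLast?_append, ih hks fun x hx => hpos x (by simp [hx])]
      simp only [List.length_cons, Nat.even_add_one]
      split_ifs <;> simp

theorem get_eq_of_getElem?_eq {α : Type*} {l : List α} {i : Fin l.length} {x : α}
    (h : l[(i : ℕ)]? = some x) : l.get i = x := by
  simpa using h

namespace Zigzag

/-- The properties shared by the inner graphs of `Path(k)` and `Cycle(k)`. -/
structure IsLegGraph (Z : Zigzag) : Prop where
  m_pos : 0 < Z.m
  n_cases : Z.n = Z.m ∨ Z.n = Z.m + 1
  lo_val : ∀ j, (Z.lo j : ℕ) = j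
  hi_val : ∀ j, (Z.hi j : ℕ) = j + 1 ∨ ((Z.hi j : ℕ) = 0 ∧ (j : ℕ) + 1 = Z.m ∧ Z.n = Z.m)
  -- In a cycle, this field and the next make vertex `0` the tail of both its inner edges: it starts
  -- the first leg and the last one.
  up_first : Z.n = Z.m → ∀ j : Fin Z.m, (j : ℕ) = 0 → Z.up j = true
  up_last : Z.n = Z.m → ∀ j : Fin Z.m, (j : ℕ) + 1 = Z.m → Z.up j = false

theorem isLegGraph_path {b : Bool} {k : List ℕ} (hk : k ≠ []) (hpos : ∀ x ∈ k, 0 < x) :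
    (path b k).IsLegGraph where
  m_pos := by
    have := directions_head (b := b) hk hpos
    rw [path]
    by_contra h
    have h2 : directions b k = [] := List.length_eq_zero_iff.1 (by simpa using h)
    simp [h2] at this
  n_cases := Or.inr rfl
  lo_val _ := rfl
  hi_val j := Or.inl (Fin.val_succ j)
  up_first h := absurd h (Nat.succ_ne_self _)
  up_last h := absurd h (Nat.succ_ne_self _)

theorem isLegGraph_cycle {k : List ℕ} (hk : k ≠ []) (hpos : ∀ x ∈ k, 0 < x) (he : Even k.length) :
    (cycle k).IsLegGraph where
  m_pos := by
    have := directions_head (b := true) hk hpos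
    rw [cycle]
    by_contra h
    have h2 : directions true k = [] := List.length_eq_zero_iff.1 (by simpa using h)
    simp [h2] at this
  n_cases := Or.inl rfl
  lo_val _ := rfl
  hi_val j := by
    have hj : (j : ℕ) < (directions true k).length := j.2
    rcases Nat.lt_or_ge ((j : ℕ) + 1) (directions true k).length with h | h
    · exact Or.inl (Nat.mod_eq_of_lt h)
    · have h' : (j : ℕ) + 1 = (directions true k).length := by omega
      refine Or.inr ⟨?_, h', rfl⟩
      change ((j : ℕ) + 1) % (directions true k).length = 0
      rw [h', Nat.mod_self]
  up_first _ j hj := by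
    have := directions_head (b := true) hk hpos
    rw [List.head?_eq_getElem?] at this
    exact get_eq_of_getElem?_eq (by rw [hj, this])
  up_last _ j hj := by
    have := directions_getLast (b := true) hk hpos
    rw [if_pos he, List.getLast?_eq_getElem?] at this
    have hj' : (j : ℕ) = (directions true k).length - 1 := by
      have : (j : ℕ) + 1 = (directions true k).length := hj
      omega
    exact get_eq_of_getElem?_eq (by rw [hj', this]; rfl)

theorem isLegGraph {Z : Zigzag} (hZ : Z.IsPath ∨ Z.IsCycle) : Z.IsLegGraph := by
  rcases hZ with ⟨b, k, hk, hpos, rfl⟩ | ⟨k, hk, hpos, he, rfl⟩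
  · exact isLegGraph_path hk hpos
  · exact isLegGraph_cycle hk hpos he

namespace IsLegGraph

variable {Z : Zigzag}

theorem lo_inj (hZ : Z.IsLegGraph) {i j : Fin Z.m} (h : Z.lo i = Z.lo j) : i = j := by
  have := hZ.lo_val i
  rw [h, hZ.lo_val j] at this
  exact Fin.ext this.symm

theorem hi_inj (hZ : Z.IsLegGraph) {i j : Fin Z.m} (h : Z.hi i = Z.hi j) : i = j := by
  have h1 := hZ.hi_val i
  have h2 := hZ.hi_val j
  rw [h] at h1
  refine Fin.ext ?_
  omega

/-- Consecutive inner edges on a directed path point in the same direction. -/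
theorem up_eq (hZ : Z.IsLegGraph) {i j : Fin Z.m} (h : Z.head i = Z.tail j) : Z.up i = Z.up j := by
  unfold head tail at h
  cases hi : Z.up i <;> cases hj : Z.up j <;> simp only [hi, hj, if_true, if_false, Bool.false_eq_true] at h
  · rfl
  · rw [hZ.lo_inj h, hj] at hi; exact absurd hi (by simp)
  · rw [hZ.hi_inj h, hj] at hi; exact absurd hi (by simp)
  · rfl

theorem card_lo_le (hZ : Z.IsLegGraph) (v : Fin Z.n) : Finset.card {j | Z.lo j = v} ≤ 1 := by
  rw [Finset.card_le_one]
  intro i hi j hj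
  exact hZ.lo_inj (((Finset.mem_filter.1 hi).2).trans (Finset.mem_filter.1 hj).2.symm)

theorem card_hi_le (hZ : Z.IsLegGraph) (v : Fin Z.n) : Finset.card {j | Z.hi j = v} ≤ 1 := by
  rw [Finset.card_le_one]
  intro i hi j hj
  exact hZ.hi_inj (((Finset.mem_filter.1 hi).2).trans (Finset.mem_filter.1 hj).2.symm)

theorem card_head_le (hZ : Z.IsLegGraph) (v : Fin Z.n) : Finset.card {j | Z.head j = v} ≤ 2 := by
  have hsub : (Finset.univ.filter fun j => Z.head j = v) ⊆
      (Finset.univ.filter fun j => Z.lo j = v) ∪ Finset.univ.filter fun j => Z.hi j = v := by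
    intro j
    simp only [Finset.mem_filter, Finset.mem_univ, true_and, Finset.mem_union]
    unfold head
    split_ifs <;> tauto
  have h1 := (Finset.card_le_card hsub).trans (Finset.card_union_le _ _)
  have h2 := hZ.card_lo_le v
  have h3 := hZ.card_hi_le v
  omega

theorem card_tail_le (hZ : Z.IsLegGraph) (v : Fin Z.n) : Finset.card {j | Z.tail j = v} ≤ 2 := by
  have hsub : (Finset.univ.filter fun j => Z.tail j = v) ⊆
      (Finset.univ.filter fun j => Z.lo j = v) ∪ Finset.univ.filter fun j => Z.hi j = v := by
    intro j
    simp only [Finset.mem_filter, Finset.mem_univ, true_and, Finset.mem_union]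
    unfold tail
    split_ifs <;> tauto
  have h1 := (Finset.card_le_card hsub).trans (Finset.card_union_le _ _)
  have h2 := hZ.card_lo_le v
  have h3 := hZ.card_hi_le v
  omega

/-- Inner edges that enter the tail of `j` have the direction of `j`, which leaves room for only
one. Hence some source edge ends at the tail. -/
theorem card_head_tail_le (hZ : Z.IsLegGraph) (j : Fin Z.m) :
    Finset.card {i | Z.head i = Z.tail j} ≤ 1 := by
  rw [Finset.card_le_one]
  intro i hi i' hi'
  simp only [Finset.mem_filter, Finset.mem_univ, true_and] at hi hi'
  have h1 := hZ.up_eq hi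
  have h2 := hZ.up_eq hi'
  have h3 := hi.trans hi'.symm
  cases hj : Z.up j <;> simp only [head, h1, h2, hj, if_true, Bool.false_eq_true, if_false] at h3
  · exact hZ.lo_inj h3
  · exact hZ.hi_inj h3

theorem card_tail_head_le (hZ : Z.IsLegGraph) (j : Fin Z.m) :
    Finset.card {i | Z.tail i = Z.head j} ≤ 1 := by
  rw [Finset.card_le_one]
  intro i hi i' hi'
  simp only [Finset.mem_filter, Finset.mem_univ, true_and] at hi hi'
  have h1 := hZ.up_eq hi.symm
  have h2 := hZ.up_eq hi'.symm
  have h3 := hi.trans hi'.symm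
  cases hj : Z.up j <;> simp only [tail, ← h1, ← h2, hj, if_true, Bool.false_eq_true, if_false] at h3
  · exact hZ.hi_inj h3
  · exact hZ.lo_inj h3

theorem exists_incident (hZ : Z.IsLegGraph) (v : Fin Z.n) :
    ∃ j : Fin Z.m, Z.head j = v ∨ Z.tail j = v := by
  have h0 := hZ.m_pos
  obtain ⟨j, hj⟩ : ∃ j : Fin Z.m, Z.lo j = v ∨ Z.hi j = v := by
    rcases Nat.lt_or_ge (v : ℕ) Z.m with h | h
    · exact ⟨⟨v, h⟩, Or.inl (Fin.ext (hZ.lo_val _))⟩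
    · refine ⟨⟨Z.m - 1, by omega⟩, Or.inr (Fin.ext ?_)⟩
      have h1 := hZ.hi_val ⟨Z.m - 1, by omega⟩
      have h2 := hZ.n_cases
      have h3 := v.2
      simp only at h1
      omega
  refine ⟨j, ?_⟩
  unfold head tail
  cases Z.up j <;> simp <;> tauto

end IsLegGraph

/-- The position of a vertex along the legs in direction `d`, increasing along the edges of these
legs. In a cycle, vertex `0` comes after all others on the legs that point downwards. -/
def pos (Z : Zigzag) (d : Bool) (v : Fin Z.n) : ℤ :=
  if d then (v : ℕ) else if (v : ℕ) = 0 ∧ Z.n = Z.m then -(Z.n : ℤ) else -((v : ℕ) : ℤ)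

/-- The special value -n at vertex `0` of a cycle is what makes the position increase along the
wrapping edge, which runs from `0` to n - 1. -/
theorem IsLegGraph.pos_lt {Z : Zigzag} (hZ : Z.IsLegGraph) (j : Fin Z.m) :
    Z.pos (Z.up j) (Z.tail j) < Z.pos (Z.up j) (Z.head j) := by
  have h1 := hZ.lo_val j
  have h2 := hZ.hi_val j
  have h3 := fun h => hZ.up_first h j
  have h4 := fun h => hZ.up_last h j
  unfold pos head tail
  cases hj : Z.up j <;> simp only [hj, if_true, Bool.false_eq_true, if_false] at h3 h4 ⊢
  · split_ifs with h5 h6 h6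
    · exact absurd (h3 h6.2 (by omega)) (by simp)
    · omega
    · have := h3 h6.2 (by omega)
      simp at this
    · omega
  · rcases h2 with h2 | ⟨-, h2, h5⟩
    · omega
    · exact absurd (h4 h5 h2) (by simp)

section Dag

variable {Z : Zigzag}

@[simp] theorem dag_src_inl (j : Fin Z.m) : Z.dag.src (.inl j) = .inner (Z.tail j) := rfl

@[simp] theorem dag_tgt_inl (j : Fin Z.m) : Z.dag.tgt (.inl j) = .inner (Z.head j) := rfl

theorem src_cases (e : Z.Edge) : Z.dag.src e = .source ∨ ∃ v, Z.dag.src e = .inner v := by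
  rcases e with j | e | e
  · exact Or.inr ⟨_, rfl⟩
  · exact Or.inl rfl
  · exact Or.inr ⟨_, rfl⟩

theorem tgt_cases (e : Z.Edge) : Z.dag.tgt e = .sink ∨ ∃ v, Z.dag.tgt e = .inner v := by
  rcases e with j | e | e
  · exact Or.inr ⟨_, rfl⟩
  · exact Or.inr ⟨_, rfl⟩
  · exact Or.inl rfl

theorem exists_eq_inl {e : Z.Edge} {u v : Fin Z.n} (hu : Z.dag.src e = .inner u)
    (hv : Z.dag.tgt e = .inner v) : ∃ j, e = .inl j ∧ Z.tail j = u ∧ Z.head j = v := by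
  rcases e with j | e | e
  · exact ⟨j, rfl, by simpa using hu, by simpa using hv⟩
  · cases hu
  · cases hv

theorem tgt_ne_sink_of_src {e : Z.Edge} (h : Z.dag.src e = .source) :
    ∃ v, Z.dag.tgt e = .inner v := by
  rcases e with j | e | e
  · cases h
  · exact ⟨_, rfl⟩
  · cases h

theorem src_ne_source_of_tgt {e : Z.Edge} (h : Z.dag.tgt e = .sink) :
    ∃ v, Z.dag.src e = .inner v := by
  rcases e with j | e | e
  · cases h
  · cases h
  · exact ⟨_, rfl⟩

open Classical in
theorem IsLegGraph.card_tgt (hZ : Z.IsLegGraph) (v : Fin Z.n) :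
    Finset.card {e | Z.dag.tgt e = .inner v} = 2 := by
  rw [Finset.card_filter, Fintype.sum_sum_type, Fintype.sum_sum_type, Fintype.sum_sigma]
  have h1 : ∑ j, (if Z.dag.tgt (.inl j) = .inner v then 1 else 0) =
      Finset.card {j | Z.head j = v} := by
    rw [Finset.card_filter]
    simp
  have h2 : ∀ u, ∑ x, (if Z.dag.tgt (.inr (.inl ⟨u, x⟩)) = .inner v then 1 else 0) =
      if u = v then 2 - Finset.card {j | Z.head j = v} else 0 := by
    intro u
    have : ∀ x, Z.dag.tgt (.inr (.inl ⟨u, x⟩)) = .inner u := fun _ => rfl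
    simp only [this, Vertex.inner.injEq]
    split_ifs with h
    · subst h; simp
    · simp
  have h3 : ∀ x, (if Z.dag.tgt (.inr (.inr x)) = .inner v then 1 else 0) = 0 := fun x =>
    if_neg fun h => by cases h
  rw [h1, Finset.sum_congr rfl fun u _ => h2 u, Finset.sum_congr rfl fun x _ => h3 x]
  have := hZ.card_head_le v
  simp
  omega

open Classical in
theorem IsLegGraph.card_src (hZ : Z.IsLegGraph) (v : Fin Z.n) :
    Finset.card {e | Z.dag.src e = .inner v} = 2 := by
  rw [Finset.card_filter, Fintype.sum_sum_type, Fintype.sum_sum_type,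
    Fintype.sum_sigma (fun x => if Z.dag.src (.inr (.inr x)) = .inner v then 1 else 0)]
  have h1 : ∑ j, (if Z.dag.src (.inl j) = .inner v then 1 else 0) =
      Finset.card {j | Z.tail j = v} := by
    rw [Finset.card_filter]
    simp
  have h2 : ∀ u, ∑ x, (if Z.dag.src (.inr (.inr ⟨u, x⟩)) = .inner v then 1 else 0) =
      if u = v then 2 - Finset.card {j | Z.tail j = v} else 0 := by
    intro u
    have : ∀ x, Z.dag.src (.inr (.inr ⟨u, x⟩)) = .inner u := fun _ => rfl
    simp only [this, Vertex.inner.injEq]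
    split_ifs with h
    · subst h; simp
    · simp
  have h3 : ∀ x, (if Z.dag.src (.inr (.inl x)) = .inner v then 1 else 0) = 0 := fun x =>
    if_neg fun h => by cases h
  rw [h1, Finset.sum_congr rfl fun u _ => h2 u, Finset.sum_congr rfl fun x _ => h3 x]
  have := hZ.card_tail_le v
  simp
  omega

theorem IsLegGraph.exists_pair_tgt (hZ : Z.IsLegGraph) (v : Fin Z.n) :
    ∃ a b, a ≠ b ∧ Z.dag.tgt a = .inner v ∧ Z.dag.tgt b = .inner v ∧
      ∀ e, Z.dag.tgt e = .inner v → e = a ∨ e = b := by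
  classical
  obtain ⟨a, b, hab, h⟩ := Finset.card_eq_two.1 (hZ.card_tgt v)
  simp only [Finset.ext_iff, Finset.mem_filter, Finset.mem_univ, true_and, Finset.mem_insert,
    Finset.mem_singleton] at h
  exact ⟨a, b, hab, (h a).2 (Or.inl rfl), (h b).2 (Or.inr rfl), fun e he => (h e).1 he⟩

theorem IsLegGraph.exists_pair_src (hZ : Z.IsLegGraph) (v : Fin Z.n) :
    ∃ a b, a ≠ b ∧ Z.dag.src a = .inner v ∧ Z.dag.src b = .inner v ∧
      ∀ e, Z.dag.src e = .inner v → e = a ∨ e = b := by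
  classical
  obtain ⟨a, b, hab, h⟩ := Finset.card_eq_two.1 (hZ.card_src v)
  simp only [Finset.ext_iff, Finset.mem_filter, Finset.mem_univ, true_and, Finset.mem_insert,
    Finset.mem_singleton] at h
  exact ⟨a, b, hab, (h a).2 (Or.inl rfl), (h b).2 (Or.inr rfl), fun e he => (h e).1 he⟩

theorem IsLegGraph.exists_sourceEdge (hZ : Z.IsLegGraph) (j : Fin Z.m) :
    ∃ e, Z.dag.src e = .source ∧ Z.dag.tgt e = .inner (Z.tail j) := by
  have := hZ.card_head_tail_le j
  exact ⟨.inr (.inl ⟨Z.tail j, ⟨0, by omega⟩⟩), rfl, rfl⟩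

theorem IsLegGraph.exists_sinkEdge (hZ : Z.IsLegGraph) (j : Fin Z.m) :
    ∃ e, Z.dag.tgt e = .sink ∧ Z.dag.src e = .inner (Z.head j) := by
  have := hZ.card_tail_head_le j
  exact ⟨.inr (.inr ⟨Z.head j, ⟨0, by omega⟩⟩), rfl, rfl⟩

theorem isSource_iff (hZ : Z.IsLegGraph) (v : Vertex Z.n) (hv : v ≠ .sink) :
    Z.dag.IsSource v ↔ v = .source := by
  constructor
  · intro h
    cases v with
    | source => rfl
    | sink => exact absurd rfl hv
    | inner i =>
      obtain ⟨a, -, -, ha, -⟩ := hZ.exists_pair_tgt i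
      exact absurd ha (h a)
  · rintro rfl e he
    rcases tgt_cases e with h | ⟨v, h⟩ <;> rw [h] at he <;> cases he

theorem isSink_iff (hZ : Z.IsLegGraph) (v : Vertex Z.n) (hv : v ≠ .source) :
    Z.dag.IsSink v ↔ v = .sink := by
  constructor
  · intro h
    cases v with
    | sink => rfl
    | source => exact absurd rfl hv
    | inner i =>
      obtain ⟨a, -, -, ha, -⟩ := hZ.exists_pair_src i
      exact absurd ha (h a)
  · rintro rfl e he
    rcases src_cases e with h | ⟨v, h⟩ <;> rw [h] at he <;> cases he

/-- The inner vertices of the full graph are the vertices of the inner graph. -/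
def innerVertex (hZ : Z.IsLegGraph) (i : Fin Z.n) : Z.dag.InnerVertex :=
  ⟨.inner i, by
    rw [isSource_iff hZ _ (by simp), isSink_iff hZ _ (by simp)]
    simp⟩

theorem exists_innerVertex (hZ : Z.IsLegGraph) (v : Z.dag.InnerVertex) :
    ∃ i, v = innerVertex hZ i := by
  obtain ⟨v, h1, h2⟩ := v
  cases v with
  | source => exact absurd ((isSource_iff hZ _ (by simp)).2 rfl) h1
  | sink => exact absurd ((isSink_iff hZ _ (by simp)).2 rfl) h2
  | inner i => exact ⟨i, rfl⟩

theorem exists_val_eq (hZ : Z.IsLegGraph) (v : Z.dag.InnerVertex) : ∃ i, v.1 = .inner i := by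
  obtain ⟨i, rfl⟩ := exists_innerVertex hZ v
  exact ⟨i, rfl⟩

end Dag

end Zigzag
end GPoly

/-! ### Routes as lists of edges: splicing, direction, positions -/

namespace GPoly

theorem exists_common_suffix {α : Type*} (l l' : List α) :
    (∃ p, l = p ++ l') ∨ (∃ p, l' = p ++ l) ∨
      ∃ p q c a b, a ≠ b ∧ l = p ++ a :: c ∧ l' = q ++ b :: c := by
  induction l using List.reverseRecOn generalizing l' with
  | nil => exact Or.inr (Or.inl ⟨l', by simp⟩)
  | append_singleton l x ih =>
    rcases List.eq_nil_or_concat' l' with rfl | ⟨l', y, rfl⟩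
    · exact Or.inl ⟨l ++ [x], by simp⟩
    · by_cases hxy : x = y
      · subst hxy
        rcases ih l' with ⟨p, rfl⟩ | ⟨p, rfl⟩ | ⟨p, q, c, a, b, hab, rfl, rfl⟩
        · exact Or.inl ⟨p, by simp⟩
        · exact Or.inr (Or.inl ⟨p, by simp⟩)
        · exact Or.inr (Or.inr ⟨p, q, c ++ [x], a, b, hab, by simp, by simp⟩)
      · exact Or.inr (Or.inr ⟨l, l', [], x, y, hxy, by simp, by simp⟩)

theorem exists_common_prefix {α : Type*} (l l' : List α) :
    (∃ p, l = l' ++ p) ∨ (∃ p, l' = l ++ p) ∨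
      ∃ c p q a b, a ≠ b ∧ l = c ++ a :: p ∧ l' = c ++ b :: q := by
  induction l generalizing l' with
  | nil => exact Or.inr (Or.inl ⟨l', by simp⟩)
  | cons x l ih =>
    cases l' with
    | nil => exact Or.inl ⟨x :: l, by simp⟩
    | cons y l' =>
      by_cases hxy : x = y
      · subst hxy
        rcases ih l' with ⟨p, rfl⟩ | ⟨p, rfl⟩ | ⟨c, p, q, a, b, hab, rfl, rfl⟩
        · exact Or.inl ⟨p, by simp⟩
        · exact Or.inr (Or.inl ⟨p, by simp⟩)
        · exact Or.inr (Or.inr ⟨x :: c, p, q, a, b, hab, by simp, by simp⟩)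
      · exact Or.inr (Or.inr ⟨[], l, l', x, y, hxy, by simp, by simp⟩)

theorem eq_of_append_cons_eq {α : Type*} {l p q p' q' : List α} {x : α} (hl : l.Nodup)
    (h : l = p ++ x :: q) (h' : l = p' ++ x :: q') : p = p' ∧ q = q' := by
  have hn := hl
  rw [h, List.nodup_append, List.nodup_cons] at hn
  have := (List.append_cons_inj_of_notMem (fun hx => hn.2.2 x hx x (by simp) rfl) hn.2.1.1).1
    (h.symm.trans h')
  exact ⟨this.1, this.2.2⟩

namespace Zigzag

variable {Z : Zigzag}

theorem Route.ext {R S : Z.dag.Route} (h : R.edges = S.edges) : R = S := by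
  cases R; cases S
  simp only at h
  subst h
  rfl

theorem src_head (hZ : Z.IsLegGraph) (R : Z.dag.Route) :
    Z.dag.src (R.edges.head R.ne) = .source := by
  refine (isSource_iff hZ _ ?_).1 R.source
  rcases src_cases (R.edges.head R.ne) with h | ⟨v, h⟩ <;> rw [h] <;> simp

theorem tgt_getLast (hZ : Z.IsLegGraph) (R : Z.dag.Route) :
    Z.dag.tgt (R.edges.getLast R.ne) = .sink := by
  refine (isSink_iff hZ _ ?_).1 R.sink
  rcases tgt_cases (R.edges.getLast R.ne) with h | ⟨v, h⟩ <;> rw [h] <;> simp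

theorem exists_eq_cons (hZ : Z.IsLegGraph) (R : Z.dag.Route) :
    ∃ s q, R.edges = s :: q ∧ Z.dag.src s = .source :=
  ⟨R.edges.head R.ne, R.edges.tail, (List.cons_head_tail R.ne).symm, src_head hZ R⟩

theorem exists_eq_concat (hZ : Z.IsLegGraph) (R : Z.dag.Route) :
    ∃ p t, R.edges = p ++ [t] ∧ Z.dag.tgt t = .sink :=
  ⟨R.edges.dropLast, R.edges.getLast R.ne, (List.dropLast_append_getLast R.ne).symm,
    tgt_getLast hZ R⟩

theorem exists_inner_of_chain {e f : Z.Edge} (h : Z.dag.tgt e = Z.dag.src f) :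
    ∃ v, Z.dag.tgt e = .inner v ∧ Z.dag.src f = .inner v := by
  rcases tgt_cases e with h1 | ⟨v, h1⟩
  · rcases src_cases f with h2 | ⟨v, h2⟩ <;> rw [h1, h2] at h <;> cases h
  · exact ⟨v, h1, h ▸ h1⟩

theorem chain_inner {R : Z.dag.Route} {p q : List Z.Edge} {e f : Z.Edge}
    (h : R.edges = p ++ e :: f :: q) : ∃ v, Z.dag.tgt e = .inner v ∧ Z.dag.src f = .inner v := by
  have := R.chain
  rw [h] at this
  exact exists_inner_of_chain (List.isChain_cons_cons.1 this.right_of_append).1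

theorem eq_nil_of_source {R : Z.dag.Route} {p q : List Z.Edge} {e : Z.Edge}
    (h : R.edges = p ++ e :: q) (he : Z.dag.src e = .source) : p = [] := by
  rcases List.eq_nil_or_concat' p with rfl | ⟨p, x, rfl⟩
  · rfl
  · rw [List.append_assoc, List.singleton_append] at h
    obtain ⟨v, -, hv⟩ := chain_inner h
    rw [he] at hv
    cases hv

theorem eq_nil_of_sink {R : Z.dag.Route} {p q : List Z.Edge} {e : Z.Edge}
    (h : R.edges = p ++ e :: q) (he : Z.dag.tgt e = .sink) : q = [] := by
  cases q with
  | nil => rfl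
  | cons f q =>
    obtain ⟨v, hv, -⟩ := chain_inner h
    rw [he] at hv
    cases hv

/-- An edge of a route that leaves an inner vertex has a predecessor. -/
theorem exists_pred (hZ : Z.IsLegGraph) {R : Z.dag.Route} {p q : List Z.Edge} {f : Z.Edge}
    {v : Fin Z.n} (h : R.edges = p ++ f :: q) (hf : Z.dag.src f = .inner v) :
    ∃ p' e, p = p' ++ [e] ∧ Z.dag.tgt e = .inner v := by
  rcases List.eq_nil_or_concat' p with rfl | ⟨p, x, rfl⟩
  · obtain ⟨s, q', hs, hs'⟩ := exists_eq_cons hZ R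
    rw [h, List.nil_append] at hs
    rw [(List.cons.inj hs).1, hs'] at hf
    cases hf
  · refine ⟨p, x, rfl, ?_⟩
    rw [List.append_assoc, List.singleton_append] at h
    obtain ⟨w, h1, h2⟩ := chain_inner h
    rw [h1, ← h2, hf]

/-- An edge of a route that enters an inner vertex has a successor. -/
theorem exists_succ (hZ : Z.IsLegGraph) {R : Z.dag.Route} {p q : List Z.Edge} {e : Z.Edge}
    {v : Fin Z.n} (h : R.edges = p ++ e :: q) (he : Z.dag.tgt e = .inner v) :
    ∃ f q', q = f :: q' ∧ Z.dag.src f = .inner v := by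
  cases q with
  | nil =>
    obtain ⟨p', t, ht, ht'⟩ := exists_eq_concat hZ R
    rw [h] at ht
    rw [(List.append_inj' ht rfl).2 |> List.cons.inj |>.1, ht'] at he
    cases he
  | cons f q =>
    refine ⟨f, q, rfl, ?_⟩
    obtain ⟨w, h1, h2⟩ := chain_inner h
    rw [h2, ← h1, he]

theorem exists_route (hZ : Z.IsLegGraph) {l : List Z.Edge}
    (hl : l.IsChain fun e f => Z.dag.tgt e = Z.dag.src f)
    (hs : ∃ s q, l = s :: q ∧ Z.dag.src s = .source)
    (ht : ∃ p t, l = p ++ [t] ∧ Z.dag.tgt t = .sink) : ∃ R : Z.dag.Route, R.edges = l := by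
  obtain ⟨s, q, hs, hs'⟩ := hs
  obtain ⟨p, t, ht, ht'⟩ := ht
  have hne : l ≠ [] := by rw [hs]; simp
  refine ⟨⟨l, hne, hl, ?_, ?_⟩, rfl⟩
  · have : l.head hne = s := by simp [hs]
    rw [this, hs']
    exact (isSource_iff hZ _ (by simp)).2 rfl
  · have : l.getLast hne = t := by simp [ht]
    rw [this, ht']
    exact (isSink_iff hZ _ (by simp)).2 rfl

/-- Two routes through a vertex can be spliced there. -/
theorem exists_splice (hZ : Z.IsLegGraph) {R S : Z.dag.Route} {p q p' q' : List Z.Edge}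
    {a b : Z.Edge} {v : Fin Z.n} (hR : R.edges = p ++ a :: q) (hS : S.edges = p' ++ b :: q')
    (ha : Z.dag.src a = .inner v) (hb : Z.dag.src b = .inner v) :
    ∃ T : Z.dag.Route, T.edges = p ++ b :: q' := by
  obtain ⟨p₀, e, rfl, he⟩ := exists_pred hZ hR ha
  refine exists_route hZ ?_ ?_ ?_
  · have h1 := R.chain
    have h2 := S.chain
    rw [hR] at h1
    rw [hS] at h2
    rw [List.isChain_append] at h1 ⊢
    refine ⟨h1.1, h2.right_of_append, ?_⟩
    simp [he, hb]
  · obtain ⟨s, r, hs, hs'⟩ := exists_eq_cons hZ R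
    rw [hR] at hs
    cases p₀ with
    | nil =>
      simp only [List.nil_append, List.cons_append, List.cons.injEq] at hs
      exact ⟨e, b :: q', by simp, by rw [hs.1, hs']⟩
    | cons x p₀ =>
      simp only [List.cons_append, List.cons.injEq] at hs
      exact ⟨x, p₀ ++ [e] ++ b :: q', by simp, by rw [hs.1, hs']⟩
  · obtain ⟨r, t, ht, ht'⟩ := exists_eq_concat hZ S
    rw [hS] at ht
    rcases List.eq_nil_or_concat' q' with rfl | ⟨q', y, rfl⟩
    · have := List.cons.inj (List.append_inj' ht rfl).2
      exact ⟨p₀ ++ [e], b, by simp, by rw [this.1, ht']⟩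
    · rw [← List.cons_append, ← List.append_assoc] at ht
      have := List.cons.inj (List.append_inj' ht rfl).2
      exact ⟨p₀ ++ [e] ++ b :: q', y, by simp, by rw [this.1, ht']⟩

/-- All inner edges of the list point in the direction `d`. -/
def HasDir (d : Bool) (l : List Z.Edge) : Prop := ∀ j, Sum.inl j ∈ l → Z.up j = d

/-- A route stays on one leg: consecutive inner edges share their direction, and nothing follows a
sink edge. -/
theorem exists_hasDir (hZ : Z.IsLegGraph) {l : List Z.Edge}
    (hl : l.IsChain fun e f => Z.dag.tgt e = Z.dag.src f) : ∃ d, HasDir d l := by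
  induction l with
  | nil => exact ⟨true, fun j hj => by simp at hj⟩
  | cons e l ih =>
    obtain ⟨d, hd⟩ := ih hl.of_cons
    rcases e with i | e | e
    · refine ⟨Z.up i, fun j hj => ?_⟩
      rcases List.mem_cons.1 hj with h | h
      · rw [Sum.inl.inj h]
      · cases l with
        | nil => simp at h
        | cons f l =>
          have h1 := (List.isChain_cons_cons.1 hl).1
          rcases f with k | f | f
          · have h2 : Z.up i = Z.up k := hZ.up_eq (by simpa using h1)
            rw [h2, hd k (by simp), hd j h]
          · cases h1
          · cases l with
            | nil => simp at h
            | cons g l =>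
              have h3 := (List.isChain_cons_cons.1 hl.of_cons).1
              rcases src_cases g with h4 | ⟨v, h4⟩ <;> rw [h4] at h3 <;> cases h3
    · exact ⟨d, fun j hj => hd j (by simpa using hj)⟩
    · exact ⟨d, fun j hj => hd j (by simpa using hj)⟩

theorem HasDir.mono {d : Bool} {l l' : List Z.Edge} (h : HasDir d l') (hl : l ⊆ l') : HasDir d l :=
  fun j hj => h j (hl hj)

/-- The position of the head of an edge, the sink being last. -/
def tgtPos (Z : Zigzag) (d : Bool) (e : Z.Edge) : WithTop ℤ :=
  match Z.dag.tgt e with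
  | .inner v => Z.pos d v
  | _ => ⊤

theorem tgtPos_eq {d : Bool} {e : Z.Edge} {v : Fin Z.n} (h : Z.dag.tgt e = .inner v) :
    Z.tgtPos d e = Z.pos d v := by
  simp [tgtPos, h]

theorem tgtPos_eq_top {d : Bool} {e : Z.Edge} (h : Z.dag.tgt e = .sink) :
    Z.tgtPos d e = ⊤ := by
  simp [tgtPos, h]

/-- Strictly increasing positions exclude repetitions, so that an edge of a route can be recovered
from its head or its tail. -/
theorem pairwise_tgtPos (hZ : Z.IsLegGraph) {d : Bool} {l : List Z.Edge}
    (hl : l.IsChain fun e f => Z.dag.tgt e = Z.dag.src f) (hd : HasDir d l) :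
    l.Pairwise fun e f => Z.tgtPos d e < Z.tgtPos d f := by
  rw [← List.isChain_iff_pairwise]
  refine hl.imp_of_mem_imp fun e f he hf hef => ?_
  obtain ⟨v, hv, hv'⟩ := exists_inner_of_chain hef
  rw [tgtPos_eq hv]
  rcases tgt_cases f with h | ⟨w, h⟩
  · rw [tgtPos_eq_top h]
    exact WithTop.coe_lt_top _
  · rw [tgtPos_eq h]
    obtain ⟨j, rfl, rfl, rfl⟩ := exists_eq_inl hv' h
    have := hZ.pos_lt j
    rw [hd j hf] at this
    exact WithTop.coe_lt_coe.2 this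

theorem pairwise_route (hZ : Z.IsLegGraph) (R : Z.dag.Route) :
    ∃ d, HasDir d R.edges ∧ R.edges.Pairwise fun e f => Z.tgtPos d e < Z.tgtPos d f := by
  obtain ⟨d, hd⟩ := exists_hasDir hZ R.chain
  exact ⟨d, hd, pairwise_tgtPos hZ R.chain hd⟩

theorem nodup_route (hZ : Z.IsLegGraph) (R : Z.dag.Route) : R.edges.Nodup := by
  obtain ⟨d, -, h⟩ := pairwise_route hZ R
  refine List.Pairwise.imp (fun {e f} hef => ?_) h
  rintro rfl
  exact lt_irrefl _ hef

theorem eq_of_tgt_eq (hZ : Z.IsLegGraph) {R : Z.dag.Route} {e f : Z.Edge} (he : e ∈ R.edges)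
    (hf : f ∈ R.edges) (h : Z.dag.tgt e = Z.dag.tgt f) : e = f := by
  obtain ⟨d, -, hp⟩ := pairwise_route hZ R
  have hpos : Z.tgtPos d e = Z.tgtPos d f := by unfold tgtPos; rw [h]
  by_contra hne
  have h2 := hp.imp (S := fun e f => Z.tgtPos d e ≠ Z.tgtPos d f) fun {a b} h => ne_of_lt h
  have : Std.Symm fun e f : Z.Edge => Z.tgtPos d e ≠ Z.tgtPos d f := ⟨fun a b h => h.symm⟩
  exact List.Pairwise.forall h2 he hf hne hpos

theorem eq_of_src_eq (hZ : Z.IsLegGraph) {R : Z.dag.Route} {e f : Z.Edge} (he : e ∈ R.edges)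
    (hf : f ∈ R.edges) (h : Z.dag.src e = Z.dag.src f) : e = f := by
  obtain ⟨p, q, hp⟩ := List.append_of_mem he
  obtain ⟨p', q', hp'⟩ := List.append_of_mem hf
  rcases src_cases e with h1 | ⟨v, h1⟩
  · have h2 := eq_nil_of_source hp h1
    have h3 := eq_nil_of_source hp' (h ▸ h1)
    rw [hp, h2, h3, List.nil_append, List.nil_append] at hp'
    exact (List.cons.inj hp').1
  · obtain ⟨r, x, rfl, hx⟩ := exists_pred hZ hp h1
    obtain ⟨r', x', rfl, hx'⟩ := exists_pred hZ hp' (h ▸ h1)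
    have hxx : x = x' := eq_of_tgt_eq hZ (by rw [hp]; simp) (by rw [hp']; simp) (hx.trans hx'.symm)
    subst hxx
    rw [List.append_assoc, List.singleton_append] at hp hp'
    have := (eq_of_append_cons_eq (nodup_route hZ R) hp hp').2
    exact (List.cons.inj this).1

/-- The start of a route comes before all its other vertices. -/
theorem pos_start_lt (hZ : Z.IsLegGraph) {R : Z.dag.Route} {d : Bool} (hd : HasDir d R.edges)
    {s e : Z.Edge} {q : List Z.Edge} (hs : R.edges = s :: q) (he : e ∈ R.edges) {u v : Fin Z.n}
    (hu : Z.dag.tgt s = .inner u) (hv : Z.dag.tgt e = .inner v) (hne : e ≠ s) :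
    Z.pos d u < Z.pos d v := by
  have hp := pairwise_tgtPos hZ R.chain hd
  rw [hs] at hp he
  have := (List.pairwise_cons.1 hp).1 e ((List.mem_cons.1 he).resolve_left hne)
  rw [tgtPos_eq hu, tgtPos_eq hv] at this
  exact WithTop.coe_lt_coe.1 this

/-- The end of a route comes after all its other vertices. -/
theorem pos_lt_end (hZ : Z.IsLegGraph) {R : Z.dag.Route} {d : Bool} (hd : HasDir d R.edges)
    {t e : Z.Edge} {p : List Z.Edge} (ht : R.edges = p ++ [t]) (he : e ∈ R.edges) {u v : Fin Z.n}
    (hu : Z.dag.src t = .inner u) (hv : Z.dag.src e = .inner v) (hne : e ≠ t) :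
    Z.pos d v < Z.pos d u := by
  have hp := pairwise_tgtPos hZ R.chain hd
  obtain ⟨p', x, rfl, hx⟩ := exists_pred hZ ht hu
  obtain ⟨r, r', hr⟩ := List.append_of_mem he
  obtain ⟨r₀, y, rfl, hy⟩ := exists_pred hZ hr hv
  have hnd := nodup_route hZ R
  have hyR : y ∈ p' ++ [x] ++ [t] := by rw [← ht, hr]; simp
  have hyt : y ≠ t := by
    rintro rfl
    rw [List.append_assoc, List.singleton_append] at hr
    have := (eq_of_append_cons_eq hnd hr ht).2
    cases this
  have hyx : y ≠ x := by
    rintro rfl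
    rw [List.append_assoc, List.singleton_append] at hr ht
    exact hne (List.cons.inj (eq_of_append_cons_eq hnd hr ht).2).1
  have hyp : y ∈ p' := by simpa [hyt, hyx] using hyR
  rw [ht, List.append_assoc, List.pairwise_append] at hp
  have := hp.2.2 y hyp x (by simp)
  rw [tgtPos_eq hx, tgtPos_eq hy] at this
  exact WithTop.coe_lt_coe.1 this

end Zigzag
end GPoly

/-! ### Conflicts as crossings of labelled routes -/

namespace GPoly

theorem isChain_of_forall_split {α : Type*} {r : α → α → Prop} {l : List α}
    (h : ∀ p e f q, l = p ++ e :: f :: q → r e f) : l.IsChain r := by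
  induction l with
  | nil => exact List.IsChain.nil
  | cons x l ih =>
    cases l with
    | nil => exact List.IsChain.singleton x
    | cons y l =>
      exact List.isChain_cons_cons.2 ⟨h [] x y l rfl, ih fun p e f q hl => h (x :: p) e f q (by rw [hl]; rfl)⟩

theorem forall_eq_of_isChain {α β : Type*} {φ : α → β} {l : List α}
    (h : l.IsChain fun e f => φ e = φ f) {e f : α} (he : e ∈ l) (hf : f ∈ l) : φ e = φ f := by
  have : Trans (fun e f => φ e = φ f) (fun e f => φ e = φ f) (fun e f => φ e = φ f) :=
    ⟨fun h h' => h.trans h'⟩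
  have hs : Std.Symm fun e f => φ e = φ f := ⟨fun a b h => h.symm⟩
  exact List.Pairwise.forall_of_forall (R := fun e f => φ e = φ f) (fun _ _ => rfl)
    (List.isChain_iff_pairwise.1 h) he hf

namespace Zigzag

variable {Z : Zigzag}

theorem exists_route_through (hZ : Z.IsLegGraph) {a b : Z.Edge} {v : Fin Z.n}
    (ha : Z.dag.tgt a = .inner v) (hb : Z.dag.src b = .inner v) :
    ∃ (R : Z.dag.Route) (p q : List Z.Edge), R.edges = p ++ a :: b :: q := by
  obtain ⟨p, hp, s, r, hs, hs'⟩ : ∃ p : List Z.Edge,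
      ((p ++ [a]).IsChain fun e f => Z.dag.tgt e = Z.dag.src f) ∧
      ∃ s r, p ++ [a] = s :: r ∧ Z.dag.src s = .source := by
    rcases src_cases a with h | ⟨u, h⟩
    · exact ⟨[], by simp, a, [], rfl, h⟩
    · obtain ⟨j, rfl, rfl, -⟩ := exists_eq_inl h ha
      obtain ⟨s, hs, hs'⟩ := hZ.exists_sourceEdge j
      exact ⟨[s], by simp [hs'], s, [.inl j], rfl, hs⟩
  obtain ⟨q, hq, r', t, ht, ht'⟩ : ∃ q : List Z.Edge,
      ((b :: q).IsChain fun e f => Z.dag.tgt e = Z.dag.src f) ∧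
      ∃ r' t, b :: q = r' ++ [t] ∧ Z.dag.tgt t = .sink := by
    rcases tgt_cases b with h | ⟨u, h⟩
    · exact ⟨[], by simp, [], b, rfl, h⟩
    · obtain ⟨j, rfl, -, rfl⟩ := exists_eq_inl hb h
      obtain ⟨t, ht, ht'⟩ := hZ.exists_sinkEdge j
      exact ⟨[t], by simp [ht'], [.inl j], t, rfl, ht⟩
  obtain ⟨R, hR⟩ := exists_route hZ (l := (p ++ [a]) ++ b :: q) (by
    rw [List.isChain_append]
    refine ⟨hp, hq, ?_⟩
    simp [ha, hb]) ⟨s, r ++ b :: q, by rw [hs]; rfl, hs'⟩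
    ⟨(p ++ [a]) ++ r', t, by rw [ht]; simp, ht'⟩
  exact ⟨R, p, q, by rw [hR]; simp⟩

/-- `R` and `S` cross: at the start of a common part `R` enters with label `false` and `S` with
label `true`, and at its end `S` leaves with label `false` and `R` with label `true`. -/
def Crosses (lab : Z.Edge → Bool) (R S : Z.dag.Route) : Prop :=
  ∃ (p q c p' q' : List Z.Edge) (a b a' b' : Z.Edge) (v w : Fin Z.n),
    R.edges = p ++ a :: (c ++ b' :: p') ∧ S.edges = q ++ b :: (c ++ a' :: q') ∧
    Z.dag.tgt a = .inner v ∧ Z.dag.tgt b = .inner v ∧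
    Z.dag.src a' = .inner w ∧ Z.dag.src b' = .inner w ∧
    lab a = false ∧ lab b = true ∧ lab a' = false ∧ lab b' = true

theorem inLT_trichotomy {F : Framing Z.dag} (hZ : Z.IsLegGraph) {v : Fin Z.n} {a b : Z.Edge}
    (ha : Z.dag.tgt a = .inner v) (hb : Z.dag.tgt b = .inner v) (hab : a ≠ b) :
    F.inLT a b ∨ F.inLT b a := by
  let _ := F.inOrder (innerVertex hZ v)
  rcases lt_trichotomy (⟨a, ha⟩ : {e // Z.dag.tgt e = (innerVertex hZ v).1}) ⟨b, hb⟩ with h | h | h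
  · exact Or.inl ⟨innerVertex hZ v, ha, hb, h⟩
  · exact absurd (congrArg Subtype.val h) hab
  · exact Or.inr ⟨innerVertex hZ v, hb, ha, h⟩

theorem outLT_trichotomy {F : Framing Z.dag} (hZ : Z.IsLegGraph) {v : Fin Z.n} {a b : Z.Edge}
    (ha : Z.dag.src a = .inner v) (hb : Z.dag.src b = .inner v) (hab : a ≠ b) :
    F.outLT a b ∨ F.outLT b a := by
  let _ := F.outOrder (innerVertex hZ v)
  rcases lt_trichotomy (⟨a, ha⟩ : {e // Z.dag.src e = (innerVertex hZ v).1}) ⟨b, hb⟩ with h | h | h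
  · exact Or.inl ⟨innerVertex hZ v, ha, hb, h⟩
  · exact absurd (congrArg Subtype.val h) hab
  · exact Or.inr ⟨innerVertex hZ v, hb, ha, h⟩

/-- A common labelling of all edges by which the framing `F` orders the edges at each vertex. -/
structure IsEdgeLabeling (F : Framing Z.dag) (lab : Z.Edge → Bool) (β : Bool) : Prop where
  inLT_iff : ∀ a b, F.inLT a b ↔
    ∃ v, Z.dag.tgt a = .inner v ∧ Z.dag.tgt b = .inner v ∧ lab a = !β ∧ lab b = β
  outLT_iff : ∀ a b, F.outLT a b ↔
    ∃ v, Z.dag.src a = .inner v ∧ Z.dag.src b = .inner v ∧ lab a = !β ∧ lab b = β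

/-- An edge labelling such that exactly the inner edges that point upwards have the label `true`. -/
structure IsLabeling (F : Framing Z.dag) (lab : Z.Edge → Bool) (β : Bool) : Prop
    extends IsEdgeLabeling F lab β where
  lab_inl : ∀ j, lab (.inl j) = Z.up j
  standard_iff : F.IsStandard ↔ β = true

namespace IsEdgeLabeling

variable {F : Framing Z.dag} {lab : Z.Edge → Bool} {β : Bool}

theorem in_ne (h : IsEdgeLabeling F lab β) (hZ : Z.IsLegGraph) {a b : Z.Edge} {v : Fin Z.n}
    (ha : Z.dag.tgt a = .inner v) (hb : Z.dag.tgt b = .inner v) (hab : a ≠ b) : lab a ≠ lab b := by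
  have key := inLT_trichotomy (F := F) hZ ha hb hab
  rw [h.inLT_iff, h.inLT_iff] at key
  rcases key with ⟨-, -, -, h1, h2⟩ | ⟨-, -, -, h1, h2⟩ <;> rw [h1, h2] <;> simp

theorem out_ne (h : IsEdgeLabeling F lab β) (hZ : Z.IsLegGraph) {a b : Z.Edge} {v : Fin Z.n}
    (ha : Z.dag.src a = .inner v) (hb : Z.dag.src b = .inner v) (hab : a ≠ b) : lab a ≠ lab b := by
  have key := outLT_trichotomy (F := F) hZ ha hb hab
  rw [h.outLT_iff, h.outLT_iff] at key
  rcases key with ⟨-, -, -, h1, h2⟩ | ⟨-, -, -, h1, h2⟩ <;> rw [h1, h2] <;> simp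

theorem in_eq (h : IsEdgeLabeling F lab β) (hZ : Z.IsLegGraph) {a b : Z.Edge} {v : Fin Z.n}
    (ha : Z.dag.tgt a = .inner v) (hb : Z.dag.tgt b = .inner v) (hab : lab a = lab b) : a = b := by
  by_contra hne
  exact h.in_ne hZ ha hb hne hab

theorem out_eq (h : IsEdgeLabeling F lab β) (hZ : Z.IsLegGraph) {a b : Z.Edge} {v : Fin Z.n}
    (ha : Z.dag.src a = .inner v) (hb : Z.dag.src b = .inner v) (hab : lab a = lab b) : a = b := by
  by_contra hne
  exact h.out_ne hZ ha hb hne hab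

theorem exists_in (h : IsEdgeLabeling F lab β) (hZ : Z.IsLegGraph) (v : Fin Z.n) (x : Bool) :
    ∃ a, Z.dag.tgt a = .inner v ∧ lab a = x := by
  obtain ⟨a, b, hab, ha, hb, -⟩ := hZ.exists_pair_tgt v
  have := h.in_ne hZ ha hb hab
  by_cases hx : lab a = x
  · exact ⟨a, ha, hx⟩
  · refine ⟨b, hb, ?_⟩
    revert this hx
    cases lab a <;> cases lab b <;> cases x <;> simp

theorem exists_out (h : IsEdgeLabeling F lab β) (hZ : Z.IsLegGraph) (v : Fin Z.n) (x : Bool) :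
    ∃ a, Z.dag.src a = .inner v ∧ lab a = x := by
  obtain ⟨a, b, hab, ha, hb, -⟩ := hZ.exists_pair_src v
  have := h.out_ne hZ ha hb hab
  by_cases hx : lab a = x
  · exact ⟨a, ha, hx⟩
  · refine ⟨b, hb, ?_⟩
    revert this hx
    cases lab a <;> cases lab b <;> cases x <;> simp

/-- The given common subroute and the common segments used in the two comparisons join to one
maximal common part, so only the four edges at its ends matter. The value of β decides which label
is the smaller one. -/
theorem conflict_iff (h : IsEdgeLabeling F lab β) (R S : Z.dag.Route) :
    F.Conflict R S ↔ Crosses lab R S ∨ Crosses lab S R := by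
  constructor
  · rintro ⟨p, q, c, p', q', hR, hS, ⟨⟨p₀, q₀, c₁, a, b, rfl, rfl, hab⟩, c₂, q₁, p₁, a', b', rfl, rfl, hab'⟩ |
      ⟨⟨q₀, p₀, c₁, b, a, rfl, rfl, hab⟩, c₂, p₁, q₁, b', a', rfl, rfl, hab'⟩⟩
    all_goals
      obtain ⟨v, h1, h2, h3, h4⟩ := (h.inLT_iff _ _).1 hab
      obtain ⟨w, h1', h2', h3', h4'⟩ := (h.outLT_iff _ _).1 hab'
      have hR' : R.edges = p₀ ++ a :: ((c₁ ++ c ++ c₂) ++ b' :: p₁) := by rw [hR]; simp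
      have hS' : S.edges = q₀ ++ b :: ((c₁ ++ c ++ c₂) ++ a' :: q₁) := by rw [hS]; simp
      cases β
    · exact Or.inr ⟨_, _, _, _, _, _, _, _, _, _, _, hS', hR', h2, h1, h2', h1', h4, h3, h4', h3'⟩
    · exact Or.inl ⟨_, _, _, _, _, _, _, _, _, _, _, hR', hS', h1, h2, h1', h2', h3, h4, h3', h4'⟩
    · exact Or.inl ⟨_, _, _, _, _, _, _, _, _, _, _, hR', hS', h2, h1, h2', h1', h4, h3, h4', h3'⟩
    · exact Or.inr ⟨_, _, _, _, _, _, _, _, _, _, _, hS', hR', h1, h2, h1', h2', h3, h4, h3', h4'⟩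
  · rintro (⟨p, q, c, p', q', a, b, a', b', v, w, hR, hS, h1, h2, h3, h4, l1, l2, l3, l4⟩ |
      ⟨q, p, c, q', p', b, a, b', a', v, w, hS, hR, h2, h1, h4, h3, l2, l1, l4, l3⟩)
    all_goals
      refine ⟨p ++ [a], q ++ [b], c, b' :: p', a' :: q', by rw [hR]; simp, by rw [hS]; simp, ?_⟩
      have hin : ∀ x y : Z.Edge, F.inLT x y → F.PrecIn (p ++ [x]) (q ++ [y]) ∧
          F.PrecIn (q ++ [x]) (p ++ [y]) := fun x y hxy =>
        ⟨⟨p, q, [], x, y, rfl, rfl, hxy⟩, ⟨q, p, [], x, y, rfl, rfl, hxy⟩⟩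
      have hout : ∀ x y : Z.Edge, F.outLT x y → F.PrecOut (x :: p') (y :: q') ∧
          F.PrecOut (x :: q') (y :: p') := fun x y hxy =>
        ⟨⟨[], p', q', x, y, rfl, rfl, hxy⟩, ⟨[], q', p', x, y, rfl, rfl, hxy⟩⟩
      cases β
    · exact Or.inr ⟨(hin b a ((h.inLT_iff _ _).2 ⟨v, h2, h1, l2, l1⟩)).2,
        (hout b' a' ((h.outLT_iff _ _).2 ⟨w, h4, h3, l4, l3⟩)).1⟩
    · exact Or.inl ⟨(hin a b ((h.inLT_iff _ _).2 ⟨v, h1, h2, l1, l2⟩)).1,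
        (hout a' b' ((h.outLT_iff _ _).2 ⟨w, h3, h4, l3, l4⟩)).2⟩
    · exact Or.inl ⟨(hin a b ((h.inLT_iff _ _).2 ⟨v, h1, h2, l1, l2⟩)).1,
        (hout a' b' ((h.outLT_iff _ _).2 ⟨w, h3, h4, l3, l4⟩)).2⟩
    · exact Or.inr ⟨(hin b a ((h.inLT_iff _ _).2 ⟨v, h2, h1, l2, l1⟩)).2,
        (hout b' a' ((h.outLT_iff _ _).2 ⟨w, h4, h3, l4, l3⟩)).1⟩

theorem coherent_iff (h : IsEdgeLabeling F lab β) (R S : Z.dag.Route) :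
    F.Coherent R S ↔ ¬ Crosses lab R S ∧ ¬ Crosses lab S R := by
  rw [Framing.Coherent, h.conflict_iff, not_or]

theorem coherent_symm (h : IsEdgeLabeling F lab β) {R S : Z.dag.Route} (hRS : F.Coherent R S) :
    F.Coherent S R := by
  rw [h.coherent_iff] at hRS ⊢
  exact hRS.symm

theorem coherent_refl (h : IsEdgeLabeling F lab β) (hZ : Z.IsLegGraph) (R : Z.dag.Route) :
    F.Coherent R R := by
  rw [h.coherent_iff, and_self]
  rintro ⟨p, q, c, p', q', a, b, a', b', v, w, hR, hS, h1, h2, h3, h4, l1, l2, l3, l4⟩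
  have : a = b := eq_of_tgt_eq (R := R) hZ (by rw [hR]; simp) (by rw [hS]; simp) (h1.trans h2.symm)
  rw [this, l2] at l1
  cases l1

theorem isExceptional_of_const (h : IsEdgeLabeling F lab β) {R : Z.dag.Route}
    (hR : ∀ e ∈ R.edges, ∀ f ∈ R.edges, lab e = lab f) : F.IsExceptional R := by
  intro S
  rw [h.coherent_iff]
  constructor
  · rintro ⟨p, q, c, p', q', a, b, a', b', v, w, hR', -, -, -, -, -, l1, -, -, l4⟩
    have := hR a (by rw [hR']; simp) b' (by rw [hR']; simp)
    rw [l1, l4] at this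
    cases this
  · rintro ⟨p, q, c, p', q', a, b, a', b', v, w, -, hR', -, -, -, -, -, l2, l3, -⟩
    have := hR b (by rw [hR']; simp) a' (by rw [hR']; simp)
    rw [l2, l3] at this
    cases this

/-- If the label changed from e to f at a vertex, a route through the other incoming and the other
outgoing edge there would cross R. -/
theorem const_of_isExceptional (h : IsEdgeLabeling F lab β) (hZ : Z.IsLegGraph) {R : Z.dag.Route}
    (hR : F.IsExceptional R) {e f : Z.Edge} (he : e ∈ R.edges) (hf : f ∈ R.edges) :
    lab e = lab f := by
  refine forall_eq_of_isChain (isChain_of_forall_split fun p e f q hpq => ?_) he hf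
  by_contra hne
  obtain ⟨v, hv, hv'⟩ := chain_inner hpq
  obtain ⟨a, ha, hla⟩ := h.exists_in hZ v (lab f)
  obtain ⟨b, hb, hlb⟩ := h.exists_out hZ v (lab e)
  obtain ⟨S, p', q', hS⟩ := exists_route_through hZ ha hb
  have hcoh := (h.coherent_iff R S).1 (hR S)
  cases hle : lab e <;> cases hlf : lab f
  · exact hne (hle.trans hlf.symm)
  · exact hcoh.1 ⟨p, p', [], q, q', e, a, b, f, v, v, hpq, hS, hv, ha, hb, hv', hle, hla.trans hlf,
      hlb.trans hle, hlf⟩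
  · exact hcoh.2 ⟨p', p, [], q', q, a, e, f, b, v, v, hS, hpq, ha, hv, hv', hb, hla.trans hlf, hle,
      hlf, hlb.trans hle⟩
  · exact hne (hle.trans hlf.symm)

end IsEdgeLabeling

end Zigzag
end GPoly

/-! ### The g-vectors in terms of labels -/

namespace GPoly
namespace Zigzag

variable {Z : Zigzag}

/-- A label as a number. -/
def num (x : Bool) : ℝ := if x then 1 else 0

/-- The sign by which a labelling determines the g-vectors. -/
def sign (β : Bool) : ℝ := if β then 1 else -1

theorem sign_ne_zero (β : Bool) : sign β ≠ 0 := by cases β <;> simp [sign]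

theorem num_injective : Function.Injective num := by
  intro x y
  cases x <;> cases y <;> simp [num]

namespace IsEdgeLabeling

variable {F : Framing Z.dag} {lab : Z.Edge → Bool} {β : Bool}

theorem inOne_iff (h : IsEdgeLabeling F lab β) (hZ : Z.IsLegGraph) {e : Z.Edge} {v : Fin Z.n}
    (he : Z.dag.tgt e = .inner v) : F.InOne e ↔ lab e = !β := by
  constructor
  · rintro ⟨a, ha⟩
    obtain ⟨-, -, -, h1, -⟩ := (h.inLT_iff _ _).1 ha
    exact h1
  · intro hl
    obtain ⟨a, ha, hla⟩ := h.exists_in hZ v β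
    exact ⟨a, (h.inLT_iff _ _).2 ⟨v, he, ha, hl, hla⟩⟩

theorem inTwo_iff (h : IsEdgeLabeling F lab β) (hZ : Z.IsLegGraph) {e : Z.Edge} {v : Fin Z.n}
    (he : Z.dag.tgt e = .inner v) : F.InTwo e ↔ lab e = β := by
  constructor
  · rintro ⟨a, ha⟩
    obtain ⟨-, -, -, -, h1⟩ := (h.inLT_iff _ _).1 ha
    exact h1
  · intro hl
    obtain ⟨a, ha, hla⟩ := h.exists_in hZ v (!β)
    exact ⟨a, (h.inLT_iff _ _).2 ⟨v, ha, he, hla, hl⟩⟩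

theorem outOne_iff (h : IsEdgeLabeling F lab β) (hZ : Z.IsLegGraph) {e : Z.Edge} {v : Fin Z.n}
    (he : Z.dag.src e = .inner v) : F.OutOne e ↔ lab e = !β := by
  constructor
  · rintro ⟨a, ha⟩
    obtain ⟨-, -, -, h1, -⟩ := (h.outLT_iff _ _).1 ha
    exact h1
  · intro hl
    obtain ⟨a, ha, hla⟩ := h.exists_out hZ v β
    exact ⟨a, (h.outLT_iff _ _).2 ⟨v, he, ha, hl, hla⟩⟩

theorem outTwo_iff (h : IsEdgeLabeling F lab β) (hZ : Z.IsLegGraph) {e : Z.Edge} {v : Fin Z.n}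
    (he : Z.dag.src e = .inner v) : F.OutTwo e ↔ lab e = β := by
  constructor
  · rintro ⟨a, ha⟩
    obtain ⟨-, -, -, -, h1⟩ := (h.outLT_iff _ _).1 ha
    exact h1
  · intro hl
    obtain ⟨a, ha, hla⟩ := h.exists_out hZ v (!β)
    exact ⟨a, (h.outLT_iff _ _).2 ⟨v, ha, he, hla, hl⟩⟩

theorem gVector_of_pass (h : IsEdgeLabeling F lab β) (hZ : Z.IsLegGraph) {R : Z.dag.Route}
    {p q : List Z.Edge} {e f : Z.Edge} (hR : R.edges = p ++ e :: f :: q) {v : Z.dag.InnerVertex}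
    (hv : Z.dag.tgt e = v.1) : F.gVector R v = sign β * (num (lab e) - num (lab f)) := by
  obtain ⟨u, hu⟩ := exists_val_eq hZ v
  have he := hv.trans hu
  have hf : Z.dag.src f = .inner u := by
    obtain ⟨w, h1, h2⟩ := chain_inner hR
    rw [h2, ← h1, he]
  have huniq : ∀ e' f' : Z.Edge, [e', f'] <:+: R.edges → Z.dag.tgt e' = v.1 → e' = e ∧ f' = f := by
    rintro e' f' ⟨p', q', hR'⟩ htgt
    have hR'' : R.edges = p' ++ e' :: f' :: q' := by rw [← hR']; simp
    obtain ⟨w, h1, h2⟩ := chain_inner hR''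
    exact ⟨eq_of_tgt_eq (R := R) hZ (by rw [hR'']; simp) (by rw [hR]; simp) (htgt.trans hv.symm),
      eq_of_src_eq (R := R) hZ (by rw [hR'']; simp) (by rw [hR]; simp)
        (by rw [h2, ← h1, htgt, hu, hf])⟩
  have hinf : [e, f] <:+: R.edges := ⟨p, q, by rw [hR]; simp⟩
  have h1 : (∃ e f, [e, f] <:+: R.edges ∧ Z.dag.tgt e = v.1 ∧ F.InOne e ∧ F.OutTwo f) ↔
      lab e = !β ∧ lab f = β := by
    rw [← h.inOne_iff hZ he, ← h.outTwo_iff hZ hf]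
    constructor
    · rintro ⟨e', f', hi, ht, h3, h4⟩
      obtain ⟨rfl, rfl⟩ := huniq e' f' hi ht
      exact ⟨h3, h4⟩
    · rintro ⟨h3, h4⟩
      exact ⟨e, f, hinf, hv, h3, h4⟩
  have h2 : (∃ e f, [e, f] <:+: R.edges ∧ Z.dag.tgt e = v.1 ∧ F.InTwo e ∧ F.OutOne f) ↔
      lab e = β ∧ lab f = !β := by
    rw [← h.inTwo_iff hZ he, ← h.outOne_iff hZ hf]
    constructor
    · rintro ⟨e', f', hi, ht, h3, h4⟩
      obtain ⟨rfl, rfl⟩ := huniq e' f' hi ht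
      exact ⟨h3, h4⟩
    · rintro ⟨h3, h4⟩
      exact ⟨e, f, hinf, hv, h3, h4⟩
  unfold Framing.gVector
  simp only [h1, h2]
  cases β <;> cases lab e <;> cases lab f <;> simp [sign, num]

end IsEdgeLabeling

theorem gVector_of_not_pass {F : Framing Z.dag} {R : Z.dag.Route} {v : Z.dag.InnerVertex}
    (hv : ∀ e ∈ R.edges, Z.dag.tgt e ≠ v.1) : F.gVector R v = 0 := by
  unfold Framing.gVector
  rw [if_neg, if_neg]
  · rintro ⟨e, f, hi, ht, -⟩
    exact hv e (hi.subset (by simp)) ht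
  · rintro ⟨e, f, hi, ht, -⟩
    exact hv e (hi.subset (by simp)) ht

namespace IsLabeling

variable {F : Framing Z.dag} {lab : Z.Edge → Bool} {β : Bool}

open Classical in
/-- The g-vector is additive along the edges of a route. -/
theorem gVector_eq_sum (h : IsLabeling F lab β) (hZ : Z.IsLegGraph) (R : Z.dag.Route)
    (v : Z.dag.InnerVertex) : F.gVector R v = sign β * (R.edges.map fun e =>
      (if Z.dag.tgt e = v.1 then num (lab e) else 0) -
        if Z.dag.src e = v.1 then num (lab e) else 0).sum := by
  obtain ⟨u, hu⟩ := exists_val_eq hZ v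
  have hnd := nodup_route hZ R
  by_cases hpass : ∃ e ∈ R.edges, Z.dag.tgt e = v.1
  · obtain ⟨e, he, hev⟩ := hpass
    obtain ⟨p, q, hR⟩ := List.append_of_mem he
    obtain ⟨f, q, rfl, hf⟩ := exists_succ hZ hR (hev.trans hu)
    rw [h.gVector_of_pass hZ hR hev]
    have hz : ∀ x ∈ R.edges, x ≠ e → x ≠ f →
        ((if Z.dag.tgt x = v.1 then num (lab x) else 0) -
          if Z.dag.src x = v.1 then num (lab x) else 0) = 0 := by
      intro x hx hxe hxf
      rw [if_neg, if_neg, sub_zero]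
      · intro hx'
        exact hxf (eq_of_src_eq hZ hx (by rw [hR]; simp) (by rw [hx', hu, hf]))
      · intro hx'
        exact hxe (eq_of_tgt_eq hZ hx he (by rw [hx', hev]))
    have hef : e ≠ f := by
      rintro rfl
      rw [hR] at hnd
      simp [List.nodup_append] at hnd
    have hpz : ∀ l : List Z.Edge, l ⊆ R.edges → e ∉ l → f ∉ l → (l.map fun e =>
        (if Z.dag.tgt e = v.1 then num (lab e) else 0) -
          if Z.dag.src e = v.1 then num (lab e) else 0).sum = 0 := by
      intro l hl hel hfl
      apply List.sum_eq_zero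
      intro x hx
      obtain ⟨y, hy, rfl⟩ := List.mem_map.1 hx
      exact hz y (hl hy) (fun h => hel (h ▸ hy)) (fun h => hfl (h ▸ hy))
    have hnd' := hnd
    rw [hR] at hnd'
    simp only [List.nodup_append, List.nodup_cons, List.mem_cons, not_or] at hnd'
    obtain ⟨-, ⟨⟨-, heq⟩, hfq, -⟩, hdis⟩ := hnd'
    have h1 := hpz p (by rw [hR]; simp) (fun hp => hdis e hp e (Or.inl rfl) rfl)
      (fun hp => hdis f hp f (Or.inr (Or.inl rfl)) rfl)
    have h2 := hpz q (by rw [hR]; intro; simp; tauto) heq hfq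
    have h3 : Z.dag.src e ≠ v.1 := fun h' =>
      hef (eq_of_src_eq hZ he (by rw [hR]; simp) (by rw [h', hu, hf]))
    have h4 : Z.dag.tgt f ≠ v.1 := fun h' =>
      hef (eq_of_tgt_eq (R := R) hZ (by rw [hR]; simp) he (by rw [h', hev])).symm
    rw [hR, List.map_append, List.sum_append, List.map_cons, List.map_cons, List.sum_cons,
      List.sum_cons, h1, h2, if_pos hev, if_neg h3, if_neg h4, if_pos (hf.trans hu.symm)]
    ring
  · push Not at hpass
    rw [gVector_of_not_pass hpass, List.sum_eq_zero, mul_zero]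
    intro x hx
    obtain ⟨y, hy, rfl⟩ := List.mem_map.1 hx
    rw [if_neg (hpass y hy), if_neg, sub_zero]
    intro h'
    obtain ⟨p, q, hR⟩ := List.append_of_mem hy
    obtain ⟨p', x, rfl, hx⟩ := exists_pred hZ hR (h'.trans hu)
    exact hpass x (by rw [hR]; simp) (hx.trans hu.symm)

/-- Exchanging the final parts of two routes preserves the sum of their g-vectors. -/
theorem gVector_add (h : IsLabeling F lab β) (hZ : Z.IsLegGraph) {R S T U : Z.dag.Route}
    {p q p' q' : List Z.Edge} (hR : R.edges = p ++ q) (hS : S.edges = p' ++ q')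
    (hT : T.edges = p ++ q') (hU : U.edges = p' ++ q) :
    F.gVector R + F.gVector S = F.gVector T + F.gVector U := by
  ext v
  simp only [Pi.add_apply, h.gVector_eq_sum hZ, hR, hS, hT, hU, List.map_append, List.sum_append]
  ring

theorem gVector_eq_zero_iff (h : IsLabeling F lab β) (hZ : Z.IsLegGraph) (R : Z.dag.Route) :
    F.gVector R = 0 ↔ F.IsExceptional R := by
  constructor
  · intro h0
    refine h.isExceptional_of_const fun e he f hf => ?_
    refine forall_eq_of_isChain (isChain_of_forall_split fun p e f q hpq => ?_) he hf
    obtain ⟨v, hv, hv'⟩ := chain_inner hpq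
    have := h.gVector_of_pass hZ hpq (v := innerVertex hZ v) hv
    rw [h0, Pi.zero_apply, eq_comm, mul_eq_zero, or_iff_right (sign_ne_zero β), sub_eq_zero] at this
    exact num_injective this
  · intro hR
    ext v
    by_cases hpass : ∃ e ∈ R.edges, Z.dag.tgt e = v.1
    · obtain ⟨e, he, hev⟩ := hpass
      obtain ⟨p, q, hpq⟩ := List.append_of_mem he
      obtain ⟨u, hu⟩ := exists_val_eq hZ v
      obtain ⟨f, q, rfl, hf⟩ := exists_succ hZ hpq (hev.trans hu)
      rw [h.gVector_of_pass hZ hpq hev, h.const_of_isExceptional hZ hR he (f := f) (by rw [hpq]; simp)]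
      simp
    · push Not at hpass
      exact gVector_of_not_pass hpass

open Classical in
/-- The g-vector of a route is determined by its source edge, its sink edge and its direction. -/
theorem gVector_eq (h : IsLabeling F lab β) (hZ : Z.IsLegGraph) {R : Z.dag.Route} {d : Bool}
    (hd : HasDir d R.edges) {s t : Z.Edge} {p q : List Z.Edge} (hs : R.edges = s :: q)
    (ht : R.edges = p ++ [t]) {u w : Z.dag.InnerVertex} (hu : Z.dag.tgt s = u.1)
    (hw : Z.dag.src t = w.1) :
    F.gVector R = Pi.single u (sign β * (num (lab s) - num d)) +
      Pi.single w (sign β * (num d - num (lab t))) := by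
  have hsR : s ∈ R.edges := by rw [hs]; simp
  have htR : t ∈ R.edges := by rw [ht]; simp
  have hin : ∀ e ∈ R.edges, e ≠ s → e ≠ t → lab e = d := by
    intro e he hes het
    obtain ⟨p', q', hpq⟩ := List.append_of_mem he
    have h1 : ∃ v, Z.dag.src e = .inner v := by
      refine (src_cases e).resolve_left fun h1 => ?_
      rw [eq_nil_of_source hpq h1, hs] at hpq
      exact hes (List.cons.inj hpq).1.symm
    have h2 : ∃ v, Z.dag.tgt e = .inner v := by
      refine (tgt_cases e).resolve_left fun h2 => ?_
      rw [eq_nil_of_sink hpq h2, ht] at hpq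
      exact het (List.cons.inj (List.append_inj' hpq rfl).2).1.symm
    obtain ⟨v, hv⟩ := h1
    obtain ⟨w, hw⟩ := h2
    obtain ⟨j, rfl, -, -⟩ := exists_eq_inl hv hw
    rw [h.lab_inl, hd j he]
  have hst : s ≠ t := by
    rintro rfl
    obtain ⟨u', hu'⟩ := exists_val_eq hZ u
    obtain ⟨f, q', rfl, -⟩ := exists_succ (p := []) hZ hs (hu.trans hu')
    rw [hs] at ht
    rcases p with _ | ⟨x, p⟩
    · cases ht
    · have hnd := nodup_route hZ R
      rw [hs, ht, List.cons_append] at hnd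
      have := (List.cons.inj ht).1
      subst this
      simp at hnd
  ext v
  obtain ⟨v', hv'⟩ := exists_val_eq hZ v
  rw [Pi.add_apply]
  by_cases hpass : ∃ e ∈ R.edges, Z.dag.tgt e = v.1
  · obtain ⟨e, he, hev⟩ := hpass
    obtain ⟨p', q', hpq⟩ := List.append_of_mem he
    obtain ⟨f, q', rfl, hf⟩ := exists_succ hZ hpq (hev.trans hv')
    have hfR : f ∈ R.edges := by rw [hpq]; simp
    have het : e ≠ t := by
      rintro rfl
      have h1 := (eq_of_append_cons_eq (nodup_route hZ R) hpq ht).2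
      cases h1
    have hfs : f ≠ s := by
      rintro rfl
      have hpq' : R.edges = (p' ++ [e]) ++ f :: q' := by rw [hpq]; simp
      have h2 := eq_of_append_cons_eq (p := []) (nodup_route hZ R) hs hpq'
      exact absurd h2.1 (by simp)
    rw [h.gVector_of_pass hZ hpq hev]
    have h1 : (Pi.single u (sign β * (num (lab s) - num d)) : Z.dag.InnerVertex → ℝ) v =
        sign β * (num (lab e) - num d) := by
      by_cases hvu : v = u
      · subst hvu
        rw [Pi.single_eq_same, eq_of_tgt_eq hZ hsR he (hu.trans hev.symm)]
      · rw [Pi.single_eq_of_ne hvu, hin e he _ het]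
        · simp
        · rintro rfl
          exact hvu (Subtype.ext (hev.symm.trans hu))
    have h2 : (Pi.single w (sign β * (num d - num (lab t))) : Z.dag.InnerVertex → ℝ) v =
        sign β * (num d - num (lab f)) := by
      by_cases hvw : v = w
      · subst hvw
        rw [Pi.single_eq_same, eq_of_src_eq hZ htR hfR (by rw [hw, hv', hf])]
      · rw [Pi.single_eq_of_ne hvw, hin f hfR hfs]
        · simp
        · rintro rfl
          exact hvw (Subtype.ext (by rw [← hw, hv', hf]))
    rw [h1, h2]
    ring
  · push Not at hpass
    rw [gVector_of_not_pass hpass, Pi.single_eq_of_ne, Pi.single_eq_of_ne, zero_add]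
    · rintro rfl
      obtain ⟨p', e, rfl, he⟩ := exists_pred hZ ht (hw.trans hv')
      exact hpass e (by rw [ht]; simp) (he.trans hv'.symm)
    · rintro rfl
      exact hpass s hsR hu

theorem exists_ends (hZ : Z.IsLegGraph) (R : Z.dag.Route) :
    ∃ (d : Bool) (s t : Z.Edge) (p q : List Z.Edge) (u w : Fin Z.n), HasDir d R.edges ∧
      R.edges = s :: q ∧ R.edges = p ++ [t] ∧ Z.dag.src s = .source ∧ Z.dag.tgt t = .sink ∧
      Z.dag.tgt s = .inner u ∧ Z.dag.src t = .inner w := by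
  obtain ⟨d, hd⟩ := exists_hasDir hZ R.chain
  obtain ⟨s, q, hs, hs'⟩ := exists_eq_cons hZ R
  obtain ⟨p, t, ht, ht'⟩ := exists_eq_concat hZ R
  obtain ⟨u, hu⟩ := tgt_ne_sink_of_src hs'
  obtain ⟨w, hw⟩ := src_ne_source_of_tgt ht'
  exact ⟨d, s, t, p, q, u, w, hd, hs, ht, hs', ht', hu, hw⟩

-- Only the first and the last inner vertex can contribute, each when the label of the end edge
-- differs from the direction. If both do, the contributions have opposite signs and cancel when the
-- two vertices coincide.
open Classical in
theorem gVector_form (h : IsLabeling F lab β) (hZ : Z.IsLegGraph) (R : Z.dag.Route) :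
    F.gVector R = 0 ∨ (∃ v, F.gVector R = Pi.single v 1 ∨ F.gVector R = Pi.single v (-1)) ∨
      ∃ v w, v ≠ w ∧ F.gVector R = Pi.single v 1 - Pi.single w 1 := by
  obtain ⟨d, s, t, p, q, u, w, hd, hs, ht, -, -, hu, hw⟩ := exists_ends hZ R
  rw [h.gVector_eq hZ hd hs ht (u := innerVertex hZ u) (w := innerVertex hZ w) hu hw]
  generalize innerVertex hZ u = u'
  generalize innerVertex hZ w = w'
  have hsgn : ∀ x, x ≠ d → (sign β * (num x - num d) = 1 ∧ sign β * (num d - num x) = -1) ∨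
      (sign β * (num x - num d) = -1 ∧ sign β * (num d - num x) = 1) := by
    intro x hx
    cases β <;> cases x <;> cases d <;> simp [sign, num] at hx ⊢
  by_cases h1 : lab s = d
  · by_cases h2 : lab t = d
    · left
      simp [h1, h2]
    · right; left
      refine ⟨w', ?_⟩
      rw [h1, sub_self, mul_zero, Pi.single_zero, zero_add]
      rcases hsgn _ h2 with h2 | h2
      · exact Or.inr (by rw [h2.2])
      · exact Or.inl (by rw [h2.2])
  · by_cases h2 : lab t = d
    · right; left
      refine ⟨u', ?_⟩
      rw [h2, sub_self, mul_zero, Pi.single_zero, add_zero]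
      rcases hsgn _ h1 with h1 | h1
      · exact Or.inl (by rw [h1.1])
      · exact Or.inr (by rw [h1.1])
    · have hst : lab t = lab s := by
        revert h1 h2
        cases lab s <;> cases lab t <;> cases d <;> simp
      rw [hst]
      by_cases huw : u' = w'
      · left
        rw [huw, ← Pi.single_add, ← mul_add, sub_add_sub_cancel, sub_self, mul_zero,
          Pi.single_zero]
      · right; right
        rcases hsgn _ h1 with h1 | h1
        · exact ⟨u', w', huw, by rw [h1.1, h1.2, Pi.single_neg, sub_eq_add_neg]⟩
        · exact ⟨w', u', Ne.symm huw, by rw [h1.1, h1.2, Pi.single_neg, sub_eq_add_neg, add_comm]⟩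

/-- A route that is constantly labelled `true` before a vertex and `false` after it. -/
theorem exists_gVector_eq_single (h : IsLabeling F lab β) (hZ : Z.IsLegGraph)
    (hex : ∀ e, ∃ R : Z.dag.Route, F.IsExceptional R ∧ e ∈ R.edges) (v : Z.dag.InnerVertex) :
    ∃ R, F.gVector R v = sign β ∧ ∀ u, u ≠ v → F.gVector R u = 0 := by
  obtain ⟨v', hv'⟩ := exists_val_eq hZ v
  obtain ⟨a, ha, hla⟩ := h.exists_in hZ v' true
  obtain ⟨b, hb, hlb⟩ := h.exists_out hZ v' false
  obtain ⟨R, hR, haR⟩ := hex a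
  obtain ⟨S, hS, hbS⟩ := hex b
  obtain ⟨x, y, hxy⟩ := List.append_of_mem haR
  obtain ⟨x', y', hxy'⟩ := List.append_of_mem hbS
  obtain ⟨f, y, rfl, hf⟩ := exists_succ hZ hxy ha
  have hxy2 : R.edges = (x ++ [a]) ++ f :: y := by rw [hxy]; simp
  obtain ⟨T, hT⟩ := exists_splice hZ hxy2 hxy' hf hb
  have hl1 : ∀ e ∈ x ++ [a], lab e = true := fun e he => by
    rw [← hla]
    exact h.const_of_isExceptional hZ hR (by rw [hxy]; simp at he ⊢; tauto) haR
  have hl2 : ∀ e ∈ b :: y', lab e = false := fun e he => by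
    rw [← hlb]
    exact h.const_of_isExceptional hZ hS (by rw [hxy']; simp at he ⊢; tauto) hbS
  refine ⟨T, ?_, fun u hu => ?_⟩
  · rw [h.gVector_of_pass (p := x) (q := y') (e := a) (f := b) hZ (by rw [hT]; simp) (by rw [ha, hv']), hla, hlb]
    simp [num]
  · by_cases hpass : ∃ e ∈ T.edges, Z.dag.tgt e = u.1
    · obtain ⟨e, he, heu⟩ := hpass
      obtain ⟨r, r', hr⟩ := List.append_of_mem he
      obtain ⟨u', hu'⟩ := exists_val_eq hZ u
      obtain ⟨g, r', rfl, hg⟩ := exists_succ hZ hr (heu.trans hu')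
      rw [h.gVector_of_pass hZ hr heu]
      have hea : e ≠ a := by
        rintro rfl
        exact hu (Subtype.ext (by rw [← heu, ha, hv']))
      have heq : (x ++ [a]) ++ (b :: y') = (r ++ [e]) ++ (g :: r') := by rw [← hT, hr]; simp
      have : lab e = lab g := by
        -- Each of the two spliced parts is constantly labelled, so the label changes only where
        -- they meet, at v.
        rcases List.append_eq_append_iff.1 heq with ⟨z, h1, h2⟩ | ⟨z, h1, h2⟩
        · rcases List.eq_nil_or_concat' z with rfl | ⟨z, k, rfl⟩
          · rw [List.append_nil] at h1
            exact absurd (List.cons.inj (List.append_inj' h1 rfl).2).1 hea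
          · rw [← List.append_assoc] at h1
            obtain rfl := (List.cons.inj (List.append_inj' h1 rfl).2).1
            rw [hl2 e (by rw [h2]; simp), hl2 g (by rw [h2]; simp)]
        · cases z with
          | nil =>
            rw [List.append_nil] at h1
            exact absurd (List.cons.inj (List.append_inj' h1 rfl).2).1.symm hea
          | cons k z =>
            obtain rfl := (List.cons.inj h2).1
            rw [hl1 e (by rw [h1]; simp), hl1 g (by rw [h1]; simp)]
      rw [this, sub_self, mul_zero]
    · push Not at hpass
      exact gVector_of_not_pass hpass

open Classical in
theorem span_gVector (h : IsLabeling F lab β) (hZ : Z.IsLegGraph)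
    (hex : ∀ e, ∃ R : Z.dag.Route, F.IsExceptional R ∧ e ∈ R.edges)
    [Fintype Z.dag.InnerVertex] : Submodule.span ℝ (Set.range F.gVector) = ⊤ := by
  rw [eq_top_iff]
  intro x _
  rw [pi_eq_sum_univ' x]
  refine Submodule.sum_mem _ fun v _ => Submodule.smul_mem _ _ ?_
  obtain ⟨R, hR, hR'⟩ := h.exists_gVector_eq_single hZ hex v
  have : (Pi.single v 1 : Z.dag.InnerVertex → ℝ) = (sign β)⁻¹ • F.gVector R := by
    ext j
    by_cases hj : j = v
    · subst hj
      simp [hR, sign_ne_zero]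
    · simp [hj, hR' j hj]
  rw [this]
  exact Submodule.smul_mem _ _ (Submodule.subset_span ⟨R, rfl⟩)

end IsLabeling
end Zigzag
end GPoly

/-! ### Rows and columns of the coherence diagram -/

namespace GPoly
namespace Zigzag

variable {Z : Zigzag}

/-- The sign of a direction. -/
def dirSign (d : Bool) : ℤ := if d then 1 else -1

/-- In a cycle both edges that leave vertex `0` are inner edges, the first and the last one; no sink
edge leaves it. -/
theorem IsLegGraph.exists_tail_eq_zero (hZ : Z.IsLegGraph) (hn : Z.n = Z.m) {v : Fin Z.n}
    (hv : (v : ℕ) = 0) {e : Z.Edge} (he : Z.dag.src e = .inner v) :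
    ∃ j, e = .inl j ∧ (Z.up j = false → (Z.hi j : ℕ) = 0) := by
  have h0 := hZ.m_pos
  obtain ⟨a, b, -, -, -, hab⟩ := hZ.exists_pair_src v
  let i : Fin Z.m := ⟨0, h0⟩
  let j : Fin Z.m := ⟨Z.m - 1, by omega⟩
  have hi : Z.up i = true := hZ.up_first hn i rfl
  have hj : Z.up j = false := hZ.up_last hn j (by simp only [j]; omega)
  have hij : (Sum.inl i : Z.Edge) ≠ Sum.inl j := by
    intro h
    rw [Sum.inl.inj h, hj] at hi
    cases hi
  have h1 : Z.dag.src (.inl i) = .inner v := by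
    rw [dag_src_inl, tail, hi, if_pos rfl]
    congr 1
    exact Fin.ext (by rw [hZ.lo_val, hv])
  have h2 : Z.dag.src (.inl j) = .inner v := by
    rw [dag_src_inl, tail, hj, if_neg (by simp)]
    congr 1
    refine Fin.ext ?_
    have h3 := hZ.hi_val j
    have h4 := (Z.hi j).2
    simp only [j] at h3 h4 ⊢
    omega
  have h3 : e = .inl i ∨ e = .inl j := by
    rcases hab _ h1 with h1 | h1 <;> rcases hab _ h2 with h2 | h2 <;> rcases hab _ he with h3 | h3
    all_goals
      first
        | exact absurd (h1.trans h2.symm) hij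
        | exact Or.inl (h3.trans h1.symm)
        | exact Or.inr (h3.trans h2.symm)
  rcases h3 with rfl | rfl
  · exact ⟨i, rfl, fun h => by rw [hi] at h; cases h⟩
  · refine ⟨j, rfl, fun _ => ?_⟩
    rw [dag_src_inl, tail, hj, if_neg (by simp)] at h2
    rw [Vertex.inner.inj h2, hv]

theorem isLegGraph_not_zero_of_sink (hZ : Z.IsLegGraph) {t : Z.Edge} (ht : Z.dag.tgt t = .sink)
    {w : Fin Z.n} (hw : Z.dag.src t = .inner w) : ¬ ((w : ℕ) = 0 ∧ Z.n = Z.m) := by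
  rintro ⟨h0, hn⟩
  obtain ⟨j, rfl, -⟩ := hZ.exists_tail_eq_zero hn h0 hw
  cases ht

/-- The wrapping edge of a cycle lies on exactly the downward routes that start at vertex `0`. -/
theorem wraps_iff (hZ : Z.IsLegGraph) {R : Z.dag.Route} {d : Bool} (hd : HasDir d R.edges)
    {s : Z.Edge} {q : List Z.Edge} (hs : R.edges = s :: q) {u : Fin Z.n}
    (hu : Z.dag.tgt s = .inner u) :
    (∃ j : Fin Z.m, .inl j ∈ R.edges ∧ Z.up j = false ∧ (Z.hi j : ℕ) = 0) ↔
      d = false ∧ (u : ℕ) = 0 ∧ Z.n = Z.m := by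
  constructor
  · rintro ⟨j, hj, hup, h0⟩
    have hn : Z.n = Z.m := by
      rcases hZ.hi_val j with h | h <;> omega
    obtain rfl : d = false := by rw [← hd j hj, hup]
    refine ⟨rfl, ?_, hn⟩
    obtain ⟨p, r, hpr⟩ := List.append_of_mem hj
    have htail : Z.dag.src (.inl j) = .inner (Z.hi j) := by
      rw [dag_src_inl, tail, hup, if_neg (by simp)]
    obtain ⟨p', e, rfl, he⟩ := exists_pred hZ hpr htail
    by_cases hes : e = s
    · rw [hes, hu] at he
      rw [Vertex.inner.inj he, h0]
    -- Vertex `0` has the least position, -n, so no other vertex of the route can precede it.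
    · have := pos_start_lt hZ hd hs (e := e) (by rw [hpr]; simp) hu he hes
      have h1 := u.2
      simp only [pos, h0, hn, and_self, if_true, Bool.false_eq_true, if_false, and_true] at this
      split_ifs at this with h2
      · exact h2
      · omega
  · rintro ⟨rfl, h0, hn⟩
    obtain ⟨f, q', rfl, hf⟩ := exists_succ (p := []) hZ hs hu
    obtain ⟨j, rfl, hj⟩ := hZ.exists_tail_eq_zero hn h0 hf
    have hmem : Sum.inl j ∈ R.edges := by rw [hs]; simp
    exact ⟨j, hmem, hd j hmem, hj (hd j hmem)⟩

/-- Two routes with the same direction and the same ends are equal. -/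
theorem route_eq (hZ : Z.IsLegGraph) {R S : Z.dag.Route} {d : Bool} (hR : HasDir d R.edges)
    (hS : HasDir d S.edges) {s t : Z.Edge} {q q' p p' : List Z.Edge} (hRs : R.edges = s :: q)
    (hSs : S.edges = s :: q') (hRt : R.edges = p ++ [t]) (hSt : S.edges = p' ++ [t])
    (ht : Z.dag.tgt t = .sink) : R = S := by
  have hmem : t ∈ R.edges ∧ t ∈ S.edges := by rw [hRt, hSt]; simp
  rcases exists_common_prefix R.edges S.edges with ⟨r, h⟩ | ⟨r, h⟩ | ⟨c, r, r', a, b, hab, h, h'⟩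
  · rw [hSt, List.append_assoc, List.singleton_append] at h
    have hr := eq_nil_of_sink h ht
    rw [hr] at h
    exact Route.ext (h.trans hSt.symm)
  · rw [hRt, List.append_assoc, List.singleton_append] at h
    have hr := eq_nil_of_sink h ht
    rw [hr] at h
    exact Route.ext (hRt.trans h.symm)
  · exfalso
    have hc : c ≠ [] := by
      rintro rfl
      rw [hRs] at h
      rw [hSs] at h'
      exact hab ((List.cons.inj h).1.symm.trans (List.cons.inj h').1)
    obtain ⟨c, x, rfl⟩ := (List.eq_nil_or_concat' c).resolve_left hc
    rw [List.append_assoc, List.singleton_append] at h h'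
    obtain ⟨v, hv, hv'⟩ := chain_inner h
    obtain ⟨w, hw, hw'⟩ := chain_inner h'
    obtain rfl := Vertex.inner.inj (hv.symm.trans hw)
    have ha : a ∈ R.edges := by rw [h]; simp
    have hb : b ∈ S.edges := by rw [h']; simp
    have key : ∀ x y : Z.Edge, Z.dag.src x = .inner v → Z.dag.src y = .inner v →
        Z.dag.tgt x = .sink → ∀ T : Z.dag.Route, y ∈ T.edges → t ∈ T.edges → x = t → x = y := by
      rintro x y hx hy - T hyT htT rfl
      exact eq_of_src_eq hZ htT hyT (hx.trans hy.symm)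
    have hsink : ∀ T : Z.dag.Route, ∀ p, T.edges = p ++ [t] → ∀ x ∈ T.edges,
        Z.dag.tgt x = .sink → x = t := by
      intro T p hT x hx hxs
      obtain ⟨y, z, hyz⟩ := List.append_of_mem hx
      rw [eq_nil_of_sink hyz hxs, hT] at hyz
      exact (List.cons.inj (List.append_inj' hyz rfl).2).1.symm
    rcases tgt_cases a with h1 | ⟨w1, h1⟩
    · exact hab (key a b hv' hw' h1 S hb hmem.2 (hsink R p hRt a ha h1))
    · rcases tgt_cases b with h2 | ⟨w2, h2⟩
      · exact hab (key b a hw' hv' h2 R ha hmem.1 (hsink S p' hSt b hb h2)).symm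
      · obtain ⟨i, rfl, hi, -⟩ := exists_eq_inl hv' h1
        obtain ⟨j, rfl, hj, -⟩ := exists_eq_inl hw' h2
        have h3 := hR i ha
        have h4 := hS j hb
        refine hab (congrArg _ ?_)
        have h5 := hi.trans hj.symm
        unfold tail at h5
        rw [h3, h4] at h5
        cases d
        · exact hZ.hi_inj (by simpa using h5)
        · exact hZ.lo_inj (by simpa using h5)

namespace IsLabeling

variable {F : Framing Z.dag} {lab : Z.Edge → Bool} {β : Bool}

theorem rowBefore_iff (h : IsLabeling F lab β) (e e' : Z.Edge) : F.RowBefore e e' ↔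
    ∃ i i', Z.dag.src e = .source ∧ Z.dag.src e' = .source ∧ Z.dag.tgt e = .inner i ∧
      Z.dag.tgt e' = .inner i' ∧ (i < i' ∨ i = i' ∧ lab e = true ∧ lab e' = false) := by
  unfold Framing.RowBefore
  refine exists_congr fun i => exists_congr fun i' => ?_
  refine and_congr_right fun _ => and_congr_right fun _ => and_congr_right fun h1 =>
    and_congr_right fun h2 => or_congr_right (and_congr_right ?_)
  rintro rfl
  rw [h.standard_iff, h.inLT_iff, h.inLT_iff]
  cases β <;> simp [h1, h2, and_comm]

theorem colBefore_iff (h : IsLabeling F lab β) (e e' : Z.Edge) : F.ColBefore e e' ↔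
    ∃ i i', Z.dag.tgt e = .sink ∧ Z.dag.tgt e' = .sink ∧ Z.dag.src e = .inner i ∧
      Z.dag.src e' = .inner i' ∧ (i < i' ∨ i = i' ∧ lab e = false ∧ lab e' = true) := by
  unfold Framing.ColBefore
  refine exists_congr fun i => exists_congr fun i' => ?_
  refine and_congr_right fun _ => and_congr_right fun _ => and_congr_right fun h1 =>
    and_congr_right fun h2 => or_congr_right (and_congr_right ?_)
  rintro rfl
  rw [h.standard_iff, h.outLT_iff, h.outLT_iff]
  cases β <;> simp [h1, h2, and_comm]

theorem ncard_rowBefore_lt (h : IsLabeling F lab β) {e e' : Z.Edge} (he : F.RowBefore e e') :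
    Set.ncard {x | F.RowBefore x e} < Set.ncard {x | F.RowBefore x e'} := by
  refine Set.ncard_lt_ncard ⟨fun x hx => ?_, fun hsub => ?_⟩ (Set.toFinite _)
  · rw [Set.mem_ofPred_eq, h.rowBefore_iff] at *
    obtain ⟨i, i', h1, h2, h3, h4, h5⟩ := hx
    obtain ⟨k, k', h1', h2', h3', h4', h5'⟩ := he
    obtain rfl := Vertex.inner.inj (h4.symm.trans h3')
    refine ⟨i, k', h1, h2', h3, h4', ?_⟩
    rcases h5 with h5 | ⟨rfl, h5, h6⟩ <;> rcases h5' with h5' | ⟨rfl, h5', h6'⟩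
    · exact Or.inl (h5.trans h5')
    · exact Or.inl h5
    · exact Or.inl h5'
    · exact Or.inr ⟨rfl, h5, h6'⟩
  · have := hsub he
    rw [Set.mem_ofPred_eq, h.rowBefore_iff] at this
    obtain ⟨i, i', -, -, h3, h4, h5⟩ := this
    obtain rfl := Vertex.inner.inj (h3.symm.trans h4)
    rcases h5 with h5 | ⟨-, h5, h6⟩
    · exact lt_irrefl _ h5
    · rw [h5] at h6
      cases h6

theorem ncard_colBefore_lt (h : IsLabeling F lab β) {e e' : Z.Edge} (he : F.ColBefore e e') :
    Set.ncard {x | F.ColBefore x e} < Set.ncard {x | F.ColBefore x e'} := by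
  refine Set.ncard_lt_ncard ⟨fun x hx => ?_, fun hsub => ?_⟩ (Set.toFinite _)
  · rw [Set.mem_ofPred_eq, h.colBefore_iff] at *
    obtain ⟨i, i', h1, h2, h3, h4, h5⟩ := hx
    obtain ⟨k, k', h1', h2', h3', h4', h5'⟩ := he
    obtain rfl := Vertex.inner.inj (h4.symm.trans h3')
    refine ⟨i, k', h1, h2', h3, h4', ?_⟩
    rcases h5 with h5 | ⟨rfl, h5, h6⟩ <;> rcases h5' with h5' | ⟨rfl, h5', h6'⟩
    · exact Or.inl (h5.trans h5')
    · exact Or.inl h5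
    · exact Or.inl h5'
    · exact Or.inr ⟨rfl, h5, h6'⟩
  · have := hsub he
    rw [Set.mem_ofPred_eq, h.colBefore_iff] at this
    obtain ⟨i, i', -, -, h3, h4, h5⟩ := this
    obtain rfl := Vertex.inner.inj (h3.symm.trans h4)
    rcases h5 with h5 | ⟨-, h5, h6⟩
    · exact lt_irrefl _ h5
    · rw [h5] at h6
      cases h6

theorem ncard_rowBefore_lt_total (h : IsLabeling F lab β) {e : Z.Edge}
    (he : Z.dag.src e = .source) :
    Set.ncard {x | F.RowBefore x e} < Set.ncard {x | Z.dag.src x = .source} := by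
  refine Set.ncard_lt_ncard ⟨?_, fun hsub => ?_⟩ (Set.toFinite _)
  · rintro x ⟨i, i', h1, -⟩
    exact h1
  · have := hsub he
    rw [Set.mem_ofPred_eq, h.rowBefore_iff] at this
    obtain ⟨i, i', -, -, h3, h4, h5⟩ := this
    obtain rfl := Vertex.inner.inj (h3.symm.trans h4)
    rcases h5 with h5 | ⟨-, h5, h6⟩
    · exact lt_irrefl _ h5
    · rw [h5] at h6
      cases h6

open Classical in
theorem row_eq (hZ : Z.IsLegGraph) {R : Z.dag.Route} {d : Bool} (hd : HasDir d R.edges)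
    {s : Z.Edge} {q : List Z.Edge} (hs : R.edges = s :: q) {u : Fin Z.n}
    (hu : Z.dag.tgt s = .inner u) :
    F.row R = Set.ncard {e | F.RowBefore e s} +
      if d = false ∧ (u : ℕ) = 0 ∧ Z.n = Z.m then Set.ncard {e | Z.dag.src e = .source} else 0 := by
  unfold Framing.row
  simp only [wraps_iff hZ hd hs hu]
  simp only [hs, List.head_cons]

theorem col_eq {R : Z.dag.Route} {t : Z.Edge} {p : List Z.Edge} (ht : R.edges = p ++ [t]) :
    F.col R = Set.ncard {e | F.ColBefore e t} := by
  unfold Framing.col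
  simp only [ht, List.getLast_append_singleton]

/-- The factor `dirSign d` treats both directions alike: the signed row grows as the start moves
forward along the leg, and at one vertex the source edge with the label of the leg comes first. The
repeated rows of a cycle match the position -n of vertex `0`. -/
theorem row_lt (h : IsLabeling F lab β) (hZ : Z.IsLegGraph) {R R' : Z.dag.Route} {d : Bool}
    (hd : HasDir d R.edges) (hd' : HasDir d R'.edges) {s s' : Z.Edge} {q q' : List Z.Edge}
    (hs : R.edges = s :: q) (hs' : R'.edges = s' :: q') {u u' : Fin Z.n}
    (hu : Z.dag.tgt s = .inner u) (hu' : Z.dag.tgt s' = .inner u')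
    (hlt : Z.pos d u' < Z.pos d u ∨ u' = u ∧ lab s = !d ∧ lab s' = d) :
    dirSign d * F.row R' < dirSign d * F.row R := by
  have h1 : Z.dag.src s = .source := by
    have := src_head hZ R
    simpa only [hs, List.head_cons] using this
  have h1' : Z.dag.src s' = .source := by
    have := src_head hZ R'
    simpa only [hs', List.head_cons] using this
  have ht := h.ncard_rowBefore_lt_total h1
  rw [row_eq hZ hd hs hu, row_eq hZ hd' hs' hu']
  have hrow : ∀ {e e' : Z.Edge} {i i' : Fin Z.n}, Z.dag.src e = .source → Z.dag.src e' = .source →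
      Z.dag.tgt e = .inner i → Z.dag.tgt e' = .inner i' →
      ((i : ℕ) < i' ∨ i = i' ∧ lab e = true ∧ lab e' = false) →
      Set.ncard {x | F.RowBefore x e} < Set.ncard {x | F.RowBefore x e'} :=
    fun a1 a2 a3 a4 a5 => h.ncard_rowBefore_lt ((h.rowBefore_iff _ _).2 ⟨_, _, a1, a2, a3, a4, a5⟩)
  cases d
  · simp only [dirSign, true_and, Bool.false_eq_true, if_false, neg_one_mul, neg_lt_neg_iff,
      Nat.cast_lt]
    rcases hlt with hlt | ⟨rfl, hl, hl'⟩
    · simp only [pos, Bool.false_eq_true, if_false] at hlt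
      have hun := u.2
      have hun' := u'.2
      split_ifs at hlt ⊢ with c1 c2 c2
      · omega
      · omega
      · omega
      · have := hrow h1 h1' hu hu' (Or.inl (by omega))
        omega
    · have := hrow h1 h1' hu hu' (Or.inr ⟨rfl, hl, hl'⟩)
      omega
  · simp only [dirSign, Bool.true_eq_false, false_and, if_false, add_zero, if_true, one_mul,
      Nat.cast_lt]
    refine hrow h1' h1 hu' hu ?_
    rcases hlt with hlt | ⟨rfl, hl, hl'⟩
    · simp only [pos, if_true, Nat.cast_lt] at hlt
      exact Or.inl hlt
    · exact Or.inr ⟨rfl, hl', hl⟩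

/-- The counterpart for ends: at one vertex the sink edge with the label of the leg comes last. A
cycle needs no correction here, since no sink edge leaves vertex `0`. -/
theorem col_lt (h : IsLabeling F lab β) (hZ : Z.IsLegGraph) {R R' : Z.dag.Route} {d : Bool}
    {t t' : Z.Edge} {p p' : List Z.Edge} (ht : R.edges = p ++ [t]) (ht' : R'.edges = p' ++ [t'])
    {w w' : Fin Z.n} (hw : Z.dag.src t = .inner w) (hw' : Z.dag.src t' = .inner w')
    (hlt : Z.pos d w < Z.pos d w' ∨ w' = w ∧ lab t = !d ∧ lab t' = d) :
    dirSign d * F.col R < dirSign d * F.col R' := by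
  have h1 : Z.dag.tgt t = .sink := by
    have := tgt_getLast hZ R
    simpa only [ht, List.getLast_append_singleton] using this
  have h1' : Z.dag.tgt t' = .sink := by
    have := tgt_getLast hZ R'
    simpa only [ht', List.getLast_append_singleton] using this
  have h0 := isLegGraph_not_zero_of_sink hZ h1 hw
  have h0' := isLegGraph_not_zero_of_sink hZ h1' hw'
  rw [col_eq ht, col_eq ht']
  have hcol : ∀ {e e' : Z.Edge} {i i' : Fin Z.n}, Z.dag.tgt e = .sink → Z.dag.tgt e' = .sink →
      Z.dag.src e = .inner i → Z.dag.src e' = .inner i' →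
      ((i : ℕ) < i' ∨ i = i' ∧ lab e = false ∧ lab e' = true) →
      Set.ncard {x | F.ColBefore x e} < Set.ncard {x | F.ColBefore x e'} :=
    fun a1 a2 a3 a4 a5 => h.ncard_colBefore_lt ((h.colBefore_iff _ _).2 ⟨_, _, a1, a2, a3, a4, a5⟩)
  cases d
  · simp only [dirSign, Bool.false_eq_true, if_false, neg_one_mul, neg_lt_neg_iff, Nat.cast_lt]
    refine hcol h1' h1 hw' hw ?_
    rcases hlt with hlt | ⟨rfl, hl, hl'⟩
    · simp only [pos, Bool.false_eq_true, if_false, if_neg h0, if_neg h0'] at hlt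
      exact Or.inl (by omega)
    · exact Or.inr ⟨rfl, hl', hl⟩
  · simp only [dirSign, if_true, one_mul, Nat.cast_lt]
    refine hcol h1 h1' hw hw' ?_
    rcases hlt with hlt | ⟨rfl, hl, hl'⟩
    · simp only [pos, if_true, Nat.cast_lt] at hlt
      exact Or.inl hlt
    · exact Or.inr ⟨rfl, hl, hl'⟩

end IsLabeling
end Zigzag
end GPoly

/-! ### Corners: the long exceptional routes -/

namespace GPoly
namespace Zigzag

variable {Z : Zigzag}

/-- All edges of the route have the label `d`. -/
def HasLabel (lab : Z.Edge → Bool) (d : Bool) (C : Z.dag.Route) : Prop := ∀ e ∈ C.edges, lab e = d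

namespace IsLabeling

variable {F : Framing Z.dag} {lab : Z.Edge → Bool} {β : Bool}

theorem exists_hasLabel (h : IsLabeling F lab β) (hZ : Z.IsLegGraph) {C : Z.dag.Route}
    (hC : F.IsExceptional C) : ∃ d, HasLabel lab d C :=
  ⟨lab (C.edges.head C.ne), fun _ he => h.const_of_isExceptional hZ hC he (List.head_mem _)⟩

theorem hasDir_of_hasLabel (h : IsLabeling F lab β) {C : Z.dag.Route} {d : Bool}
    (hC : HasLabel lab d C) : HasDir d C.edges := fun j hj => by
  rw [← h.lab_inl, hC _ hj]

theorem hasDir_of_isCornerOf (h : IsLabeling F lab β) {C R : Z.dag.Route} {d : Bool}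
    (hC : HasLabel lab d C) (hCR : F.IsCornerOf C R) : HasDir d R.edges := fun j hj =>
  h.hasDir_of_hasLabel hC j (hCR.2.2.1 j hj)

/-- At each vertex the label determines the next and the previous edge, so a constantly labelled
route is determined by any one of its edges. -/
theorem eq_of_mem_mem (h : IsLabeling F lab β) (hZ : Z.IsLegGraph) {C D : Z.dag.Route} {d : Bool}
    (hC : HasLabel lab d C) (hD : HasLabel lab d D) {e : Z.Edge} (heC : e ∈ C.edges)
    (heD : e ∈ D.edges) : C = D := by
  obtain ⟨p, q, hp⟩ := List.append_of_mem heC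
  obtain ⟨p', q', hp'⟩ := List.append_of_mem heD
  have hCm : ∀ x ∈ p ++ e :: q, lab x = d := by rwa [← hp]
  have hDm : ∀ x ∈ p' ++ e :: q', lab x = d := by rwa [← hp']
  have hq : q = q' := by
    rcases exists_common_prefix q q' with ⟨r, hr⟩ | ⟨r, hr⟩ | ⟨c, r, r', a, b, hab, hr, hr'⟩
    · obtain ⟨y, t, ht, ht'⟩ := exists_eq_concat hZ D
      have h1 : C.edges = (p ++ e :: q') ++ r := by rw [hp, hr]; simp
      cases r with
      | nil => simpa using hr
      | cons x r =>
        exfalso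
        obtain ⟨z, k, hk⟩ := (List.eq_nil_or_concat' (e :: q')).resolve_left (by simp)
        rw [hk, ← List.append_assoc, List.append_assoc] at h1
        obtain ⟨v, hv, -⟩ := chain_inner h1
        rw [hp', hk, ← List.append_assoc] at ht
        obtain rfl := (List.cons.inj (List.append_inj' ht rfl).2).1
        rw [ht'] at hv
        cases hv
    · obtain ⟨y, t, ht, ht'⟩ := exists_eq_concat hZ C
      have h1 : D.edges = (p' ++ e :: q) ++ r := by rw [hp', hr]; simp
      cases r with
      | nil => simpa using hr.symm
      | cons x r =>
        exfalso
        obtain ⟨z, k, hk⟩ := (List.eq_nil_or_concat' (e :: q)).resolve_left (by simp)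
        rw [hk, ← List.append_assoc, List.append_assoc] at h1
        obtain ⟨v, hv, -⟩ := chain_inner h1
        rw [hp, hk, ← List.append_assoc] at ht
        obtain rfl := (List.cons.inj (List.append_inj' ht rfl).2).1
        rw [ht'] at hv
        cases hv
    · exfalso
      obtain ⟨z, k, hk⟩ := (List.eq_nil_or_concat' (e :: c)).resolve_left (by simp)
      have h1 : C.edges = (p ++ z) ++ k :: a :: r := by
        rw [hp, hr, ← List.cons_append, hk]; simp
      have h2 : D.edges = (p' ++ z) ++ k :: b :: r' := by
        rw [hp', hr', ← List.cons_append, hk]; simp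
      obtain ⟨v, hv, hv'⟩ := chain_inner h1
      obtain ⟨w, hw, hw'⟩ := chain_inner h2
      obtain rfl := Vertex.inner.inj (hv.symm.trans hw)
      exact hab (h.out_eq hZ hv' hw' (by rw [hC a (by rw [h1]; simp), hD b (by rw [h2]; simp)]))
  have hpp : p = p' := by
    rcases exists_common_suffix p p' with ⟨r, hr⟩ | ⟨r, hr⟩ | ⟨r, r', c, a, b, hab, hr, hr'⟩
    · obtain ⟨s, y, hs, hs'⟩ := exists_eq_cons hZ D
      rcases List.eq_nil_or_concat' r with rfl | ⟨r, x, rfl⟩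
      · simpa using hr
      · exfalso
        obtain ⟨k, z, hk⟩ : ∃ k z, p' ++ [e] = k :: z := by cases p' <;> simp
        have h1 : C.edges = r ++ x :: k :: (z ++ q) := by
          rw [← List.cons_append, ← hk, hp, hr]; simp
        obtain ⟨v, -, hv⟩ := chain_inner h1
        have h2 : D.edges = k :: (z ++ q') := by
          rw [← List.cons_append, ← hk, hp']; simp
        rw [h2] at hs
        rw [(List.cons.inj hs).1, hs'] at hv
        cases hv
    · obtain ⟨s, y, hs, hs'⟩ := exists_eq_cons hZ C
      rcases List.eq_nil_or_concat' r with rfl | ⟨r, x, rfl⟩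
      · simpa using hr.symm
      · exfalso
        obtain ⟨k, z, hk⟩ : ∃ k z, p ++ [e] = k :: z := by cases p <;> simp
        have h1 : D.edges = r ++ x :: k :: (z ++ q') := by
          rw [← List.cons_append, ← hk, hp', hr]; simp
        obtain ⟨v, -, hv⟩ := chain_inner h1
        have h2 : C.edges = k :: (z ++ q) := by
          rw [← List.cons_append, ← hk, hp]; simp
        rw [h2] at hs
        rw [(List.cons.inj hs).1, hs'] at hv
        cases hv
    · exfalso
      obtain ⟨k, z, hk⟩ : ∃ k z, c ++ [e] = k :: z := by cases c <;> simp
      have h1 : C.edges = r ++ a :: k :: (z ++ q) := by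
        rw [← List.cons_append, ← hk, hp, hr]; simp
      have h2 : D.edges = r' ++ b :: k :: (z ++ q') := by
        rw [← List.cons_append, ← hk, hp', hr']; simp
      obtain ⟨v, hv, hv'⟩ := chain_inner h1
      obtain ⟨w, hw, hw'⟩ := chain_inner h2
      obtain rfl := Vertex.inner.inj (hv'.symm.trans hw')
      exact hab (h.in_eq hZ hv hw (by rw [hC a (by rw [h1]; simp), hD b (by rw [h2]; simp)]))
  exact Route.ext (by rw [hp, hp', hq, hpp])

/-- A route with label `d` that has a vertex in common with an inner part of direction `d`
contains this part. -/
theorem mem_of_forward (h : IsLabeling F lab β) (hZ : Z.IsLegGraph) {C : Z.dag.Route} {d : Bool}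
    (hC : HasLabel lab d C) {q : List Z.Edge} {e : Z.Edge}
    (hch : (e :: q).IsChain fun e f => Z.dag.tgt e = Z.dag.src f) (hd : HasDir d q)
    {v : Fin Z.n} (hev : Z.dag.tgt e = .inner v) (hpass : ∃ e' ∈ C.edges, Z.dag.tgt e' = .inner v) :
    ∀ f ∈ q, (∀ i, f = .inl i → f ∈ C.edges) ∧
      ∀ w, Z.dag.tgt f = .inner w → ∃ e' ∈ C.edges, Z.dag.tgt e' = .inner w := by
  induction q generalizing e v with
  | nil => intro f hf; cases hf
  | cons f q ih =>
    obtain ⟨e', he', hev'⟩ := hpass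
    obtain ⟨p, r, hpr⟩ := List.append_of_mem he'
    obtain ⟨f', r, rfl, hf'⟩ := exists_succ hZ hpr hev'
    have hf : Z.dag.src f = .inner v := by rw [← hev, (List.isChain_cons_cons.1 hch).1]
    have hf'C : f' ∈ C.edges := by rw [hpr]; simp
    rcases tgt_cases f with ht | ⟨w, ht⟩
    · cases q with
      | nil =>
        intro g hg
        obtain rfl := List.mem_singleton.1 hg
        refine ⟨fun i hi => ?_, fun w hw => ?_⟩
        · rw [hi] at ht; cases ht
        · rw [ht] at hw; cases hw
      | cons g q =>
        obtain ⟨w, hw, -⟩ := exists_inner_of_chain (List.isChain_cons_cons.1 hch.of_cons).1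
        rw [ht] at hw
        cases hw
    · obtain ⟨i, rfl, -⟩ := exists_eq_inl hf ht
      have hfC : (.inl i : Z.Edge) ∈ C.edges := by
        rw [h.out_eq hZ hf hf' (by rw [h.lab_inl, hd i (by simp), hC _ hf'C])]
        exact hf'C
      have := ih hch.of_cons (hd.mono (by simp)) ht ⟨_, hfC, ht⟩
      intro g hg
      rcases List.mem_cons.1 hg with rfl | hg
      · exact ⟨fun _ _ => hfC, fun w' hw' => ⟨_, hfC, hw'⟩⟩
      · exact this g hg

theorem mem_of_backward (h : IsLabeling F lab β) (hZ : Z.IsLegGraph) {C : Z.dag.Route} {d : Bool}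
    (hC : HasLabel lab d C) {p : List Z.Edge} {f : Z.Edge}
    (hch : (p ++ [f]).IsChain fun e f => Z.dag.tgt e = Z.dag.src f) (hd : HasDir d p)
    {v : Fin Z.n} (hfv : Z.dag.src f = .inner v) (hpass : ∃ e' ∈ C.edges, Z.dag.src e' = .inner v) :
    ∀ e ∈ p, (∀ i, e = .inl i → e ∈ C.edges) ∧
      ∀ w, Z.dag.tgt e = .inner w → ∃ e' ∈ C.edges, Z.dag.tgt e' = .inner w := by
  induction p using List.reverseRecOn generalizing f v with
  | nil => intro f hf; cases hf
  | append_singleton p e ih =>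
    obtain ⟨f', hf', hfv'⟩ := hpass
    obtain ⟨r, r', hpr⟩ := List.append_of_mem hf'
    obtain ⟨r, e', rfl, he'⟩ := exists_pred hZ hpr hfv'
    have he : Z.dag.tgt e = .inner v := by
      rw [List.append_assoc] at hch
      rw [← hfv, (List.isChain_cons_cons.1 hch.right_of_append).1]
    have he'C : e' ∈ C.edges := by rw [hpr]; simp
    have hself : ∀ w, Z.dag.tgt e = .inner w → ∃ e' ∈ C.edges, Z.dag.tgt e' = .inner w := by
      intro w hw
      exact ⟨e', he'C, by rw [he', ← he, hw]⟩
    rcases src_cases e with hs | ⟨w, hs⟩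
    · rcases List.eq_nil_or_concat' p with rfl | ⟨p, x, rfl⟩
      · intro g hg
        obtain rfl := List.mem_singleton.1 hg
        refine ⟨fun i hi => ?_, hself⟩
        rw [hi] at hs; cases hs
      · rw [List.append_assoc, List.append_assoc] at hch
        obtain ⟨w, -, hw⟩ := exists_inner_of_chain (List.isChain_cons_cons.1 hch.right_of_append).1
        rw [hs] at hw
        cases hw
    · obtain ⟨i, rfl, -⟩ := exists_eq_inl hs he
      have heC : (.inl i : Z.Edge) ∈ C.edges := by
        rw [h.in_eq hZ he he' (by rw [h.lab_inl, hd i (by simp), hC _ he'C])]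
        exact he'C
      have := ih hch.left_of_append (hd.mono (by simp)) hs ⟨_, heC, hs⟩
      intro g hg
      rcases List.mem_append.1 hg with hg | hg
      · exact this g hg
      · obtain rfl := List.mem_singleton.1 hg
        exact ⟨fun _ _ => heC, hself⟩

theorem two_lt_length (hZ : Z.IsLegGraph) {C : Z.dag.Route} {j : Fin Z.m}
    (hj : .inl j ∈ C.edges) : 2 < C.edges.length := by
  obtain ⟨p, q, hpq⟩ := List.append_of_mem hj
  obtain ⟨p, x, rfl, -⟩ := exists_pred hZ hpq rfl
  obtain ⟨y, q, rfl, -⟩ := exists_succ hZ hpq rfl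
  rw [hpq]
  simp only [List.length_append, List.length_cons, List.length_nil]
  omega

/-- The inner edges of a leg carry its label, so a constantly labelled route that shares one inner
edge with R must follow the leg at least as far as R does, in both directions. -/
theorem isCornerOf_of_mem (h : IsLabeling F lab β) (hZ : Z.IsLegGraph) {C R : Z.dag.Route}
    (hC : F.IsExceptional C) {j : Fin Z.m} (hjC : .inl j ∈ C.edges) (hjR : .inl j ∈ R.edges) :
    F.IsCornerOf C R := by
  obtain ⟨d, hd⟩ := h.exists_hasLabel hZ hC
  have hdR : HasDir d R.edges := by
    obtain ⟨d', hd'⟩ := exists_hasDir hZ R.chain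
    rwa [← hd _ hjC, h.lab_inl, hd' j hjR]
  obtain ⟨p, q, hpq⟩ := List.append_of_mem hjR
  have hch := R.chain
  rw [hpq] at hch
  have h1 := h.mem_of_forward hZ hd hch.right_of_append
    (hdR.mono (by rw [hpq]; intro x hx; simp [hx])) (v := Z.head j) rfl ⟨_, hjC, rfl⟩
  have h2 := h.mem_of_backward hZ hd (p := p) (f := .inl j) (by
      rw [List.append_cons] at hch
      exact hch.left_of_append)
    (hdR.mono (by rw [hpq]; simp)) (v := Z.tail j) rfl ⟨_, hjC, rfl⟩
  refine ⟨hC, two_lt_length hZ hjC, fun i hi => ?_, ?_⟩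
  · rw [hpq] at hi
    rcases List.mem_append.1 hi with hi | hi
    · exact (h2 _ hi).1 i rfl
    · rcases List.mem_cons.1 hi with hi | hi
      · rw [hi]; exact hjC
      · exact (h1 _ hi).1 i rfl
  · rintro i ⟨e, he, hi⟩
    rw [hpq] at he
    rcases List.mem_append.1 he with he | he
    · exact (h2 _ he).2 i hi
    · rcases List.mem_cons.1 he with rfl | he
      · exact ⟨_, hjC, hi⟩
      · exact (h1 _ he).2 i hi

theorem exists_isCornerOf (h : IsLabeling F lab β) (hZ : Z.IsLegGraph)
    (hex : ∀ e, ∃ R : Z.dag.Route, F.IsExceptional R ∧ e ∈ R.edges) (R : Z.dag.Route) :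
    ∃ C, F.IsCornerOf C R := by
  by_cases hj : ∃ j, Sum.inl j ∈ R.edges
  · obtain ⟨j, hj⟩ := hj
    obtain ⟨C, hC, hjC⟩ := hex (.inl j)
    exact ⟨C, h.isCornerOf_of_mem hZ hC hjC hj⟩
  -- R has a single inner vertex, and an exceptional route along any inner edge incident to it
  -- passes through that vertex.
  · push Not at hj
    obtain ⟨s, q, hs, hs'⟩ := exists_eq_cons hZ R
    obtain ⟨u, hu⟩ := tgt_ne_sink_of_src hs'
    obtain ⟨j, hjv⟩ := hZ.exists_incident u
    obtain ⟨C, hC, hjC⟩ := hex (.inl j)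
    refine ⟨C, hC, two_lt_length hZ hjC, fun i hi => absurd hi (hj i), ?_⟩
    rintro i ⟨e, he, hei⟩
    have hsrc : Z.dag.src e = .source := by
      refine (src_cases e).resolve_right ?_
      rintro ⟨v, hv⟩
      obtain ⟨k, rfl, -⟩ := exists_eq_inl hv hei
      exact hj k he
    obtain ⟨p, r, hpr⟩ := List.append_of_mem he
    obtain rfl := eq_nil_of_source hpr hsrc
    rw [hs] at hpr
    obtain rfl := (List.cons.inj hpr).1
    obtain rfl := Vertex.inner.inj (hei.symm.trans hu)
    rcases hjv with hjv | hjv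
    · exact ⟨_, hjC, by rw [dag_tgt_inl, hjv]⟩
    · obtain ⟨p, r, hpr⟩ := List.append_of_mem hjC
      obtain ⟨p, x, rfl, hx⟩ := exists_pred (v := i) hZ hpr (by rw [dag_src_inl, hjv])
      exact ⟨x, by rw [hpr]; simp, hx⟩

/-- The delicate case is a route s, t without inner edges and corners C, D with different labels.
Each of s, t lies on C or on D. If both lie on the same one, this has only two edges. Otherwise
consider the two remaining edges at the vertex: if one of them is a source or sink edge, C or D
again has only two edges; if both are inner, they are consecutive and so have equal labels. -/
theorem corner_unique (h : IsLabeling F lab β) (hZ : Z.IsLegGraph) {C D R : Z.dag.Route}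
    (hC : F.IsCornerOf C R) (hD : F.IsCornerOf D R) : C = D := by
  obtain ⟨d, hd⟩ := h.exists_hasLabel hZ hC.1
  obtain ⟨d', hd'⟩ := h.exists_hasLabel hZ hD.1
  obtain ⟨s, q, hs, hs'⟩ := exists_eq_cons hZ R
  obtain ⟨u, hu⟩ := tgt_ne_sink_of_src hs'
  obtain ⟨e, he, heu⟩ := hC.2.2.2 u ⟨s, by rw [hs]; simp, hu⟩
  obtain ⟨e', he', heu'⟩ := hD.2.2.2 u ⟨s, by rw [hs]; simp, hu⟩
  by_cases hdd : d = d'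
  · subst hdd
    obtain rfl := h.in_eq hZ heu heu' ((hd e he).trans (hd' e' he').symm)
    exact h.eq_of_mem_mem hZ hd hd' he he'
  · exfalso
    by_cases hj : ∃ j, Sum.inl j ∈ R.edges
    · obtain ⟨j, hj⟩ := hj
      rw [← hd _ (hC.2.2.1 j hj), ← hd' _ (hD.2.2.1 j hj)] at hdd
      exact hdd rfl
    · push Not at hj
      obtain ⟨t, q, rfl, ht⟩ := exists_succ (p := []) hZ hs hu
      have htt : Z.dag.tgt t = .sink := by
        refine (tgt_cases t).resolve_right ?_
        rintro ⟨w, hw⟩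
        obtain ⟨j, rfl, -⟩ := exists_eq_inl ht hw
        exact hj j (by rw [hs]; simp)
      obtain ⟨p, r, hpr⟩ := List.append_of_mem he
      obtain ⟨f, r, rfl, hf⟩ := exists_succ hZ hpr heu
      obtain ⟨p', r', hpr'⟩ := List.append_of_mem he'
      obtain ⟨f', r', rfl, hf'⟩ := exists_succ hZ hpr' heu'
      have hfC : f ∈ C.edges := by rw [hpr]; simp
      have hfD : f' ∈ D.edges := by rw [hpr']; simp
      have hlong : ∀ {T : Z.dag.Route} {p r : List Z.Edge} {e f : Z.Edge},
          2 < T.edges.length → T.edges = p ++ e :: f :: r → Z.dag.src e = .source →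
          Z.dag.tgt f = .sink → False := by
        intro T p r e f hT hpr hsrc htgt
        obtain rfl := eq_nil_of_source hpr hsrc
        have hpr2 : T.edges = [e] ++ f :: r := hpr
        obtain rfl := eq_nil_of_sink hpr2 htgt
        rw [hpr] at hT
        simp at hT
      have hin : s = e ∨ s = e' := by
        by_cases hse : lab s = d
        · exact Or.inl (h.in_eq hZ hu heu (hse.trans (hd e he).symm))
        · refine Or.inr (h.in_eq hZ hu heu' ?_)
          rw [hd' e' he']
          revert hse hdd
          cases lab s <;> cases d <;> cases d' <;> simp
      have hout : t = f ∨ t = f' := by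
        by_cases hse : lab t = d
        · exact Or.inl (h.out_eq hZ ht hf (hse.trans (hd f hfC).symm))
        · refine Or.inr (h.out_eq hZ ht hf' ?_)
          rw [hd' f' hfD]
          revert hse hdd
          cases lab t <;> cases d <;> cases d' <;> simp
      have hmix : ∀ {e f : Z.Edge}, Z.dag.tgt e = .inner u → Z.dag.src f = .inner u →
          Z.dag.src e ≠ .source → Z.dag.tgt f ≠ .sink → lab e = lab f := by
        intro e f he hf hes hft
        obtain ⟨x, hx⟩ := (src_cases e).resolve_left hes
        obtain ⟨y, hy⟩ := (tgt_cases f).resolve_left hft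
        obtain ⟨i, rfl, -, hi⟩ := exists_eq_inl hx he
        obtain ⟨j, rfl, hj, -⟩ := exists_eq_inl hf hy
        rw [h.lab_inl, h.lab_inl, hZ.up_eq (hi.trans hj.symm)]
      rcases hin with rfl | rfl <;> rcases hout with rfl | rfl
      · exact hlong hC.2.1 hpr hs' htt
      · by_cases h1 : Z.dag.src e' = .source
        · exact hlong hD.2.1 hpr' h1 htt
        · by_cases h2 : Z.dag.tgt f = .sink
          · exact hlong hC.2.1 hpr hs' h2
          · exact hdd (by rw [← hd f hfC, ← hd' e' he', hmix heu' hf h1 h2])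
      · by_cases h1 : Z.dag.src e = .source
        · exact hlong hC.2.1 hpr h1 htt
        · by_cases h2 : Z.dag.tgt f' = .sink
          · exact hlong hD.2.1 hpr' hs' h2
          · exact hdd (by rw [← hd e he, ← hd' f' hfD, hmix heu hf' h1 h2])
      · exact hlong hD.2.1 hpr' hs' htt

end IsLabeling
end Zigzag
end GPoly

/-! ### Distance from the corner, and the resolution of conflicts -/

namespace GPoly
namespace Zigzag

variable {Z : Zigzag}

namespace IsLabeling

variable {F : Framing Z.dag} {lab : Z.Edge → Bool} {β : Bool}

theorem row_corner_le (h : IsLabeling F lab β) (hZ : Z.IsLegGraph) {C R : Z.dag.Route} {d : Bool}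
    (hd : HasLabel lab d C) (hC : F.IsCornerOf C R) :
    dirSign d * F.row C ≤ dirSign d * F.row R := by
  obtain ⟨s, q, hs, hs'⟩ := exists_eq_cons hZ R
  obtain ⟨u, hu⟩ := tgt_ne_sink_of_src hs'
  obtain ⟨s₀, q₀, hs₀, hs₀'⟩ := exists_eq_cons hZ C
  obtain ⟨u₀, hu₀⟩ := tgt_ne_sink_of_src hs₀'
  obtain ⟨e, he, heu⟩ := hC.2.2.2 u ⟨s, by rw [hs]; simp, hu⟩
  have hdC := h.hasDir_of_hasLabel hd
  have hdR := h.hasDir_of_isCornerOf hd hC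
  by_cases hes : e = s₀
  · subst hes
    obtain rfl := Vertex.inner.inj (hu₀.symm.trans heu)
    by_cases hl : lab s = d
    · obtain rfl := h.in_eq hZ hu hu₀ (hl.trans (hd e he).symm)
      rw [row_eq hZ hdC hs₀ hu₀, row_eq hZ hdR hs hu]
    · refine (h.row_lt hZ hdR hdC hs hs₀ hu hu₀ (Or.inr ⟨rfl, ?_, hd e he⟩)).le
      revert hl
      cases lab s <;> cases d <;> simp
  · exact (h.row_lt hZ hdR hdC hs hs₀ hu hu₀
      (Or.inl (pos_start_lt hZ hdC hs₀ he hu₀ heu hes))).le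

theorem col_le_corner (h : IsLabeling F lab β) (hZ : Z.IsLegGraph) {C R : Z.dag.Route} {d : Bool}
    (hd : HasLabel lab d C) (hC : F.IsCornerOf C R) :
    dirSign d * F.col R ≤ dirSign d * F.col C := by
  obtain ⟨p, t, ht, ht'⟩ := exists_eq_concat hZ R
  obtain ⟨w, hw⟩ := src_ne_source_of_tgt ht'
  obtain ⟨p₀, t₀, ht₀, ht₀'⟩ := exists_eq_concat hZ C
  obtain ⟨w₀, hw₀⟩ := src_ne_source_of_tgt ht₀'
  obtain ⟨p, x, rfl, hx⟩ := exists_pred hZ ht hw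
  obtain ⟨e, he, hew⟩ := hC.2.2.2 w ⟨x, by rw [ht]; simp, hx⟩
  obtain ⟨r, r', hr⟩ := List.append_of_mem he
  obtain ⟨f, r', rfl, hf⟩ := exists_succ hZ hr hew
  have hfC : f ∈ C.edges := by rw [hr]; simp
  have hdC := h.hasDir_of_hasLabel hd
  by_cases hft : f = t₀
  · subst hft
    obtain rfl := Vertex.inner.inj (hw₀.symm.trans hf)
    by_cases hl : lab t = d
    · obtain rfl := h.out_eq hZ hw hw₀ (hl.trans (hd f hfC).symm)
      rw [col_eq ht, col_eq ht₀]
    · refine (h.col_lt hZ ht ht₀ hw hw₀ (Or.inr ⟨rfl, ?_, hd f hfC⟩)).le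
      revert hl
      cases lab t <;> cases d <;> simp
  · exact (h.col_lt hZ ht ht₀ hw hw₀ (Or.inl (pos_lt_end hZ hdC ht₀ hfC hw₀ hf hft))).le

/-- Relative to the corner, rows and columns are displaced in opposite senses, so the absolute value
is the sum of two nonnegative displacements. -/
theorem diagDist_eq (h : IsLabeling F lab β) (hZ : Z.IsLegGraph) {C R : Z.dag.Route} {d : Bool}
    (hd : HasLabel lab d C) (hC : F.IsCornerOf C R) :
    (F.diagDist C R : ℤ) = (dirSign d * F.row R - dirSign d * F.row C) +
      (dirSign d * F.col C - dirSign d * F.col R) := by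
  have h1 := h.row_corner_le hZ hd hC
  have h2 := h.col_le_corner hZ hd hC
  unfold Framing.diagDist
  rw [Int.natCast_natAbs]
  cases d
  · simp only [dirSign, Bool.false_eq_true, if_false] at *
    rw [abs_of_nonpos] <;> linarith
  · simp only [dirSign, if_true] at *
    rw [abs_of_nonneg] <;> linarith

/-- Replacing the source edge of a route by an initial part that enters with the label of the leg
gives a route nearer to the corner. -/
theorem closer_of_start (h : IsLabeling F lab β) (hZ : Z.IsLegGraph) {C R R' : Z.dag.Route}
    {d : Bool} (hd : HasLabel lab d C) (hC : F.IsCornerOf C R) {p q c : List Z.Edge} {a b : Z.Edge}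
    {v : Fin Z.n} (hR : R.edges = p ++ a :: c) (hR' : R'.edges = q ++ b :: c)
    (ha : Z.dag.tgt a = .inner v) (hb : Z.dag.tgt b = .inner v) (hla : lab a = !d)
    (hlb : lab b = d) : p = [] ∧ F.IsCornerOf C R' ∧ F.diagDist C R' < F.diagDist C R := by
  have hdR := h.hasDir_of_isCornerOf hd hC
  -- An inner edge of R would have the label d.
  have hasrc : Z.dag.src a = .source := by
    refine (src_cases a).resolve_right ?_
    rintro ⟨w, hw⟩
    obtain ⟨j, rfl, -⟩ := exists_eq_inl hw ha
    rw [h.lab_inl, hdR j (by rw [hR]; simp)] at hla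
    cases d <;> cases hla
  obtain rfl := eq_nil_of_source hR hasrc
  obtain ⟨f, c, rfl, hf⟩ := exists_succ hZ hR ha
  obtain ⟨e, he, hev⟩ := hC.2.2.2 v ⟨a, by rw [hR]; simp, ha⟩
  -- The label identifies b as the edge by which the corner route enters v.
  obtain rfl := h.in_eq hZ hb hev (hlb.trans (hd e he).symm)
  have hbR' : b ∈ R'.edges := by rw [hR']; simp
  have hC' : F.IsCornerOf C R' := by
    rcases src_cases b with hbs | ⟨w, hw⟩
    · obtain rfl := eq_nil_of_source hR' hbs
      refine ⟨hC.1, hC.2.1, fun j hj => ?_, ?_⟩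
      · rw [hR'] at hj
        rcases List.mem_cons.1 hj with hj | hj
        · rw [hj]; exact he
        · exact hC.2.2.1 j (by rw [hR]; simp at hj ⊢; tauto)
      · rintro i ⟨x, hx, hxi⟩
        rw [hR'] at hx
        rcases List.mem_cons.1 hx with rfl | hx
        · exact ⟨_, he, hxi⟩
        · exact hC.2.2.2 i ⟨x, by rw [hR]; simp at hx ⊢; tauto, hxi⟩
    · obtain ⟨j, rfl, -⟩ := exists_eq_inl hw hb
      exact h.isCornerOf_of_mem hZ hC.1 he hbR'
  refine ⟨rfl, hC', ?_⟩
  have hdR' := h.hasDir_of_isCornerOf hd hC'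
  obtain ⟨y, t, hy⟩ := (List.eq_nil_or_concat' (f :: c)).resolve_left (by simp)
  have hcol : F.col R = F.col R' := by
    rw [col_eq (R := R) (t := t) (p := a :: y) (by rw [hR, hy]; simp),
      col_eq (R := R') (t := t) (p := q ++ b :: y) (by rw [hR', hy]; simp)]
  have hrow : dirSign d * F.row R' < dirSign d * F.row R := by
    obtain ⟨s', q', hs', hs''⟩ := exists_eq_cons hZ R'
    obtain ⟨u', hu'⟩ := tgt_ne_sink_of_src hs''
    refine h.row_lt hZ hdR hdR' hR hs' ha hu' ?_
    by_cases hbs : b = s'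
    · subst hbs
      exact Or.inr ⟨Vertex.inner.inj (hu'.symm.trans hb), hla, hlb⟩
    · exact Or.inl (pos_start_lt hZ hdR' hs' hbR' hu' hb hbs)
  have h1 := h.diagDist_eq hZ hd hC
  have h2 := h.diagDist_eq hZ hd hC'
  rw [hcol] at h1
  zify
  rw [h1, h2]
  linarith

/-- Mirror image of `closer_of_start`: the row is unchanged, and the column moves towards the
corner. -/
theorem closer_of_end (h : IsLabeling F lab β) (hZ : Z.IsLegGraph) {C R R' : Z.dag.Route}
    {d : Bool} (hd : HasLabel lab d C) (hC : F.IsCornerOf C R) {p q c : List Z.Edge} {a b : Z.Edge}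
    {v : Fin Z.n} (hR : R.edges = c ++ a :: p) (hR' : R'.edges = c ++ b :: q)
    (ha : Z.dag.src a = .inner v) (hb : Z.dag.src b = .inner v) (hla : lab a = !d)
    (hlb : lab b = d) : p = [] ∧ F.IsCornerOf C R' ∧ F.diagDist C R' < F.diagDist C R := by
  have hdR := h.hasDir_of_isCornerOf hd hC
  have hatgt : Z.dag.tgt a = .sink := by
    refine (tgt_cases a).resolve_right ?_
    rintro ⟨w, hw⟩
    obtain ⟨j, rfl, -⟩ := exists_eq_inl ha hw
    rw [h.lab_inl, hdR j (by rw [hR]; simp)] at hla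
    cases d <;> cases hla
  obtain rfl := eq_nil_of_sink hR hatgt
  obtain ⟨c, f, rfl, hf⟩ := exists_pred hZ hR ha
  obtain ⟨e', he', hev'⟩ := hC.2.2.2 v ⟨f, by rw [hR]; simp, hf⟩
  obtain ⟨r, r', hr⟩ := List.append_of_mem he'
  obtain ⟨e, r', rfl, hev⟩ := exists_succ hZ hr hev'
  have he : e ∈ C.edges := by rw [hr]; simp
  obtain rfl := h.out_eq hZ hb hev (hlb.trans (hd e he).symm)
  have hbR' : b ∈ R'.edges := by rw [hR']; simp
  have hC' : F.IsCornerOf C R' := by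
    rcases tgt_cases b with hbs | ⟨w, hw⟩
    · obtain rfl := eq_nil_of_sink hR' hbs
      refine ⟨hC.1, hC.2.1, fun j hj => ?_, ?_⟩
      · rw [hR'] at hj
        rcases List.mem_append.1 hj with hj | hj
        · exact hC.2.2.1 j (by rw [hR]; exact List.mem_append_left _ hj)
        · rw [List.mem_singleton.1 hj]; exact he
      · rintro i ⟨x, hx, hxi⟩
        rw [hR'] at hx
        rcases List.mem_append.1 hx with hx | hx
        · exact hC.2.2.2 i ⟨x, by rw [hR]; exact List.mem_append_left _ hx, hxi⟩
        · obtain rfl := List.mem_singleton.1 hx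
          exact ⟨_, he, hxi⟩
    · obtain ⟨j, rfl, -⟩ := exists_eq_inl hb hw
      exact h.isCornerOf_of_mem hZ hC.1 he hbR'
  refine ⟨rfl, hC', ?_⟩
  have hdR' := h.hasDir_of_isCornerOf hd hC'
  obtain ⟨s, y, hy⟩ : ∃ s y, c ++ [f] = s :: y := by cases c <;> simp
  have hRs : R.edges = s :: (y ++ [a]) := by rw [hR, hy]; simp
  have hRs' : R'.edges = s :: (y ++ b :: q) := by rw [hR', hy]; simp
  have hrow : F.row R = F.row R' := by
    obtain ⟨s₁, q₁, hs₁, hs₁'⟩ := exists_eq_cons hZ R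
    obtain ⟨u₁, hu₁⟩ := tgt_ne_sink_of_src hs₁'
    obtain rfl := (List.cons.inj (hRs.symm.trans hs₁)).1
    rw [row_eq hZ hdR hRs hu₁, row_eq hZ hdR' hRs' hu₁]
  have hcol : dirSign d * F.col R < dirSign d * F.col R' := by
    obtain ⟨p', t', ht', ht''⟩ := exists_eq_concat hZ R'
    obtain ⟨w', hw'⟩ := src_ne_source_of_tgt ht''
    refine h.col_lt hZ hR ht' ha hw' ?_
    by_cases hbt : b = t'
    · subst hbt
      exact Or.inr ⟨Vertex.inner.inj (hw'.symm.trans hb), hla, hlb⟩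
    · exact Or.inl (pos_lt_end hZ hdR' ht' hbR' hw' hb hbt)
  have h1 := h.diagDist_eq hZ hd hC
  have h2 := h.diagDist_eq hZ hd hC'
  rw [hrow] at h1
  zify
  rw [h1, h2]
  linarith

/-- In a diagonal order, a nonexceptional route nearer to its corner precedes a farther one. -/
theorem mem_of_closer {L : List Z.dag.Route} (hL : F.IsDiagonalOrder L) {C D T T' : Z.dag.Route}
    {L₁ L₂ : List Z.dag.Route} (hLT : L = L₁ ++ T :: L₂) (hC : F.IsCornerOf C T)
    (hD : F.IsCornerOf D T') (hlt : F.diagDist D T' < F.diagDist C T) (h1 : C = D ∨ T ≠ T') :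
    F.IsExceptional T' ∨ T' ∈ L₁ := by
  by_cases hT' : F.IsExceptional T'
  · exact Or.inl hT'
  · right
    have hmem := (hL.2.1 T').2 hT'
    rw [hLT] at hmem
    rcases List.mem_append.1 hmem with hmem | hmem
    · exact hmem
    · exfalso
      rcases List.mem_cons.1 hmem with rfl | hmem
      · rcases h1 with rfl | h1
        · exact lt_irrefl _ hlt
        · exact h1 rfl
      · have hp := hL.2.2
        rw [hLT] at hp
        have := (List.pairwise_cons.1 (List.pairwise_append.1 hp).2.1).1 T' hmem C D hC hD
        omega

theorem resolves (h : IsLabeling F lab β) (hZ : Z.IsLegGraph)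
    (hex : ∀ e, ∃ R : Z.dag.Route, F.IsExceptional R ∧ e ∈ R.edges) {L : List Z.dag.Route}
    (hL : F.IsDiagonalOrder L) : IsRootFan.Resolves F.gVector F.Coherent L := by
  have key : ∀ R S, Crosses lab R S → ∃ R' S', F.gVector R + F.gVector S =
      F.gVector R' + F.gVector S' ∧ ∀ T, (T = R ∨ T = S) → ∀ L₁ L₂, L = L₁ ++ T :: L₂ →
        F.gVector R' = 0 ∨ R' ∈ L₁ := by
    rintro R S ⟨p, q, c, p', q', a, b, a', b', v, w, hR, hS, ha, hb, ha', hb', la, lb, la', lb'⟩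
    have hR2 : R.edges = (p ++ a :: c) ++ b' :: p' := by rw [hR]; simp
    have hS2 : S.edges = (q ++ b :: c) ++ a' :: q' := by rw [hS]; simp
    -- T takes the edges labelled `false` at both ends of the common part, U the edges labelled
    -- `true`.
    obtain ⟨T, hT⟩ := exists_splice hZ hR2 hS2 hb' ha'
    obtain ⟨U, hU⟩ := exists_splice hZ hS2 hR2 ha' hb'
    have hT2 : T.edges = p ++ a :: (c ++ a' :: q') := by rw [hT]; simp
    have hU2 : U.edges = q ++ b :: (c ++ b' :: p') := by rw [hU]; simp
    have hadd := h.gVector_add hZ hR2 hS2 hT hU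
    have hadd' := hadd.trans (add_comm _ _)
    obtain ⟨C, hC⟩ := h.exists_isCornerOf hZ hex R
    obtain ⟨D, hD⟩ := h.exists_isCornerOf hZ hex S
    obtain ⟨d, hd⟩ := h.exists_hasLabel hZ hC.1
    obtain ⟨d', hd'⟩ := h.exists_hasLabel hZ hD.1
    have fin : ∀ X Y C₁ C₂ : Z.dag.Route, F.gVector R + F.gVector S = F.gVector X + F.gVector Y →
        F.IsCornerOf C₁ X → F.diagDist C₁ X < F.diagDist C R →
        F.IsCornerOf C₂ X → F.diagDist C₂ X < F.diagDist D S →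
        ∃ R' S', F.gVector R + F.gVector S =
          F.gVector R' + F.gVector S' ∧ ∀ T, (T = R ∨ T = S) → ∀ L₁ L₂, L = L₁ ++ T :: L₂ →
          F.gVector R' = 0 ∨ R' ∈ L₁ := by
      intro X Y C₁ C₂ hXY h1 h2 h3 h4
      refine ⟨X, Y, hXY, ?_⟩
      rintro T (rfl | rfl) L₁ L₂ hLT <;> rw [h.gVector_eq_zero_iff hZ]
      · refine mem_of_closer hL hLT hC h1 h2 (or_iff_not_imp_right.2 fun hne => ?_)
        rw [not_not] at hne
        subst hne
        exact h.corner_unique hZ hC h1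
      · refine mem_of_closer hL hLT hD h3 h4 (or_iff_not_imp_right.2 fun hne => ?_)
        rw [not_not] at hne
        subst hne
        exact h.corner_unique hZ hD h3
    -- On a leg with label d, exchanging the wrongly labelled end produces the route with label d at
    -- both ends of the common part: U for `true`, T for `false`.
    have hRt : d = true → F.IsCornerOf C U ∧ F.diagDist C U < F.diagDist C R := by
      rintro rfl
      exact (h.closer_of_start hZ hd hC hR hU2 ha hb la lb).2
    have hRf : d = false → F.IsCornerOf C T ∧ F.diagDist C T < F.diagDist C R := by
      rintro rfl
      exact (h.closer_of_end hZ hd hC hR2 hT hb' ha' lb' la').2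
    have hSt : d' = true → F.IsCornerOf D U ∧ F.diagDist D U < F.diagDist D S := by
      rintro rfl
      exact (h.closer_of_end hZ hd' hD hS2 hU ha' hb' la' lb').2
    have hSf : d' = false → F.IsCornerOf D T ∧ F.diagDist D T < F.diagDist D S := by
      rintro rfl
      exact (h.closer_of_start hZ hd' hD hS hT2 hb ha lb la).2
    cases d <;> cases d'
    · exact fin T U C D hadd (hRf rfl).1 (hRf rfl).2 (hSf rfl).1 (hSf rfl).2
    -- With different labels, one exchange route is nearer than R and the other is nearer than S.
    -- The one that improves on the smaller of the two distances precedes both R and S.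
    · rcases le_total (F.diagDist C R) (F.diagDist D S) with hle | hle
      · exact fin T U C C hadd (hRf rfl).1 (hRf rfl).2 (hRf rfl).1 ((hRf rfl).2.trans_le hle)
      · exact fin U T D D hadd' (hSt rfl).1 ((hSt rfl).2.trans_le hle) (hSt rfl).1 (hSt rfl).2
    · rcases le_total (F.diagDist C R) (F.diagDist D S) with hle | hle
      · exact fin U T C C hadd' (hRt rfl).1 (hRt rfl).2 (hRt rfl).1 ((hRt rfl).2.trans_le hle)
      · exact fin T U D D hadd (hSf rfl).1 ((hSf rfl).2.trans_le hle) (hSf rfl).1 (hSf rfl).2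
    · exact fin U T C D hadd' (hRt rfl).1 (hRt rfl).2 (hSt rfl).1 (hSt rfl).2
  intro R S hRS
  rw [Framing.Coherent, not_not, h.conflict_iff] at hRS
  rcases hRS with hRS | hRS
  · exact key R S hRS
  · obtain ⟨R', S', h1, h2⟩ := key S R hRS
    exact ⟨R', S', (add_comm _ _).trans h1, fun T hT => h2 T hT.symm⟩

end IsLabeling
end Zigzag
end GPoly

/-! ### Uniqueness of coherent combinations; existence of diagonal orders -/

namespace GPoly
namespace Zigzag

variable {Z : Zigzag}

theorem IsLegGraph.finite_route (hZ : Z.IsLegGraph) : Finite Z.dag.Route := by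
  classical
  refine Finite.of_injective
    (fun R : Z.dag.Route => (⟨R.edges, nodup_route hZ R⟩ : {l : List Z.Edge // l.Nodup})) ?_
  intro R S hRS
  exact Route.ext (Subtype.ext_iff.1 hRS)

theorem IsLegGraph.finite_innerVertex (hZ : Z.IsLegGraph) : Finite Z.dag.InnerVertex :=
  Finite.of_surjective (innerVertex hZ) fun v => by
    obtain ⟨i, rfl⟩ := exists_innerVertex hZ v
    exact ⟨i, rfl⟩

theorem IsLegGraph.nonempty_innerVertex (hZ : Z.IsLegGraph) : Nonempty Z.dag.InnerVertex :=
  ⟨innerVertex hZ (Z.lo ⟨0, hZ.m_pos⟩)⟩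

theorem eq_of_ne_not {x y d : Bool} (h : x = !d) (hxy : x ≠ y) : y = d := by
  revert h hxy
  cases x <;> cases y <;> cases d <;> simp

namespace IsLabeling

variable {F : Framing Z.dag} {lab : Z.Edge → Bool} {β : Bool}

theorem exists_pass_of_ne_zero (h : IsLabeling F lab β) (hZ : Z.IsLegGraph) {R : Z.dag.Route}
    {v : Z.dag.InnerVertex} (hR : F.gVector R v ≠ 0) : ∃ (p q : List Z.Edge) (e f : Z.Edge),
      R.edges = p ++ e :: f :: q ∧ Z.dag.tgt e = v.1 ∧ lab e ≠ lab f ∧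
      F.gVector R v = sign β * (num (lab e) - num (lab f)) := by
  by_cases hpass : ∃ e ∈ R.edges, Z.dag.tgt e = v.1
  · obtain ⟨e, he, hev⟩ := hpass
    obtain ⟨u, hu⟩ := exists_val_eq hZ v
    obtain ⟨p, q, hpq⟩ := List.append_of_mem he
    obtain ⟨f, q, rfl, hf⟩ := exists_succ hZ hpq (hev.trans hu)
    have hg := h.gVector_of_pass hZ hpq hev
    refine ⟨p, q, e, f, hpq, hev, fun hef => hR ?_, hg⟩
    rw [hg, hef, sub_self, mul_zero]
  · push Not at hpass
    exact absurd (gVector_of_not_pass hpass) hR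

theorem sign_mul_self (β : Bool) : sign β * sign β = 1 := by cases β <;> simp [sign]

/-- The g-vectors of coherent routes are sign-coherent. -/
theorem sign_coherent (h : IsLabeling F lab β) (hZ : Z.IsLegGraph) {R S : Z.dag.Route}
    (hRS : F.Coherent R S) (v : Z.dag.InnerVertex) : 0 ≤ F.gVector R v * F.gVector S v := by
  by_contra hneg
  rw [not_le] at hneg
  obtain ⟨p, q, e, f, hR, he, hef, hgR⟩ := h.exists_pass_of_ne_zero hZ (left_ne_zero_of_mul hneg.ne)
  obtain ⟨p', q', e', f', hS, he', hef', hgS⟩ :=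
    h.exists_pass_of_ne_zero hZ (right_ne_zero_of_mul hneg.ne)
  obtain ⟨u, hu⟩ := exists_val_eq hZ v
  obtain ⟨w, hw, hf⟩ := chain_inner hR
  obtain rfl := Vertex.inner.inj (hw.symm.trans (he.trans hu))
  obtain ⟨w', hw', hf'⟩ := chain_inner hS
  obtain rfl := Vertex.inner.inj (hw'.symm.trans (he'.trans hu))
  rw [hgR, hgS, mul_mul_mul_comm, sign_mul_self, one_mul] at hneg
  have hno := (h.coherent_iff R S).1 hRS
  cases hle : lab e <;> cases hlf : lab f <;> cases hle' : lab e' <;> cases hlf' : lab f' <;>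
    simp only [hle, hlf, hle', hlf', num, if_true, if_false, Bool.false_eq_true, ne_eq,
      not_true_eq_false] at hneg hef hef'
  any_goals norm_num at hneg
  · exact hno.1 ⟨p, p', [], q, q', e, e', f', f, w', w', hR, hS, hw, hw', hf', hf, hle, hle', hlf', hlf⟩
  · exact hno.2 ⟨p', p, [], q', q, e', e, f, f', w', w', hS, hR, hw', hw, hf, hf', hle', hle, hlf, hlf'⟩

/-- The sign at v fixes the labels of the edges before and after v, and these labels fix the edges.
-/
theorem pass_of_pos (h : IsLabeling F lab β) (hZ : Z.IsLegGraph) {R S : Z.dag.Route}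
    {v : Z.dag.InnerVertex} (hv : 0 < F.gVector R v * F.gVector S v) {p q : List Z.Edge}
    {e f : Z.Edge} (hR : R.edges = p ++ e :: f :: q) (he : Z.dag.tgt e = v.1) :
    ∃ p' q', S.edges = p' ++ e :: f :: q' := by
  obtain ⟨p', q', e', f', hS, he', hef', hgS⟩ :=
    h.exists_pass_of_ne_zero hZ (right_ne_zero_of_mul hv.ne')
  obtain ⟨u, hu⟩ := exists_val_eq hZ v
  obtain ⟨w, hw, hf⟩ := chain_inner hR
  obtain rfl := Vertex.inner.inj (hw.symm.trans (he.trans hu))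
  obtain ⟨w', hw', hf'⟩ := chain_inner hS
  obtain rfl := Vertex.inner.inj (hw'.symm.trans (he'.trans hu))
  rw [h.gVector_of_pass hZ hR he, hgS, mul_mul_mul_comm, sign_mul_self, one_mul] at hv
  have hlab : lab e = lab e' ∧ lab f = lab f' := by
    revert hv
    cases lab e <;> cases lab f <;> cases lab e' <;> cases lab f' <;> simp [num]
  rw [h.in_eq hZ hw hw' hlab.1, h.out_eq hZ hf hf' hlab.2]
  exact ⟨p', q', hS⟩

/-- In the coordinate v, the sum of (a S - b S) g_R(v) g_S(v) over all S is zero. The term of R is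
positive, and those with a S > b S are nonnegative by sign-coherence, so a term with a S < b S must
be negative. -/
theorem exists_partner (h : IsLabeling F lab β) (hZ : Z.IsLegGraph) [Fintype Z.dag.Route]
    {a b : Z.dag.Route → ℝ} (hb : ∀ R, 0 ≤ b R)
    (hca : ∀ R S, a R ≠ 0 → a S ≠ 0 → F.Coherent R S)
    (hsum : ∑ R, a R • F.gVector R = ∑ R, b R • F.gVector R) {R : Z.dag.Route}
    (hR : b R < a R) {v : Z.dag.InnerVertex} (hv : F.gVector R v ≠ 0) :
    ∃ S, a S < b S ∧ 0 < F.gVector R v * F.gVector S v := by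
  have h0 : ∑ S, (a S - b S) * (F.gVector R v * F.gVector S v) = 0 := by
    have := congrFun hsum v
    simp only [Finset.sum_apply, Pi.smul_apply, smul_eq_mul] at this
    have h1 : ∑ S, (a S - b S) * (F.gVector R v * F.gVector S v) =
        F.gVector R v * (∑ S, a S * F.gVector S v - ∑ S, b S * F.gVector S v) := by
      rw [← Finset.sum_sub_distrib, Finset.mul_sum]
      exact Finset.sum_congr rfl fun S _ => by ring
    rw [h1, this, sub_self, mul_zero]
  by_contra! hno
  refine h0.not_gt (Finset.sum_pos' (fun S _ => ?_) ⟨R, Finset.mem_univ _, ?_⟩)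
  · rcases lt_trichotomy (a S) (b S) with hS | hS | hS
    · exact mul_nonneg_of_nonpos_of_nonpos (by linarith) (hno S hS)
    · rw [hS, sub_self, zero_mul]
    · refine mul_nonneg (by linarith) (h.sign_coherent hZ (hca R S ?_ ?_) v)
      · exact ((hb R).trans_lt hR).ne'
      · exact ((hb S).trans_lt hS).ne'
  · exact mul_pos (by linarith) (mul_self_pos.2 hv)

/-- Trace both routes back from their last two edges to the place where they diverge. The one that
enters there with a label other than d is strictly farther from the corner and starts there. As S is
not farther, this is R. -/
theorem end_partner (h : IsLabeling F lab β) (hZ : Z.IsLegGraph) {C R S : Z.dag.Route} {d : Bool}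
    (hd : HasLabel lab d C) (hC : F.IsCornerOf C R) {p q : List Z.Edge} {e t : Z.Edge}
    (hR : R.edges = p ++ e :: [t]) (hS : S.edges = q ++ e :: [t]) (hne : R ≠ S)
    (hD : F.IsCornerOf C S → F.diagDist C S ≤ F.diagDist C R) :
    ∃ (c q' : List Z.Edge) (a b : Z.Edge) (v : Fin Z.n), R.edges = a :: (c ++ [t]) ∧
      S.edges = q' ++ b :: (c ++ [t]) ∧ Z.dag.tgt a = .inner v ∧ Z.dag.tgt b = .inner v ∧
      lab a = !d ∧ lab b = d := by
  obtain ⟨v, hv, -⟩ := chain_inner hR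
  obtain ⟨p₁, q₁, c, a, b, hab, hp, hq⟩ : ∃ p₁ q₁ c a b, a ≠ b ∧ p = p₁ ++ a :: c ∧
      q = q₁ ++ b :: c := by
    rcases exists_common_suffix p q with ⟨r, hr⟩ | ⟨r, hr⟩ | hr
    · exfalso
      rcases List.eq_nil_or_concat' r with rfl | ⟨r, x, rfl⟩
      · exact hne (Route.ext (by rw [hR, hS, hr]; simp))
      · obtain ⟨s, y, hs, hs'⟩ := exists_eq_cons hZ S
        have h1 : R.edges = r ++ x :: s :: y := by rw [← hs, hS, hR, hr]; simp
        obtain ⟨w, -, hw⟩ := chain_inner h1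
        rw [hs'] at hw
        cases hw
    · exfalso
      rcases List.eq_nil_or_concat' r with rfl | ⟨r, x, rfl⟩
      · exact hne (Route.ext (by rw [hR, hS, hr]; simp))
      · obtain ⟨s, y, hs, hs'⟩ := exists_eq_cons hZ R
        have h1 : S.edges = r ++ x :: s :: y := by rw [← hs, hS, hR, hr]; simp
        obtain ⟨w, -, hw⟩ := chain_inner h1
        rw [hs'] at hw
        cases hw
    · exact hr
  have hR1 : R.edges = p₁ ++ a :: (c ++ e :: [t]) := by rw [hR, hp]; simp
  have hS1 : S.edges = q₁ ++ b :: (c ++ e :: [t]) := by rw [hS, hq]; simp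
  have hR2 : R.edges = p₁ ++ a :: ((c ++ [e]) ++ [t]) := by rw [hR1]; simp
  have hS2 : S.edges = q₁ ++ b :: ((c ++ [e]) ++ [t]) := by rw [hS1]; simp
  obtain ⟨j, rfl⟩ : ∃ j, e = .inl j := by
    rcases src_cases e with hs | ⟨w, hs⟩
    · rw [eq_nil_of_source hR hs] at hp
      exact absurd hp (by simp)
    · obtain ⟨j, rfl, -⟩ := exists_eq_inl hs hv
      exact ⟨j, rfl⟩
  have hjC := hC.2.2.1 j (by rw [hR]; simp)
  have hCS := h.isCornerOf_of_mem hZ (R := S) hC.1 hjC (by rw [hS]; simp)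
  obtain ⟨k, z, hk⟩ : ∃ k z, (c ++ [.inl j]) ++ [t] = k :: z := by cases c <;> simp
  rw [hk] at hR2 hS2
  obtain ⟨w, ha, hka⟩ := chain_inner hR2
  obtain ⟨w', hb, hkb⟩ := chain_inner hS2
  obtain rfl := Vertex.inner.inj (hka.symm.trans hkb)
  have hlne := h.in_ne hZ ha hb hab
  by_cases hla : lab a = !d
  · have hlb := eq_of_ne_not hla hlne
    obtain ⟨rfl, -⟩ := h.closer_of_start hZ hd hC hR2 hS2 ha hb hla hlb
    exact ⟨c ++ [.inl j], q₁, a, b, w, by rw [hR2, hk]; rfl, by rw [hS2, hk], ha, hb, hla, hlb⟩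
  · exfalso
    have hla' : lab a = d := by
      revert hla
      cases lab a <;> cases d <;> simp
    have hlb : lab b = !d := by
      revert hlne
      rw [hla']
      cases lab b <;> cases d <;> simp
    exact (h.closer_of_start hZ hd hCS hS2 hR2 hb ha hlb hla').2.2.not_ge (hD hCS)

/-- Mirror image of `end_partner`, tracing forward from the first two edges. -/
theorem start_partner (h : IsLabeling F lab β) (hZ : Z.IsLegGraph) {C R S : Z.dag.Route}
    {d : Bool} (hd : HasLabel lab d C) (hC : F.IsCornerOf C R) {p q : List Z.Edge} {s e : Z.Edge}
    (hR : R.edges = s :: e :: p) (hS : S.edges = s :: e :: q) (hne : R ≠ S)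
    (hD : F.IsCornerOf C S → F.diagDist C S ≤ F.diagDist C R) :
    ∃ (c q' : List Z.Edge) (a b : Z.Edge) (v : Fin Z.n), R.edges = s :: c ++ [a] ∧
      S.edges = s :: c ++ b :: q' ∧ Z.dag.src a = .inner v ∧ Z.dag.src b = .inner v ∧
      lab a = !d ∧ lab b = d := by
  obtain ⟨v, -, hv⟩ := chain_inner (p := []) hR
  obtain ⟨c, p₁, q₁, a, b, hab, hp, hq⟩ : ∃ c p₁ q₁ a b, a ≠ b ∧ p = c ++ a :: p₁ ∧
      q = c ++ b :: q₁ := by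
    rcases exists_common_prefix p q with ⟨r, hr⟩ | ⟨r, hr⟩ | hr
    · exfalso
      cases r with
      | nil => exact hne (Route.ext (by rw [hR, hS, hr]; simp))
      | cons x r =>
        obtain ⟨y, t, ht, ht'⟩ := exists_eq_concat hZ S
        have h1 : R.edges = y ++ t :: x :: r := by
          rw [List.append_cons, ← ht, hS, hR, hr]; simp
        obtain ⟨w, hw, -⟩ := chain_inner h1
        rw [ht'] at hw
        cases hw
    · exfalso
      cases r with
      | nil => exact hne (Route.ext (by rw [hR, hS, hr]; simp))
      | cons x r =>
        obtain ⟨y, t, ht, ht'⟩ := exists_eq_concat hZ R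
        have h1 : S.edges = y ++ t :: x :: r := by
          rw [List.append_cons, ← ht, hS, hR, hr]; simp
        obtain ⟨w, hw, -⟩ := chain_inner h1
        rw [ht'] at hw
        cases hw
    · exact hr
  have hR2 : R.edges = (s :: e :: c) ++ a :: p₁ := by rw [hR, hp]; simp
  have hS2 : S.edges = (s :: e :: c) ++ b :: q₁ := by rw [hS, hq]; simp
  obtain ⟨j, rfl⟩ : ∃ j, e = .inl j := by
    rcases tgt_cases e with ht | ⟨w, ht⟩
    · have hR3 : R.edges = [s] ++ e :: p := hR
      rw [eq_nil_of_sink hR3 ht] at hp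
      exact absurd hp (by simp)
    · obtain ⟨j, rfl, -⟩ := exists_eq_inl hv ht
      exact ⟨j, rfl⟩
  have hjC := hC.2.2.1 j (by rw [hR]; simp)
  have hCS := h.isCornerOf_of_mem hZ (R := S) hC.1 hjC (by rw [hS]; simp)
  obtain ⟨z, k, hk⟩ := (List.eq_nil_or_concat' (s :: .inl j :: c)).resolve_left (by simp)
  have hR3 : R.edges = z ++ k :: a :: p₁ := by rw [hR2, hk]; simp
  have hS3 : S.edges = z ++ k :: b :: q₁ := by rw [hS2, hk]; simp
  obtain ⟨w, hka, ha⟩ := chain_inner hR3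
  obtain ⟨w', hkb, hb⟩ := chain_inner hS3
  obtain rfl := Vertex.inner.inj (hka.symm.trans hkb)
  have hlne := h.out_ne hZ ha hb hab
  by_cases hla : lab a = !d
  · have hlb := eq_of_ne_not hla hlne
    obtain ⟨rfl, -⟩ := h.closer_of_end hZ hd hC hR2 hS2 ha hb hla hlb
    exact ⟨.inl j :: c, q₁, a, b, w, hR2, hS2, ha, hb, hla, hlb⟩
  · exfalso
    have hla' : lab a = d := by
      revert hla
      cases lab a <;> cases d <;> simp
    have hlb : lab b = !d := by
      revert hlne
      rw [hla']
      cases lab b <;> cases d <;> simp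
    exact (h.closer_of_end hZ hd hCS hS2 hR2 hb ha hlb hla').2.2.not_ge (hD hCS)

/-- The last two edges of a nonexceptional route that ends off the label of its leg. -/
theorem exists_end (h : IsLabeling F lab β) (hZ : Z.IsLegGraph) {R : Z.dag.Route} {d : Bool}
    (hd : HasDir d R.edges) (hR : ¬ F.IsExceptional R) {p : List Z.Edge} {t : Z.Edge}
    (ht : R.edges = p ++ [t]) (hlt : lab t = !d) (htt : Z.dag.tgt t = .sink) :
    ∃ p' e, p = p' ++ [e] ∧ lab e = d := by
  obtain ⟨w, hw⟩ := src_ne_source_of_tgt htt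
  obtain ⟨p, e, rfl, he⟩ := exists_pred hZ ht hw
  refine ⟨p, e, rfl, ?_⟩
  rw [List.append_assoc, List.singleton_append] at ht
  rcases src_cases e with hs | ⟨u, hs⟩
  · obtain rfl := eq_nil_of_source ht hs
    refine eq_of_ne_not hlt fun hte => hR (h.isExceptional_of_const ?_)
    rw [ht]
    simp [hte]
  · obtain ⟨j, rfl, -⟩ := exists_eq_inl hs he
    rw [h.lab_inl, hd j (by rw [ht]; simp)]

theorem exists_start (h : IsLabeling F lab β) (hZ : Z.IsLegGraph) {R : Z.dag.Route} {d : Bool}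
    (hd : HasDir d R.edges) (hR : ¬ F.IsExceptional R) {q : List Z.Edge} {s : Z.Edge}
    (hs : R.edges = s :: q) (hls : lab s = !d) (hss : Z.dag.src s = .source) :
    ∃ e q', q = e :: q' ∧ lab e = d := by
  obtain ⟨w, hw⟩ := tgt_ne_sink_of_src hss
  obtain ⟨e, q, rfl, he⟩ := exists_succ (p := []) hZ hs hw
  refine ⟨e, q, rfl, ?_⟩
  rcases tgt_cases e with ht | ⟨u, ht⟩
  · have hs' : R.edges = [s] ++ e :: q := hs
    obtain rfl := eq_nil_of_sink hs' ht
    refine eq_of_ne_not hls fun hte => hR (h.isExceptional_of_const ?_)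
    rw [hs]
    simp [hte]
  · obtain ⟨j, rfl, -⟩ := exists_eq_inl he ht
    rw [h.lab_inl, hd j (by rw [hs]; simp)]

/-- If the last edge of R has the wrong label, comparing the coordinate at the last vertex gives a
partner S in the support of b; since R is farthest, `end_partner` applies and shows that the first
edge of R has the wrong label too. The same holds with start and end interchanged. As g(R) is
nonzero, both labels are wrong, and the two partners cross along the inner part of R, against the
coherence of b. -/
theorem not_lt_of_farthest (h : IsLabeling F lab β) (hZ : Z.IsLegGraph)
    (hex : ∀ e, ∃ R : Z.dag.Route, F.IsExceptional R ∧ e ∈ R.edges) [Fintype Z.dag.Route]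
    {a b : Z.dag.Route → ℝ} (ha : ∀ R, 0 ≤ a R) (hb : ∀ R, 0 ≤ b R)
    (hca : ∀ R S, a R ≠ 0 → a S ≠ 0 → F.Coherent R S)
    (hcb : ∀ R S, b R ≠ 0 → b S ≠ 0 → F.Coherent R S)
    (hsum : ∑ R, a R • F.gVector R = ∑ R, b R • F.gVector R) {R : Z.dag.Route}
    (hRne : ¬ F.IsExceptional R)
    (hmax : ∀ S, ¬ F.IsExceptional S → a S ≠ b S → ∀ C D, F.IsCornerOf C R → F.IsCornerOf D S →
      F.diagDist D S ≤ F.diagDist C R) : ¬ b R < a R := by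
  intro hR
  obtain ⟨C, hC⟩ := h.exists_isCornerOf hZ hex R
  obtain ⟨d, hd⟩ := h.exists_hasLabel hZ hC.1
  have hdR := h.hasDir_of_isCornerOf hd hC
  obtain ⟨s, q, hs, hs'⟩ := exists_eq_cons hZ R
  obtain ⟨p, t, ht, ht'⟩ := exists_eq_concat hZ R
  obtain ⟨u, hu⟩ := tgt_ne_sink_of_src hs'
  obtain ⟨w, hw⟩ := src_ne_source_of_tgt ht'
  have hfar : ∀ {S : Z.dag.Route} {v : Z.dag.InnerVertex}, a S < b S →
      0 < F.gVector R v * F.gVector S v →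
      R ≠ S ∧ (F.IsCornerOf C S → F.diagDist C S ≤ F.diagDist C R) := by
    intro S v hS hv
    refine ⟨fun hRS => ?_, fun hCS => hmax S ?_ hS.ne C C hC hCS⟩
    · subst hRS; exact lt_asymm hS hR
    · rw [← h.gVector_eq_zero_iff hZ]
      intro h0
      rw [h0, Pi.zero_apply, mul_zero] at hv
      exact lt_irrefl _ hv
  have hE : lab t = !d → ∃ (S : Z.dag.Route) (c q' : List Z.Edge) (x y : Z.Edge) (v : Fin Z.n),
      a S < b S ∧ R.edges = x :: (c ++ [t]) ∧ S.edges = q' ++ y :: (c ++ [t]) ∧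
      Z.dag.tgt x = .inner v ∧ Z.dag.tgt y = .inner v ∧ lab x = !d ∧ lab y = d := by
    intro hlt
    obtain ⟨p, e, rfl, hle⟩ := h.exists_end hZ hdR hRne ht hlt ht'
    have hRe : R.edges = p ++ e :: [t] := by rw [ht]; simp
    obtain ⟨w', he, hw'⟩ := chain_inner hRe
    obtain rfl := Vertex.inner.inj (hw.symm.trans hw')
    have hg := h.gVector_of_pass hZ hRe (v := innerVertex hZ w) he
    obtain ⟨S, hS, hpos⟩ := h.exists_partner hZ hb hca hsum hR (v := innerVertex hZ w) (by
      rw [hg, hle, hlt]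
      cases d <;> simp [num, sign_ne_zero])
    obtain ⟨p', q', hSe⟩ := h.pass_of_pos hZ hpos hRe he
    have hSe' : S.edges = (p' ++ [e]) ++ t :: q' := by rw [hSe]; simp
    obtain rfl := eq_nil_of_sink hSe' ht'
    obtain ⟨c, q', x, y, v, h1, h2, h3⟩ := h.end_partner hZ hd hC hRe hSe (hfar hS hpos).1
      (hfar hS hpos).2
    exact ⟨S, c, q', x, y, v, hS, h1, h2, h3⟩
  have hB : lab s = !d → ∃ (S : Z.dag.Route) (c q' : List Z.Edge) (x y : Z.Edge) (v : Fin Z.n),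
      a S < b S ∧ R.edges = s :: c ++ [x] ∧ S.edges = s :: c ++ y :: q' ∧
      Z.dag.src x = .inner v ∧ Z.dag.src y = .inner v ∧ lab x = !d ∧ lab y = d := by
    intro hls
    obtain ⟨e, q, rfl, hle⟩ := h.exists_start hZ hdR hRne hs hls hs'
    have hg := h.gVector_of_pass (p := []) hZ hs (v := innerVertex hZ u) hu
    obtain ⟨S, hS, hpos⟩ := h.exists_partner hZ hb hca hsum hR (v := innerVertex hZ u) (by
      rw [hg, hle, hls]
      cases d <;> simp [num, sign_ne_zero])
    obtain ⟨p', q', hSe⟩ := h.pass_of_pos (p := []) hZ hpos hs hu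
    obtain rfl := eq_nil_of_source hSe hs'
    obtain ⟨c, q', x, y, v, h1, h2, h3⟩ := h.start_partner hZ hd hC hs hSe (hfar hS hpos).1
      (hfar hS hpos).2
    exact ⟨S, c, q', x, y, v, hS, h1, h2, h3⟩
  have hlabE : lab t = !d → lab s = !d := by
    intro hlt
    obtain ⟨S, c, q', x, y, v, -, h1, -, -, -, h2, -⟩ := hE hlt
    rw [hs] at h1
    rw [(List.cons.inj h1).1, h2]
  have hlabB : lab s = !d → lab t = !d := by
    intro hlt
    obtain ⟨S, c, q', x, y, v, -, h1, -, -, -, h2, -⟩ := hB hlt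
    rw [ht] at h1
    rw [(List.cons.inj (List.append_inj' h1 rfl).2).1, h2]
  have hls : lab s = !d := by
    by_contra hls
    have hls' : lab s = d := by
      revert hls
      cases lab s <;> cases d <;> simp
    have hlt' : lab t = d := by
      have := mt hlabE hls
      revert this
      cases lab t <;> cases d <;> simp
    refine hRne ((h.gVector_eq_zero_iff hZ R).1 ?_)
    rw [h.gVector_eq hZ hdR hs ht (u := innerVertex hZ u) (w := innerVertex hZ w) hu hw, hls', hlt']
    simp
  have hlt := hlabB hls
  obtain ⟨S, c, q₁, x, y, v, hS, h1, h2, hx, hy, hlx, hly⟩ := hE hlt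
  obtain ⟨S', c', q₁', x', y', v', hS', h1', h2', hx', hy', hlx', hly'⟩ := hB hls
  have h3 : s = x ∧ c = c' ∧ t = x' := by
    obtain ⟨rfl, h4⟩ := List.cons.inj (hs.symm.trans h1)
    have h5 : s :: (c ++ [t]) = s :: (c' ++ [x']) := h1.symm.trans h1'
    have h6 := List.append_inj' (List.cons.inj h5).2 rfl
    exact ⟨rfl, h6.1, (List.cons.inj h6.2).1⟩
  obtain ⟨rfl, rfl, rfl⟩ := h3
  -- Both partners contain the part c of R. S enters it with label d and leaves with the other
  -- label, S' does the opposite.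
  have hcoh := (h.coherent_iff S S').1 (hcb S S' ((ha S).trans_lt hS).ne' ((ha S').trans_lt hS').ne')
  have h2'' : S'.edges = [] ++ s :: (c ++ y' :: q₁') := h2'
  cases d
  · exact hcoh.1 ⟨_, _, _, _, _, _, _, _, _, _, _, h2, h2'', hy, hx, hy', hx', hly, hlx, hly', hlx'⟩
  · exact hcoh.2 ⟨_, _, _, _, _, _, _, _, _, _, _, h2'', h2, hx, hy, hx', hy', hlx, hly, hlx', hly'⟩

open Classical in
theorem isRootFan (h : IsLabeling F lab β) (hZ : Z.IsLegGraph)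
    (hex : ∀ e, ∃ R : Z.dag.Route, F.IsExceptional R ∧ e ∈ R.edges) [Fintype Z.dag.Route]
    [Fintype Z.dag.InnerVertex] : IsRootFan F.gVector F.Coherent where
  symm _ _ := h.coherent_symm
  refl := h.coherent_refl hZ
  eq_zero_iff := h.gVector_eq_zero_iff hZ
  exists_zero := by
    obtain ⟨R, hR, -⟩ := hex (.inl ⟨0, hZ.m_pos⟩)
    exact ⟨R, (h.gVector_eq_zero_iff hZ R).2 hR⟩
  unique := by
    intro a b ha hb hca hcb hsum R hR
    by_contra hne
    choose cor hcor using h.exists_isCornerOf hZ hex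
    -- Among the nonexceptional routes with different coefficients, take one farthest from its
    -- corner.
    obtain ⟨S, hS, hmax⟩ := Finset.exists_max_image
      (Finset.univ.filter fun S => ¬ F.IsExceptional S ∧ a S ≠ b S)
      (fun S => F.diagDist (cor S) S)
      ⟨R, by simpa [← h.gVector_eq_zero_iff hZ] using ⟨hR, hne⟩⟩
    simp only [Finset.mem_filter, Finset.mem_univ, true_and] at hS hmax
    have hmax' : ∀ T, ¬ F.IsExceptional T → a T ≠ b T → ∀ C D, F.IsCornerOf C S →
        F.IsCornerOf D T → F.diagDist D T ≤ F.diagDist C S := by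
      intro T hT hT' C D hC hD
      rw [h.corner_unique hZ hC (hcor S), h.corner_unique hZ hD (hcor T)]
      exact hmax T ⟨hT, hT'⟩
    rcases lt_or_gt_of_ne hS.2 with hlt | hlt
    · exact h.not_lt_of_farthest hZ hex hb ha hcb hca hsum.symm hS.1
        (fun T hT hT' => hmax' T hT hT'.symm) hlt
    · exact h.not_lt_of_farthest hZ hex ha hb hca hcb hsum hS.1 hmax' hlt
  form := h.gVector_form hZ
  span := h.span_gVector hZ hex

theorem eq_of_row_eq_of_col_eq (h : IsLabeling F lab β) (hZ : Z.IsLegGraph) {R S : Z.dag.Route}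
    {d : Bool} (hR : HasDir d R.edges) (hS : HasDir d S.edges) (hrow : F.row R = F.row S)
    (hcol : F.col R = F.col S) : R = S := by
  obtain ⟨s, q, hs, hs'⟩ := exists_eq_cons hZ R
  obtain ⟨u, hu⟩ := tgt_ne_sink_of_src hs'
  obtain ⟨p, t, ht, ht'⟩ := exists_eq_concat hZ R
  obtain ⟨w, hw⟩ := src_ne_source_of_tgt ht'
  obtain ⟨s₁, q₁, hs₁, hs₁'⟩ := exists_eq_cons hZ S
  obtain ⟨u₁, hu₁⟩ := tgt_ne_sink_of_src hs₁'
  obtain ⟨p₁, t₁, ht₁, ht₁'⟩ := exists_eq_concat hZ S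
  obtain ⟨w₁, hw₁⟩ := src_ne_source_of_tgt ht₁'
  have hposinj : ∀ x y, Z.pos d x = Z.pos d y → x = y := by
    intro x y hxy
    have := x.2
    have := y.2
    refine Fin.ext ?_
    unfold pos at hxy
    cases d
    · simp only [Bool.false_eq_true, if_false] at hxy
      split_ifs at hxy <;> omega
    · simpa using hxy
  have hlabs : ∀ x y : Bool, x ≠ y → x = (!d) ∧ y = d ∨ y = (!d) ∧ x = d := by
    intro x y
    cases x <;> cases y <;> cases d <;> simp
  have h1 : s = s₁ := by
    by_contra hne
    have hlt : dirSign d * F.row R ≠ dirSign d * F.row S → False := by rw [hrow]; simp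
    rcases lt_trichotomy (Z.pos d u) (Z.pos d u₁) with hlt' | heq | hlt'
    · exact hlt (h.row_lt hZ hS hR hs₁ hs hu₁ hu (Or.inl hlt')).ne
    · obtain rfl := hposinj _ _ heq
      rcases hlabs _ _ (h.in_ne hZ hu hu₁ hne) with hl | hl
      · exact hlt (h.row_lt hZ hR hS hs hs₁ hu hu₁ (Or.inr ⟨rfl, hl⟩)).ne'
      · exact hlt (h.row_lt hZ hS hR hs₁ hs hu₁ hu (Or.inr ⟨rfl, hl⟩)).ne
    · exact hlt (h.row_lt hZ hR hS hs hs₁ hu hu₁ (Or.inl hlt')).ne'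
  have h2 : t = t₁ := by
    by_contra hne
    have hlt : dirSign d * F.col R ≠ dirSign d * F.col S → False := by rw [hcol]; simp
    rcases lt_trichotomy (Z.pos d w) (Z.pos d w₁) with hlt' | heq | hlt'
    · exact hlt (h.col_lt hZ ht ht₁ hw hw₁ (Or.inl hlt')).ne
    · obtain rfl := hposinj _ _ heq
      rcases hlabs _ _ (h.out_ne hZ hw hw₁ hne) with hl | hl
      · exact hlt (h.col_lt hZ ht ht₁ hw hw₁ (Or.inr ⟨rfl, hl⟩)).ne
      · exact hlt (h.col_lt hZ ht₁ ht hw₁ hw (Or.inr ⟨rfl, hl⟩)).ne'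
    · exact hlt (h.col_lt hZ ht₁ ht hw₁ hw (Or.inl hlt')).ne'
  subst h1 h2
  exact route_eq hZ hR hS hs hs₁ ht ht₁ ht'

theorem exists_isDiagonalOrder (h : IsLabeling F lab β) (hZ : Z.IsLegGraph)
    (hex : ∀ e, ∃ R : Z.dag.Route, F.IsExceptional R ∧ e ∈ R.edges) :
    ∃ L : List Z.dag.Route, F.IsDiagonalOrder L := by
  classical
  have := hZ.finite_route
  have := Fintype.ofFinite Z.dag.Route
  choose cor hcor using h.exists_isCornerOf hZ hex
  -- Sort by distance, then by row. Distinct routes with the same corner have different keys: by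
  -- `diagDist_eq`, distance and row determine the column.
  let key : Z.dag.Route → ℕ ×ₗ ℕ := fun R => toLex (F.diagDist (cor R) R, F.row R)
  let r : Z.dag.Route → Z.dag.Route → Prop := fun R S => key R ≤ key S
  have : Std.Total r := ⟨fun R S => le_total _ _⟩
  have : IsTrans Z.dag.Route r := ⟨fun R S T h1 h2 => le_trans h1 h2⟩
  let L₀ := (Finset.univ.filter fun R => ¬ F.IsExceptional R).toList
  have hperm := List.perm_insertionSort r L₀
  have hnd : (L₀.insertionSort r).Nodup := hperm.nodup_iff.2 (Finset.nodup_toList _)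
  refine ⟨L₀.insertionSort r, hnd, fun R => ?_, ?_⟩
  · rw [hperm.mem_iff]
    simp [L₀]
  · refine ((List.pairwise_insertionSort r L₀).and hnd).imp ?_
    rintro R S ⟨hRS, hne⟩ C D hC hD
    have hCR := h.corner_unique hZ hC (hcor R)
    have hDS := h.corner_unique hZ hD (hcor S)
    rcases Prod.Lex.toLex_le_toLex.1 hRS with hlt | ⟨heq, hle⟩
    · left
      rw [hCR, hDS]
      exact hlt
    · right
      simp only at heq hle
      rw [← hCR, ← hDS] at heq
      refine ⟨heq, fun hCD => lt_of_le_of_ne hle fun hrow => hne ?_⟩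
      subst hCD
      obtain ⟨d, hd⟩ := h.exists_hasLabel hZ hC.1
      have h1 := h.diagDist_eq hZ hd hC
      have h2 := h.diagDist_eq hZ hd hD
      rw [heq, h2, hrow] at h1
      refine h.eq_of_row_eq_of_col_eq hZ (h.hasDir_of_isCornerOf hd hC)
        (h.hasDir_of_isCornerOf hd hD) hrow ?_
      cases d <;> simp only [dirSign, if_true, if_false, Bool.false_eq_true] at h1 <;> omega

end IsLabeling
end Zigzag
end GPoly

/-! ### From ample, locally anti-blocking framings to labellings -/

namespace GPoly

/-- A proper face of a polyhedron that contains the origin lies in a facet. -/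
theorem IsExposed.exists_isFacet {W : Type*} [AddCommGroup W] [Module ℝ W] [TopologicalSpace W]
    [FiniteDimensional ℝ W] {K Φ : Set W} (hΦ : IsExposed ℝ K Φ) (h0 : 0 ∈ Φ) (hne : Φ ≠ K) :
    ∃ Ψ, IsFacet K Ψ ∧ Φ ⊆ Ψ := by
  -- An exposing functional of a face through the origin vanishes on the face, so the face contains
  -- all points of K in its linear span. A face with maximal span is therefore a maximal face, and
  -- maximal spans exist in finite dimension.
  have hker : ∀ Ψ, IsExposed ℝ K Ψ → 0 ∈ Ψ → K ∩ Submodule.span ℝ Ψ ⊆ Ψ := by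
    intro Ψ hΨ h0 x hx
    obtain ⟨l, rfl⟩ := hΨ ⟨0, h0⟩
    have hl : Submodule.span ℝ {x | x ∈ K ∧ ∀ y ∈ K, l y ≤ l x} ≤ LinearMap.ker l.toLinearMap := by
      rw [Submodule.span_le]
      rintro z ⟨hz, hzmax⟩
      have h1 := h0.2 z hz
      have h2 := hzmax 0 h0.1
      rw [map_zero] at h1 h2
      exact le_antisymm h1 h2
    have hlx : l x = 0 := hl hx.2
    refine ⟨hx.1, fun y hy => ?_⟩
    rw [hlx, ← map_zero l]
    exact h0.2 y hy
  let 𝒮 : Set (Submodule ℝ W) :=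
    {V | ∃ Ψ, IsExposed ℝ K Ψ ∧ Ψ ≠ K ∧ Φ ⊆ Ψ ∧ V = Submodule.span ℝ Ψ}
  obtain ⟨V, ⟨Ψ, hΨ, hΨne, hΦΨ, rfl⟩, hmax⟩ :=
    (wellFounded_gt (α := Submodule ℝ W)).has_min 𝒮 ⟨_, Φ, hΦ, hne, subset_rfl, rfl⟩
  refine ⟨Ψ, ⟨hΨ, hΨne, fun Ψ' hΨ' hne' hsub => subset_antisymm ?_ hsub⟩, hΦΨ⟩
  have heq : Submodule.span ℝ Ψ' = Submodule.span ℝ Ψ := by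
    by_contra hneq
    exact hmax _ ⟨Ψ', hΨ', hne', hΦΨ.trans hsub, rfl⟩
      (lt_of_le_of_ne (Submodule.span_mono hsub) (Ne.symm hneq))
  intro x hx
  refine hker Ψ hΨ (hΦΨ h0) ⟨hΨ'.subset hx, ?_⟩
  rw [SetLike.mem_coe, ← heq]
  exact Submodule.subset_span hx

namespace Zigzag

variable {Z : Zigzag}

open Classical in
theorem indicator_mem_flowCone (hZ : Z.IsLegGraph) (R : Z.dag.Route) :
    R.indicator ∈ Z.dag.flowCone := by
  refine ⟨fun e => ?_, fun v => ?_⟩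
  · unfold MultiDigraph.Route.indicator
    split_ifs <;> norm_num
  · obtain ⟨u, hu⟩ := exists_val_eq hZ v
    unfold MultiDigraph.Route.indicator
    by_cases hpass : ∃ e ∈ R.edges, Z.dag.tgt e = v.1
    · obtain ⟨e, he, hev⟩ := hpass
      obtain ⟨p, q, hpq⟩ := List.append_of_mem he
      obtain ⟨f, q, rfl, hf⟩ := exists_succ hZ hpq (hev.trans hu)
      have hfR : f ∈ R.edges := by rw [hpq]; simp
      have hfv : Z.dag.src f = v.1 := hf.trans hu.symm
      rw [Finset.sum_eq_single_of_mem e (by simp [hev]), Finset.sum_eq_single_of_mem f (by simp [hfv]),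
        if_pos he, if_pos hfR]
      · intro x hx hxf
        refine if_neg fun hxR => hxf (eq_of_src_eq hZ hxR hfR ?_)
        rw [(Finset.mem_filter.1 hx).2, hfv]
      · intro x hx hxe
        refine if_neg fun hxR => hxe (eq_of_tgt_eq hZ hxR he ?_)
        rw [(Finset.mem_filter.1 hx).2, hev]
    · push Not at hpass
      rw [Finset.sum_eq_zero, Finset.sum_eq_zero]
      · intro x hx
        refine if_neg fun hxR => ?_
        obtain ⟨p, q, hpq⟩ := List.append_of_mem hxR
        obtain ⟨p, y, rfl, hy⟩ := exists_pred hZ hpq ((Finset.mem_filter.1 hx).2.trans hu)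
        exact hpass y (by rw [hpq]; simp) (hy.trans hu.symm)
      · intro x hx
        exact if_neg fun hxR => hpass x hxR (Finset.mem_filter.1 hx).2

/-- For an ample framing every edge lies on an exceptional route. -/
theorem exists_exceptional_of_isAmple (hZ : Z.IsLegGraph) {F : Framing Z.dag} (hF : F.IsAmple)
    (e : Z.Edge) : ∃ R : Z.dag.Route, F.IsExceptional R ∧ e ∈ R.edges := by
  classical
  -- The flows that vanish at e form a face. An exceptional route outside a facet that contains this
  -- face must use e.
  let Φ : Set (Z.Edge → ℝ) := {f | f ∈ Z.dag.flowCone ∧ f e = 0}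
  have h0 : (0 : Z.Edge → ℝ) ∈ Φ := by
    refine ⟨⟨fun e => le_rfl, fun v => ?_⟩, rfl⟩
    simp
  have hexp : IsExposed ℝ Z.dag.flowCone Φ := by
    intro _
    refine ⟨-ContinuousLinearMap.proj e, Set.ext fun f => and_congr_right fun hf => ?_⟩
    constructor
    · intro hfe y hy
      simpa [hfe] using hy.1 e
    · intro hmax
      have := hmax 0 h0.1
      simp only [neg_apply, ContinuousLinearMap.proj_apply, Pi.zero_apply,
        neg_zero, Left.nonneg_neg_iff] at this
      exact le_antisymm this (hf.1 e)
  -- The constant 1 is a flow, because indegree and outdegree are 2 at each inner vertex.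
  have hne : Φ ≠ Z.dag.flowCone := by
    intro heq
    have hone : (1 : Z.Edge → ℝ) ∈ Φ := by
      rw [heq]
      refine ⟨fun e => zero_le_one, fun v => ?_⟩
      obtain ⟨u, hu⟩ := exists_val_eq hZ v
      have h1 := hZ.card_tgt u
      have h2 := hZ.card_src u
      simp only [Pi.one_apply, Finset.sum_const, nsmul_eq_mul, mul_one, hu, Nat.cast_inj]
      convert h1.trans h2.symm using 1
    exact one_ne_zero hone.2
  obtain ⟨Ψ, hΨ, hsub⟩ := IsExposed.exists_isFacet hexp h0 hne
  have := hF Ψ hΨ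
  push Not at this
  obtain ⟨R, hR, hRΨ⟩ := this
  refine ⟨R, hR, ?_⟩
  by_contra heR
  exact hRΨ (hsub ⟨indicator_mem_flowCone hZ R, if_neg heR⟩)

section Ample

variable {F : Framing Z.dag}

theorem inLT_asymm {a b : Z.Edge} (h : F.inLT a b) (h' : F.inLT b a) : False := by
  obtain ⟨v, ha, hb, hab⟩ := h
  obtain ⟨w, hb', ha', hba⟩ := h'
  obtain rfl : v = w := Subtype.ext (ha.symm.trans ha')
  exact @lt_asymm _ (F.inOrder v).toPreorder _ _ hab hba

theorem outLT_asymm {a b : Z.Edge} (h : F.outLT a b) (h' : F.outLT b a) : False := by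
  obtain ⟨v, ha, hb, hab⟩ := h
  obtain ⟨w, hb', ha', hba⟩ := h'
  obtain rfl : v = w := Subtype.ext (ha.symm.trans ha')
  exact @lt_asymm _ (F.outOrder v).toPreorder _ _ hab hba

theorem inLT_tgt (hZ : Z.IsLegGraph) {a b : Z.Edge} (h : F.inLT a b) :
    ∃ v, Z.dag.tgt a = .inner v ∧ Z.dag.tgt b = .inner v := by
  obtain ⟨v, ha, hb, -⟩ := h
  obtain ⟨u, hu⟩ := exists_val_eq hZ v
  exact ⟨u, ha.trans hu, hb.trans hu⟩

theorem outLT_src (hZ : Z.IsLegGraph) {a b : Z.Edge} (h : F.outLT a b) :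
    ∃ v, Z.dag.src a = .inner v ∧ Z.dag.src b = .inner v := by
  obtain ⟨v, ha, hb, -⟩ := h
  obtain ⟨u, hu⟩ := exists_val_eq hZ v
  exact ⟨u, ha.trans hu, hb.trans hu⟩

/-- One of two edges entering an inner vertex is labelled `1` and the other is labelled `2`. -/
theorem inLT_iff_inTwo (hZ : Z.IsLegGraph) (a b : Z.Edge) : F.inLT a b ↔
    ∃ v, Z.dag.tgt a = .inner v ∧ Z.dag.tgt b = .inner v ∧ ¬ F.InTwo a ∧ F.InTwo b := by
  constructor
  · intro h
    obtain ⟨v, ha, hb⟩ := inLT_tgt hZ h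
    refine ⟨v, ha, hb, ?_, a, h⟩
    rintro ⟨c, hc⟩
    obtain ⟨w, hc', ha'⟩ := inLT_tgt hZ hc
    obtain rfl := Vertex.inner.inj (ha.symm.trans ha')
    obtain ⟨x, y, -, -, -, hxy⟩ := hZ.exists_pair_tgt v
    have hab : a ≠ b := by rintro rfl; exact inLT_asymm h h
    have hca : c ≠ a := by rintro rfl; exact inLT_asymm hc hc
    have hcb : c ≠ b := by rintro rfl; exact inLT_asymm h hc
    rcases hxy a ha with rfl | rfl <;> rcases hxy b hb with rfl | rfl <;>
      rcases hxy c hc' with rfl | rfl <;> simp_all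
  · rintro ⟨v, ha, hb, hna, c, hc⟩
    have hab : a ≠ b := by rintro rfl; exact hna ⟨c, hc⟩
    exact (inLT_trichotomy hZ ha hb hab).resolve_right fun h => hna ⟨b, h⟩

theorem outLT_iff_outTwo (hZ : Z.IsLegGraph) (a b : Z.Edge) : F.outLT a b ↔
    ∃ v, Z.dag.src a = .inner v ∧ Z.dag.src b = .inner v ∧ ¬ F.OutTwo a ∧ F.OutTwo b := by
  constructor
  · intro h
    obtain ⟨v, ha, hb⟩ := outLT_src hZ h
    refine ⟨v, ha, hb, ?_, a, h⟩
    rintro ⟨c, hc⟩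
    obtain ⟨w, hc', ha'⟩ := outLT_src hZ hc
    obtain rfl := Vertex.inner.inj (ha.symm.trans ha')
    obtain ⟨x, y, -, -, -, hxy⟩ := hZ.exists_pair_src v
    have hab : a ≠ b := by rintro rfl; exact outLT_asymm h h
    have hca : c ≠ a := by rintro rfl; exact outLT_asymm hc hc
    have hcb : c ≠ b := by rintro rfl; exact outLT_asymm h hc
    rcases hxy a ha with rfl | rfl <;> rcases hxy b hb with rfl | rfl <;>
      rcases hxy c hc' with rfl | rfl <;> simp_all
  · rintro ⟨v, ha, hb, hna, c, hc⟩
    have hab : a ≠ b := by rintro rfl; exact hna ⟨c, hc⟩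
    exact (outLT_trichotomy hZ ha hb hab).resolve_right fun h => hna ⟨b, h⟩

/-- An exceptional route leaves a common part with the label with which it enters it. -/
theorem inTwo_iff_outTwo_of_splice (hZ : Z.IsLegGraph) {R : Z.dag.Route} (hR : F.IsExceptional R)
    {p q c : List Z.Edge} {e f : Z.Edge} (hpq : R.edges = p ++ e :: (c ++ f :: q))
    {v w : Fin Z.n} (he : Z.dag.tgt e = .inner v) (hf : Z.dag.src f = .inner w)
    (hS : ∀ a b, Z.dag.tgt a = .inner v → Z.dag.src b = .inner w →
      ∃ (S : Z.dag.Route) (p' q' : List Z.Edge), S.edges = p' ++ a :: (c ++ b :: q')) :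
    F.InTwo e ↔ F.OutTwo f := by
  -- A route through the other edges a and b at the two ends of the common part would conflict with
  -- R if the labels of e and f differed.
  obtain ⟨a, hae, ha⟩ : ∃ a, e ≠ a ∧ Z.dag.tgt a = .inner v := by
    obtain ⟨x, y, hxy, hx, hy, -⟩ := hZ.exists_pair_tgt v
    by_cases hex : e = x
    · exact ⟨y, by rwa [hex], hy⟩
    · exact ⟨x, hex, hx⟩
  obtain ⟨b, hbf, hb⟩ : ∃ b, f ≠ b ∧ Z.dag.src b = .inner w := by
    obtain ⟨x, y, hxy, hx, hy, -⟩ := hZ.exists_pair_src w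
    by_cases hfx : f = x
    · exact ⟨y, by rwa [hfx], hy⟩
    · exact ⟨x, hfx, hx⟩
  obtain ⟨S, p', q', hSe⟩ := hS a b ha hb
  have hin : ∀ {x y : Z.Edge} {p p' : List Z.Edge}, F.inLT x y →
      F.PrecIn (p ++ [x]) (p' ++ [y]) := fun {x y p p'} h => ⟨p, p', [], x, y, rfl, rfl, h⟩
  have hout : ∀ {x y : Z.Edge} {q q' : List Z.Edge}, F.outLT x y →
      F.PrecOut (x :: q) (y :: q') := fun {x y q q'} h => ⟨[], q, q', x, y, rfl, rfl, h⟩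
  have hR' : R.edges = (p ++ [e]) ++ c ++ f :: q := by rw [hpq]; simp
  have hS' : S.edges = (p' ++ [a]) ++ c ++ b :: q' := by rw [hSe]; simp
  constructor
  · intro h1
    by_contra h2
    have h3 : F.inLT a e := (inLT_trichotomy hZ ha he hae.symm).resolve_right fun h =>
      ((inLT_iff_inTwo hZ _ _).1 h).elim fun _ h' => h'.2.2.1 h1
    have h4 : F.outLT f b := (outLT_trichotomy hZ hf hb hbf).resolve_right fun h => h2 ⟨b, h⟩
    exact hR S ⟨_, _, c, _, _, hR', hS', Or.inr ⟨hin h3, hout h4⟩⟩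
  · intro h1
    by_contra h2
    have h3 : F.inLT e a := (inLT_trichotomy hZ he ha hae).resolve_right fun h => h2 ⟨a, h⟩
    have h4 : F.outLT b f := (outLT_trichotomy hZ hb hf hbf.symm).resolve_right fun h =>
      ((outLT_iff_outTwo hZ _ _).1 h).elim fun _ h' => h'.2.2.1 h1
    exact hR S ⟨_, _, c, _, _, hR', hS', Or.inl ⟨hin h3, hout h4⟩⟩

/-- For an ample framing, the labels of an inner edge at its ends agree. -/
theorem inTwo_iff_outTwo (hZ : Z.IsLegGraph)
    (hex : ∀ e, ∃ R : Z.dag.Route, F.IsExceptional R ∧ e ∈ R.edges) (j : Fin Z.m) :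
    F.InTwo (.inl j : Z.Edge) ↔ F.OutTwo (.inl j : Z.Edge) := by
  obtain ⟨R, hR, hj⟩ := hex (.inl j)
  obtain ⟨p, q, hpq⟩ := List.append_of_mem hj
  obtain ⟨p, x, rfl, hx⟩ := exists_pred (v := Z.tail j) hZ hpq rfl
  obtain ⟨y, q, rfl, hy⟩ := exists_succ (v := Z.head j) hZ hpq rfl
  have h1 : R.edges = p ++ x :: ([] ++ .inl j :: y :: q) := by rw [hpq]; simp
  have h2 : R.edges = (p ++ [x]) ++ .inl j :: ([] ++ y :: q) := by rw [hpq]; simp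
  have h3 : R.edges = p ++ x :: ([.inl j] ++ y :: q) := by rw [hpq]; simp
  -- The exceptional route links the labels at the head of `j`, at its tail and across `j`, where x
  -- and y are its neighbouring edges.
  rw [inTwo_iff_outTwo_of_splice hZ hR h2 rfl hy fun a b ha hb => exists_route_through hZ ha hb,
    ← inTwo_iff_outTwo_of_splice hZ hR h1 hx rfl fun a b ha hb => exists_route_through hZ ha hb,
    inTwo_iff_outTwo_of_splice hZ hR h3 hx hy fun a b ha hb => ?_]
  obtain ⟨S, r, r', hS⟩ := exists_route_through (b := .inl j) hZ ha rfl
  obtain ⟨T, t, t', hT⟩ := exists_route_through (a := .inl j) hZ rfl hb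
  have hS' : S.edges = (r ++ [a]) ++ .inl j :: r' := by rw [hS]; simp
  obtain ⟨U, hU⟩ := exists_splice (v := Z.tail j) hZ hS' hT rfl rfl
  exact ⟨U, r, t', by rw [hU]; simp⟩

/-- An ample framing is given by a labelling of the edges. -/
theorem exists_isEdgeLabeling (hZ : Z.IsLegGraph)
    (hex : ∀ e, ∃ R : Z.dag.Route, F.IsExceptional R ∧ e ∈ R.edges) :
    ∃ lab, IsEdgeLabeling F lab true ∧ ∀ j : Fin Z.m, lab (.inl j) = true ↔ F.InTwo (.inl j) := by
  classical
  have hin : ∀ {e : Z.Edge} {v : Fin Z.n}, Z.dag.tgt e = .inner v →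
      (F.InTwo e ∨ F.OutTwo e ↔ F.InTwo e) := by
    intro e v he
    refine or_iff_left_of_imp fun h => ?_
    obtain ⟨a, ha⟩ := h
    obtain ⟨u, -, hu⟩ := outLT_src hZ ha
    obtain ⟨j, rfl, -⟩ := exists_eq_inl hu he
    exact (inTwo_iff_outTwo hZ hex j).2 ⟨a, ha⟩
  have hout : ∀ {e : Z.Edge} {v : Fin Z.n}, Z.dag.src e = .inner v →
      (F.InTwo e ∨ F.OutTwo e ↔ F.OutTwo e) := by
    intro e v he
    refine or_iff_right_of_imp fun h => ?_
    obtain ⟨a, ha⟩ := h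
    obtain ⟨u, -, hu⟩ := inLT_tgt hZ ha
    obtain ⟨j, rfl, -⟩ := exists_eq_inl he hu
    exact (inTwo_iff_outTwo hZ hex j).1 ⟨a, ha⟩
  -- The disjunction serves source and sink edges, which carry a label at one end only.
  refine ⟨fun e => decide (F.InTwo e ∨ F.OutTwo e), ⟨fun a b => ?_, fun a b => ?_⟩, fun j => ?_⟩
  · rw [inLT_iff_inTwo hZ]
    refine exists_congr fun v => and_congr_right fun ha => and_congr_right fun hb => ?_
    rw [Bool.not_true, decide_eq_false_iff_not, decide_eq_true_iff, hin ha, hin hb]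
  · rw [outLT_iff_outTwo hZ]
    refine exists_congr fun v => and_congr_right fun ha => and_congr_right fun hb => ?_
    rw [Bool.not_true, decide_eq_false_iff_not, decide_eq_true_iff, hout ha, hout hb]
  · rw [decide_eq_true_iff]
    exact hin (v := Z.head j) rfl

theorem IsEdgeLabeling.flip {lab : Z.Edge → Bool} {β : Bool} (h : IsEdgeLabeling F lab β) :
    IsEdgeLabeling F (fun e => !lab e) (!β) where
  inLT_iff a b := by
    rw [h.inLT_iff]
    cases β <;> simp
  outLT_iff a b := by
    rw [h.outLT_iff]
    cases β <;> simp

/-- Along a leg of a locally anti-blocking framing the label does not drop. -/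
theorem IsEdgeLabeling.not_drop {lab : Z.Edge → Bool} {β : Bool} (h : IsEdgeLabeling F lab β)
    (hZ : Z.IsLegGraph) (hF : IsLocallyAntiBlocking F.gPolytope) {j k : Fin Z.m}
    (hjk : Z.head j = Z.tail k) : ¬ (lab (.inl j) = true ∧ lab (.inl k) = false) := by
  classical
  rintro ⟨hj, hk⟩
  -- Write δ_v for -sign β times the coordinate at v; for a route through v this is the outgoing
  -- minus the incoming label. Then δ_a + δ_b + δ_c ≤ 1 holds on the polytope. The route T with
  -- successive labels `false`, `true`, `false`, `true` has δ = 1, -1, 1 at these vertices;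
  -- anti-blocking would allow the middle entry to be replaced by 0, making the sum 2.
  let a := innerVertex hZ (Z.tail j)
  let b := innerVertex hZ (Z.head j)
  let c := innerVertex hZ (Z.head k)
  have hnum : ∀ x : Bool, 0 ≤ num x ∧ num x ≤ 1 := by intro x; cases x <;> simp [num]
  have hpassv : ∀ (R : Z.dag.Route) (v : Z.dag.InnerVertex),
      F.gVector R v = 0 ∨ ∃ (p q : List Z.Edge) (e f : Z.Edge), R.edges = p ++ e :: f :: q ∧
        Z.dag.tgt e = v.1 ∧ Z.dag.src f = v.1 ∧
        - (sign β * F.gVector R v) = num (lab f) - num (lab e) := by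
    intro R v
    by_cases hpass : ∃ e ∈ R.edges, Z.dag.tgt e = v.1
    · obtain ⟨e, he, hev⟩ := hpass
      obtain ⟨u, hu⟩ := exists_val_eq hZ v
      obtain ⟨p, q, hpq⟩ := List.append_of_mem he
      obtain ⟨f, q, rfl, hf⟩ := exists_succ hZ hpq (hev.trans hu)
      refine Or.inr ⟨p, q, e, f, hpq, hev, hf.trans hu.symm, ?_⟩
      rw [h.gVector_of_pass hZ hpq hev]
      cases β <;> simp [sign]
    · push Not at hpass
      exact Or.inl (gVector_of_not_pass hpass)
  have hδ : ∀ (R : Z.dag.Route) (v : Z.dag.InnerVertex) (p q : List Z.Edge) (e f : Z.Edge),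
      R.edges = p ++ e :: f :: q → Z.dag.tgt e = v.1 →
      - (sign β * F.gVector R v) = num (lab f) - num (lab e) := by
    intro R v p q e f hpq he
    rw [h.gVector_of_pass hZ hpq he]
    cases β <;> simp [sign]
  have hbound : ∀ R : Z.dag.Route, - (sign β * F.gVector R a) + - (sign β * F.gVector R b) +
      - (sign β * F.gVector R c) ≤ 1 := by
    intro R
    -- A route that avoids `j` can leave a only by the edge labelled `false`, so δ_a ≤ 0; likewise
    -- δ_c ≤ 0 for a route that avoids `k`. Along the edges that are used, the sum telescopes to a
    -- difference of two labels.
    have ha0 : .inl j ∉ R.edges → - (sign β * F.gVector R a) ≤ 0 := by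
      intro hjR
      rcases hpassv R a with h0 | ⟨p, q, e, f, hpq, he, hf, h0⟩
      · simp [h0]
      · have : lab f = false := by
          have := h.out_ne hZ (a := f) (b := .inl j) (v := Z.tail j) hf rfl
            (by rintro rfl; exact hjR (by rw [hpq]; simp))
          rw [hj] at this
          simpa using this
        rw [h0, this]
        have := hnum (lab e)
        simp only [num, Bool.false_eq_true, if_false] at this ⊢
        linarith
    have hc0 : .inl k ∉ R.edges → - (sign β * F.gVector R c) ≤ 0 := by
      intro hjR
      rcases hpassv R c with h0 | ⟨p, q, e, f, hpq, he, hf, h0⟩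
      · simp [h0]
      · have : lab e = true := by
          have := h.in_ne hZ (a := e) (b := .inl k) (v := Z.head k) he rfl
            (by rintro rfl; exact hjR (by rw [hpq]; simp))
          rw [hk] at this
          simpa using this
        rw [h0, this]
        have := hnum (lab f)
        simp only [num, if_true] at this ⊢
        linarith
    by_cases hjR : .inl j ∈ R.edges
    · obtain ⟨p, q, hpq⟩ := List.append_of_mem hjR
      obtain ⟨p, x, rfl, hx⟩ := exists_pred (v := Z.tail j) hZ hpq rfl
      obtain ⟨f, q, rfl, hf⟩ := exists_succ (v := Z.head j) hZ hpq rfl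
      have h1 := hδ R a p (f :: q) x (.inl j) (by rw [hpq]; simp) hx
      have h2 := hδ R b _ _ (.inl j) f hpq rfl
      have hx1 := hnum (lab x)
      by_cases hkR : .inl k ∈ R.edges
      · have hfk : f = .inl k := eq_of_src_eq (R := R) hZ (by rw [hpq]; simp) hkR
          (by rw [hf, hjk]; rfl)
        subst hfk
        have hpq' : R.edges = ((p ++ [x]) ++ [.inl j]) ++ .inl k :: q := by rw [hpq]; simp
        obtain ⟨y, q, rfl, hy⟩ := exists_succ (v := Z.head k) hZ hpq' rfl
        have h3 := hδ R c _ _ (.inl k) y hpq' rfl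
        have hy1 := hnum (lab y)
        linarith
      · have h3 := hc0 hkR
        have hf1 := hnum (lab f)
        linarith
    · have h1 := ha0 hjR
      by_cases hkR : .inl k ∈ R.edges
      · obtain ⟨p, q, hpq⟩ := List.append_of_mem hkR
        obtain ⟨p, x, rfl, hx⟩ := exists_pred (v := Z.tail k) hZ hpq rfl
        obtain ⟨y, q, rfl, hy⟩ := exists_succ (v := Z.head k) hZ hpq rfl
        have h2 := hδ R b p (y :: q) x (.inl k) (by rw [hpq]; simp) (by rw [hx, ← hjk]; rfl)
        have h3 := hδ R c _ _ (.inl k) y hpq rfl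
        have hx1 := hnum (lab x)
        have hy1 := hnum (lab y)
        linarith
      · have h3 := hc0 hkR
        rcases hpassv R b with h0 | ⟨p, q, e, f, hpq, he, hf, h0⟩
        · rw [h0, mul_zero]
          linarith
        · have hx1 := hnum (lab e)
          have hy1 := hnum (lab f)
          linarith
  have hP : ∀ z ∈ F.gPolytope, - (sign β * z a) + - (sign β * z b) + - (sign β * z c) ≤ 1 := by
    have hconv : Convex ℝ {z : Z.dag.InnerVertex → ℝ |
        - (sign β * z a) + - (sign β * z b) + - (sign β * z c) ≤ 1} := by
      refine convex_halfSpace_le (𝕜 := ℝ) (f := fun z : Z.dag.InnerVertex → ℝ =>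
        - (sign β * z a) + - (sign β * z b) + - (sign β * z c)) ⟨fun x y => ?_, fun r x => ?_⟩ 1
      · simp only [Pi.add_apply]; ring
      · simp only [Pi.smul_apply, smul_eq_mul]; ring
    exact fun z hz => convexHull_min (by rintro _ ⟨R, rfl⟩; exact hbound R) hconv hz
  obtain ⟨x, hx, hlx⟩ := h.exists_in hZ (Z.tail j) false
  obtain ⟨y, hy, hly⟩ := h.exists_out hZ (Z.head k) true
  obtain ⟨S₁, p₁, q₁, hS₁⟩ := exists_route_through (b := .inl j) hZ hx rfl
  obtain ⟨S₂, p₂, q₂, hS₂⟩ := exists_route_through (a := .inl j) (b := .inl k) (v := Z.head j) hZ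
    rfl (by rw [hjk]; rfl)
  obtain ⟨S₃, p₃, q₃, hS₃⟩ := exists_route_through (a := .inl k) hZ rfl hy
  have hS₁' : S₁.edges = (p₁ ++ [x]) ++ .inl j :: q₁ := by rw [hS₁]; simp
  obtain ⟨T₁, hT₁⟩ := exists_splice (v := Z.tail j) hZ hS₁' hS₂ rfl rfl
  have hT₁' : T₁.edges = ((p₁ ++ [x]) ++ [.inl j]) ++ .inl k :: q₂ := by rw [hT₁]; simp
  obtain ⟨T, hT⟩ := exists_splice (v := Z.tail k) hZ hT₁' hS₃ rfl rfl
  have hTa := hδ T a p₁ (.inl k :: y :: q₃) x (.inl j) (by rw [hT]; simp) hx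
  have hTb := hδ T b (p₁ ++ [x]) (y :: q₃) (.inl j) (.inl k) (by rw [hT]; simp) rfl
  have hTc := hδ T c _ _ (.inl k) y hT rfl
  rw [hlx, hj] at hTa
  rw [hj, hk] at hTb
  rw [hk, hly] at hTc
  simp only [num, if_true, if_false, Bool.false_eq_true, sub_zero, zero_sub] at hTa hTb hTc
  have hab : a ≠ b := by
    intro hab
    rw [hab] at hTa
    linarith
  have hcb : c ≠ b := by
    intro hcb
    rw [hcb] at hTc
    linarith
  -- The sign vector that moves the g-vector of T into the nonnegative orthant.
  let σ : Z.dag.InnerVertex → ℝ := fun v => if F.gVector T v < 0 then -1 else 1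
  have hσ : ∀ v, σ v = 1 ∨ σ v = -1 := by
    intro v
    simp only [σ]
    split_ifs <;> simp
  have hσ0 : ∀ v, 0 ≤ σ v * F.gVector T v := by
    intro v
    simp only [σ]
    split_ifs with hv <;> linarith
  obtain ⟨⟨z, hz, hzy⟩, -⟩ := hF σ hσ (σ * F.gVector T)
    ⟨⟨_, subset_convexHull ℝ _ ⟨T, rfl⟩, rfl⟩, hσ0⟩
    (fun v => if v = b then 0 else σ v * F.gVector T v) fun v => by
      split_ifs
      · exact ⟨le_rfl, hσ0 v⟩
      · exact ⟨hσ0 v, le_rfl⟩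
  have hσne : ∀ v, σ v ≠ 0 := by
    intro v
    rcases hσ v with hv | hv <;> rw [hv] <;> norm_num
  have hzv : ∀ v, v ≠ b → z v = F.gVector T v := by
    intro v hv
    have := congrFun hzy v
    simp only [Pi.mul_apply, if_neg hv] at this
    exact mul_left_cancel₀ (hσne v) this
  have hzb : z b = 0 := by
    have := congrFun hzy b
    simp only [Pi.mul_apply, if_true] at this
    exact (mul_eq_zero.1 this).resolve_left (hσne b)
  have := hP z hz
  rw [hzv a hab, hzv c hcb, hzb, mul_zero, hTa, hTc] at this
  norm_num at this

/-- Interchanging the labels turns a rise into a drop, so both are excluded. -/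
theorem IsEdgeLabeling.lab_eq_of_head_eq_tail {lab : Z.Edge → Bool} {β : Bool}
    (h : IsEdgeLabeling F lab β) (hZ : Z.IsLegGraph) (hF : IsLocallyAntiBlocking F.gPolytope)
    {j k : Fin Z.m} (hjk : Z.head j = Z.tail k) : lab (.inl j) = lab (.inl k) := by
  have h1 := h.not_drop hZ hF hjk
  have h2 := h.flip.not_drop hZ hF hjk
  revert h1 h2
  cases lab (.inl j) <;> cases lab (.inl k) <;> simp

/-- The labels of the inner edges of a locally anti-blocking framing are determined by their
directions. -/
theorem IsEdgeLabeling.lab_eq_up {lab : Z.Edge → Bool} {β : Bool}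
    (h : IsEdgeLabeling F lab β) (hZ : Z.IsLegGraph) (hF : IsLocallyAntiBlocking F.gPolytope) :
    ∃ γ, ∀ j : Fin Z.m, lab (.inl j) = (Z.up j == γ) := by
  have hstep : ∀ j k : Fin Z.m, (k : ℕ) = j + 1 →
      (lab (.inl j) == Z.up j) = (lab (.inl k) == Z.up k) := by
    intro j k hk
    have hlo : Z.hi j = Z.lo k := by
      refine Fin.ext ?_
      have h1 := hZ.lo_val k
      have h2 := hZ.hi_val j
      have h3 := k.2
      omega
    have hne : (.inl j : Z.Edge) ≠ .inl k := by
      intro h'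
      rw [Sum.inl.inj h'] at hk
      omega
    -- Edges with the same direction are consecutive on a leg and have equal labels. Edges with
    -- opposite directions share their tail or their head, where the labels must differ.
    cases hj : Z.up j <;> cases hk : Z.up k
    · have := h.lab_eq_of_head_eq_tail hZ hF (j := k) (k := j) (by simp [head, tail, hj, hk, hlo])
      rw [this]
    · have := h.out_ne hZ (a := .inl j) (b := .inl k) (v := Z.hi j)
        (by rw [dag_src_inl]; simp [tail, hj]) (by rw [dag_src_inl]; simp [tail, hk, hlo]) hne
      revert this
      cases lab (.inl j) <;> cases lab (.inl k) <;> simp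
    · have := h.in_ne hZ (a := .inl j) (b := .inl k) (v := Z.hi j)
        (by rw [dag_tgt_inl]; simp [head, hj]) (by rw [dag_tgt_inl]; simp [head, hk, hlo]) hne
      revert this
      cases lab (.inl j) <;> cases lab (.inl k) <;> simp
    · have := h.lab_eq_of_head_eq_tail hZ hF (j := j) (k := k) (by simp [head, tail, hj, hk, hlo])
      rw [this]
  let j₀ : Fin Z.m := ⟨0, hZ.m_pos⟩
  have hall : ∀ (i : ℕ) (hi : i < Z.m),
      (lab (.inl ⟨i, hi⟩) == Z.up ⟨i, hi⟩) = (lab (.inl j₀) == Z.up j₀) := by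
    intro i
    induction i with
    | zero => intro hi; rfl
    | succ i ih =>
      intro hi
      rw [← ih (by omega)]
      exact (hstep ⟨i, by omega⟩ ⟨i + 1, hi⟩ rfl).symm
  refine ⟨lab (.inl j₀) == Z.up j₀, fun j => ?_⟩
  rw [← hall j j.2]
  cases lab (.inl j) <;> cases Z.up j <;> rfl

theorem exists_isLabeling (hZ : Z.IsLegGraph)
    (hex : ∀ e, ∃ R : Z.dag.Route, F.IsExceptional R ∧ e ∈ R.edges)
    (hF : IsLocallyAntiBlocking F.gPolytope) : ∃ lab β, IsLabeling F lab β := by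
  obtain ⟨lab, h, hlab⟩ := exists_isEdgeLabeling hZ hex
  obtain ⟨γ, hγ⟩ := h.lab_eq_up hZ hF
  have hstd : F.IsStandard ↔ γ = true := by
    unfold Framing.IsStandard
    simp only [← hlab, hγ]
    constructor
    · intro h'
      have := h' ⟨0, hZ.m_pos⟩
      revert this
      cases Z.up ⟨0, hZ.m_pos⟩ <;> cases γ <;> simp
    · rintro rfl j
      cases Z.up j <;> simp
  -- For γ = `false` the upward edges have label 1, and flipping the labelling makes them `true`.
  cases γ
  · refine ⟨_, _, h.flip, fun j => ?_, hstd⟩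
    rw [hγ]
    cases Z.up j <;> rfl
  · refine ⟨lab, true, h, fun j => ?_, hstd⟩
    rw [hγ]
    cases Z.up j <;> rfl

end Ample

end Zigzag
end GPoly

/-! ### The theorem on the DKK triangulation -/

theorem theorem4p16 (Z : Zigzag) (hZ : Z.IsPath ∨ Z.IsCycle) (F : Framing Z.dag)
    (hample : F.IsAmple) (hlab : IsLocallyAntiBlocking F.gPolytope) :
    IsPullingTriangulation F.gPolytope F.dkk ∧
      (∀ T ∈ F.dkk, IsUnimodularSimplex T) ∧
      (∃ L : List Z.dag.Route, F.IsDiagonalOrder L) ∧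
      ∀ L : List Z.dag.Route, F.IsDiagonalOrder L →
        pullSeq F.gPolytope (0 :: L.map F.gVector) = F.dkk := by
  classical
  have hG := Zigzag.isLegGraph hZ
  have hex := Zigzag.exists_exceptional_of_isAmple hG hample
  obtain ⟨lab, β, h⟩ := Zigzag.exists_isLabeling hG hex hlab
  have := hG.finite_route
  have := Fintype.ofFinite Z.dag.Route
  have := hG.finite_innerVertex
  have := Fintype.ofFinite Z.dag.InnerVertex
  have := hG.nonempty_innerVertex
  have hfan := h.isRootFan hG hex
  have hmem : ∀ L : List Z.dag.Route, F.IsDiagonalOrder L → ∀ R, R ∈ L ↔ F.gVector R ≠ 0 :=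
    fun L hL R => (hL.2.1 R).trans (not_congr (h.gVector_eq_zero_iff hG R)).symm
  have hpull : ∀ L : List Z.dag.Route, F.IsDiagonalOrder L →
      pullSeq F.gPolytope (0 :: L.map F.gVector) = F.dkk := fun L hL =>
    hfan.pullSeq_eq_cells hL.1 (hmem L hL) (h.resolves hG hex hL)
  obtain ⟨L, hL⟩ := h.exists_isDiagonalOrder hG hex
  refine ⟨⟨?_, 0 :: L.map F.gVector, ?_, hpull L hL⟩, ?_, ⟨L, hL⟩, hpull⟩
  · exact hfan.isTriangulation_cells hL.1 (hmem L hL) (h.resolves hG hex hL)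
  · intro x hx
    rcases List.mem_cons.1 hx with rfl | hx
    · obtain ⟨R, hR⟩ := hfan.exists_zero
      rw [← hR]
      exact subset_convexHull ℝ _ ⟨R, rfl⟩
    · obtain ⟨R, -, rfl⟩ := List.mem_map.1 hx
      exact subset_convexHull ℝ _ ⟨R, rfl⟩
  · intro T hT
    exact hfan.isUnimodularSimplex_cells hL.1 (hmem L hL) (h.resolves hG hex hL) hT
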